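/- **Setting.** $M\ge 1$ transmitters (TXs), TX $j$ having $N_j$ antennas ($N_T=\sum_j N_j$), jointly serve $K$ single-antenna receivers (RXs). The channel $\mathbf H\in\mathbb C^{K\times N_T}$, with rows $\mathbf h_1,\dots,\mathbf h_K$, has i.i.d. $\mathcal{CN}(0,1)$ entries. At SNR $P$, with $\bar P=\sqrt P$, TX $j$ knows only $$\hat{\mathbf H}^{(j)}=\sqrt{1-(z^{(j)})^2}\,\mathbf H+z^{(j)}\boldsymbol\Delta^{(j)},\qquad z^{(j)}=\bar P^{-\alpha^{(j)}},$$ where each $\boldsymbol\Delta^{(j)}$ has i.i.d. $\mathcal{CN}(0,1)$ entries and is independent of $\mathbf H$, and $1\ge\alpha^{(1)}>\dots>\alpha^{(M)}$. A precoding matrix $\mathbf T\in\mathbb C^{N_T\times K}$ with columns $\mathbf t_1,\dots,\mathbf t_K$ must satisfy the per-antenna constraint that each of its rows has Euclidean norm at most $1$. Its expected sum rate is $$\sum_{i=1}^K\mathbb E\Big[\log_2\Big(1+\frac{P|\mathbf h_i\mathbf t_i|^2}{1+\sum_{l\ne i}P|\mathbf h_i\mathbf t_l|^2}\Big)\Big].$$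 **Centralized ZF.** Let $\mathcal V:\mathbb C^{K\times N_T}\to\mathbb C^{N_T\times K}$ be a precoding algorithm whose values satisfy the per-antenna constraint and whose entries are built from the channel estimate and constants by conjugation, sums, products, norms and generalized (Moore–Penrose) inverses. Let $\mathbf v_1,\dots,\mathbf v_K$ be the columns of $\mathcal V(\hat{\mathbf H})$, where $\hat{\mathbf H}$ (with rows $\hat{\mathbf h}_i$) has i.i.d. $\mathcal{CN}(0,1)$ entries, which is the law of every estimate. Assume that (ZF1) $\hat{\mathbf h}_i\mathbf v_l=0$ almost surely for all $l\neq i$; (ZF2) $\mathbb E\big[|(\mathbf v_i)_a|^{-1}\big]<\infty$ for every $i$ and every antenna $a$; (ZF3) $\|\mathbf v_i\|$ has a bounded density for every $i$; and that $\hat{\mathbf h}_i\mathbf v_i\neq0$ almost surely for every $i$. Let $R^\star(\alpha^{(1)})$ be the expected sum rate at SNR $P$ of the precoder $\mathcal V(\hat{\mathbf H}^{(1)})$ (ideal centralized setting: every TX holds the best estimate $\hat{\mathbf H}^{(1)}$). **CD-ZF.** Fix $0<\alpha_\mu<\alpha_q<\alpha^{(M)}$ and a back-off $\mu=\mu(P)\in(0,1)$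 with $1-\mu=\Theta(\bar P^{-\alpha_\mu})$. Let $\mathcal Q$ round the real and imaginary part $x$ of each entry to $q\lfloor x/q+\tfrac12\rfloor$, where $q=\bar P^{-\alpha_q}$. Each TX $j\ge2$ applies its own rows of $\mu\,\mathcal V(\mathcal Q(\hat{\mathbf H}^{(j)}))$. For each $j\geq 2$, TX 1 computes from $\hat{\mathbf H}^{(1)}$ the maximum a posteriori estimate of $\mathcal Q(\hat{\mathbf H}^{(j)})$. Let $\mathbf w_{l,\bar1}$ be the vector that consists of the coefficients (without the factor $\mu$) which the TXs $2,\dots,M$ would apply to the symbols of RX $l$ if these MAP estimates were correct. TX 1 then applies to the symbols of RX $l$ the vector $\mu\mathbf w_{l,1}$, where $$\mathbf w_{l,1}=\mathbf v_{l,1}+\hat{\mathbf H}_{\bar l,1}^{\dagger}\,\hat{\mathbf H}_{\bar l,\bar1}\,(\mathbf v_{l,\bar1}-\mathbf w_{l,\bar1}).$$ Here $\mathbf v_l$ is column $l$ of $\mathcal V(\hat{\mathbf H}^{(1)})$, the subscripts $1$ and $\bar1$ select the antennas of TX 1 and of the other TXs, and $\hat{\mathbf H}_{\bar l}$ is $\hat{\mathbf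 H}^{(1)}$ without row $l$. If these vectors violate the power constraint at TX 1, then TX 1 uses instead an arbitrary (measurable) function of $\hat{\mathbf H}^{(1)}$ that satisfies it. Let $R(\boldsymbol\alpha_M)$ be the expected sum rate of the resulting precoder at SNR $P$. **Theorem 1.** If $N_1\ge K-1$ and $\alpha^{(M)}>0$, then for $P>1$ both precoders satisfy the power constraint and both expected sum rates are finite, and $$\lim_{P\to\infty}\big(R^\star(\alpha^{(1)})-R(\boldsymbol\alpha_M)\big)=0.$$ Consequently the two settings have the same affine expansions $\mathrm{DoF}\cdot\log_2P-\mathcal R_\infty+o(1)$ of the rate, and in particular the same rate offset $\mathcal R_\infty$. -/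

import Mathlib

open MeasureTheory ProbabilityTheory Filter Topology Asymptotics
open scoped Matrix ENNReal NNReal

namespace NetworkMISO

noncomputable section

/-! ### Complex matrices: measurable structure, Moore-Penrose inverse -/

instance instMeasurableSpaceMatrix {κ ν : Type*} : MeasurableSpace (Matrix κ ν ℂ) :=
  inferInstanceAs (MeasurableSpace (κ → ν → ℂ))

instance instStandardBorelSpaceMatrix {κ ν : Type*} [Fintype κ] [Fintype ν] :
    StandardBorelSpace (Matrix κ ν ℂ) :=
  inferInstanceAs (StandardBorelSpace (κ → ν → ℂ))

/-- The four Penrose equations: `X` is the Moore-Penrose inverse of `A`. -/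
structure IsMoorePenrose {κ ν : Type*} [Fintype κ] [Fintype ν]
    (A : Matrix κ ν ℂ) (X : Matrix ν κ ℂ) : Prop where
  mul_mul : A * X * A = A
  mul_mul' : X * A * X = X
  hermitian_left : (A * X)ᴴ = A * X
  hermitian_right : (X * A)ᴴ = X * A

open scoped ComplexOrder in
theorem exists_isMoorePenrose {κ ν : Type*} [Fintype κ] [Fintype ν] (A : Matrix κ ν ℂ) :
    ∃ X, IsMoorePenrose A X := by
  classical
  set B : Matrix ν ν ℂ := Aᴴ * A with hB
  have hBsa : IsSelfAdjoint B := Matrix.isHermitian_conjTranspose_mul_self A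
  have hfin : (spectrum ℝ B).Finite :=
    Matrix.finite_real_spectrum (A := B)
  have hc : ∀ f : ℝ → ℝ, ContinuousOn f (spectrum ℝ B) := fun f => hfin.continuousOn f
  set G : Matrix ν ν ℂ := cfc (fun x : ℝ => x⁻¹) B with hG
  have hid : cfc (fun x : ℝ => x) B = B := cfc_id' ℝ B
  have hGsa : Gᴴ = G := (cfc_predicate (fun x : ℝ => x⁻¹) B : IsSelfAdjoint _)
  have hGB : G * B = cfc (fun x : ℝ => x⁻¹ * x) B := by
    rw [cfc_mul (fun x : ℝ => x⁻¹) (fun x => x) B (hc _) (hc _), hid]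
  have hGBsa : (G * B)ᴴ = G * B := by
    rw [hGB]
    exact (cfc_predicate (fun x : ℝ => x⁻¹ * x) B : IsSelfAdjoint _)
  have hBGB : B * (G * B) = B := by
    rw [hGB]
    conv_lhs => rw [← hid]
    rw [hid, ← hid, hid]
    conv_lhs => enter [1]; rw [← hid]
    rw [← cfc_mul (fun x : ℝ => x) (fun x => x⁻¹ * x) B (hc _) (hc _)]
    conv_rhs => rw [← hid]
    congr 1
    funext x
    by_cases hx : x = 0
    · simp [hx]
    · field_simp
  have hGBG : G * B * G = G := by
    rw [hGB, hG, ← cfc_mul (fun x : ℝ => x⁻¹ * x) (fun x => x⁻¹) B (hc _) (hc _)]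
    congr 1
    funext x
    by_cases hx : x = 0
    · simp [hx]
    · field_simp
  have key : A * (G * B) - A = 0 := by
    rw [← Matrix.conjTranspose_mul_self_eq_zero]
    have h1 : Aᴴ * (A * (G * B) - A) = 0 := by
      rw [Matrix.mul_sub, ← Matrix.mul_assoc, ← hB, hBGB, sub_self]
    rw [Matrix.conjTranspose_sub, Matrix.conjTranspose_mul, Matrix.sub_mul, Matrix.mul_assoc, h1]
    simp
  refine ⟨G * Aᴴ, ?_, ?_, ?_, ?_⟩
  · have : A * (G * Aᴴ) * A = A * (G * B) := by simp only [hB, Matrix.mul_assoc]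
    rw [this]
    exact sub_eq_zero.mp key
  · have : G * Aᴴ * A * (G * Aᴴ) = G * B * G * Aᴴ := by simp only [hB, Matrix.mul_assoc]
    rw [this, hGBG]
  · rw [Matrix.conjTranspose_mul, Matrix.conjTranspose_mul, Matrix.conjTranspose_conjTranspose,
      hGsa, Matrix.mul_assoc]
  · have : G * Aᴴ * A = G * B := by simp only [hB, Matrix.mul_assoc]
    rw [this, hGBsa]

/-- The Moore-Penrose inverse (the unique solution of the Penrose equations). -/
def pinv {κ ν : Type*} [Fintype κ] [Fintype ν] (A : Matrix κ ν ℂ) : Matrix ν κ ℂ :=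
  (exists_isMoorePenrose A).choose

/-! ### Channel and distributed channel state information -/

/-- The transmit antennas: pairs (transmitter `j`, antenna `n` of transmitter `j`). -/
abbrev Ant {M : ℕ} (N : Fin M → ℕ) : Type := Σ j : Fin M, Fin (N j)

/-- The circularly-symmetric complex normal distribution with variance `1`. -/
def stdComplexNormal : Measure ℂ :=
  ((gaussianReal 0 (1 / 2)).prod (gaussianReal 0 (1 / 2))).map
    Complex.measurableEquivRealProd.symm

/-- The law of a random matrix with i.i.d. standard complex normal entries. -/
def stdComplexNormalMatrix (κ ν : Type*) [Fintype κ] [Fintype ν] : Measure (Matrix κ ν ℂ) :=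
  Measure.pi fun _ : κ => Measure.pi fun _ : ν => stdComplexNormal

/-- The channel `H` has i.i.d. standard complex normal entries, and so has the estimation noise
`Δ j` of every transmitter `j`, which is independent of `H`. -/
structure IsDistributedCSIT {Ω : Type*} [MeasurableSpace Ω] (μ : Measure Ω) {M K : ℕ}
    {N : Fin M → ℕ} (H : Ω → Matrix (Fin K) (Ant N) ℂ)
    (Δ : Fin M → Ω → Matrix (Fin K) (Ant N) ℂ) : Prop where
  law_channel : HasLaw H (stdComplexNormalMatrix (Fin K) (Ant N)) μ
  law_noise : ∀ j, HasLaw (Δ j) (stdComplexNormalMatrix (Fin K) (Ant N)) μ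
  indep : ∀ j, IndepFun H (Δ j) μ

/-- The channel estimate with accuracy scaling `a` at SNR `P`:
`√(1 - z²) H + z D` with `z = (√P)^(-a)`. -/
def estimate {κ ν : Type*} (P a : ℝ) (H D : Matrix κ ν ℂ) : Matrix κ ν ℂ :=
  ((√(1 - (√P ^ (-a)) ^ 2) : ℝ) : ℂ) • H + ((√P ^ (-a) : ℝ) : ℂ) • D

/-! ### Power constraint and rates

A precoding matrix `T` has one row per transmit antenna and one column per receiver. -/

/-- The per-antenna instantaneous power constraint: every row has Euclidean norm at most `1`. -/
def PowerFeasible {ι κ : Type*} [Fintype κ] (T : Matrix ι κ ℂ) : Prop :=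
  ∀ a, √(∑ i, ‖T a i‖ ^ 2) ≤ 1

/-- The instantaneous rate of receiver `i`. -/
def instRate {K : ℕ} {ν : Type*} [Fintype ν] (P : ℝ) (H : Matrix (Fin K) ν ℂ)
    (T : Matrix ν (Fin K) ℂ) (i : Fin K) : ℝ :=
  Real.logb 2 (1 + P * ‖(H * T) i i‖ ^ 2 /
    (1 + ∑ l ∈ Finset.univ.erase i, P * ‖(H * T) i l‖ ^ 2))

/-- The expected sum rate for a random channel and a random precoder. -/
def expectedSumRate {Ω : Type*} [MeasurableSpace Ω] (μ : Measure Ω) {K : ℕ} {ν : Type*}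
    [Fintype ν] (P : ℝ) (H : Ω → Matrix (Fin K) ν ℂ) (T : Ω → Matrix ν (Fin K) ℂ) : ℝ :=
  ∑ i, ∫ ω, instRate P (H ω) (T ω) i ∂μ

/-- `R(P) = DoF * log₂ P - offset + o(1)` as `P → ∞`. -/
def HasAffineExpansion (R : ℝ → ℝ) (dof offset : ℝ) : Prop :=
  Tendsto (fun P => R P - (dof * Real.logb 2 P - offset)) atTop (𝓝 0)

/-! ### Zero-forcing schemes -/

/-- Scalar functions of a matrix that are entries of matrix expressions built from the matrix and
constants by conjugation, sums, products, Euclidean (Frobenius) norms and Moore-Penrose inverses.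
(Every other generalized inverse of `A` is `A⁺ + U - A⁺ * A * U * A * A⁺` for some matrix `U`.) -/
inductive IsPrecoderExpr {κ ν : Type} : (Matrix κ ν ℂ → ℂ) → Prop
  | entry (i : κ) (a : ν) : IsPrecoderExpr fun H => H i a
  | const (c : ℂ) : IsPrecoderExpr fun _ => c
  | conj {f : Matrix κ ν ℂ → ℂ} (hf : IsPrecoderExpr f) : IsPrecoderExpr fun H => star (f H)
  | add {f g : Matrix κ ν ℂ → ℂ} (hf : IsPrecoderExpr f) (hg : IsPrecoderExpr g) :
      IsPrecoderExpr fun H => f H + g H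
  | mul {f g : Matrix κ ν ℂ → ℂ} (hf : IsPrecoderExpr f) (hg : IsPrecoderExpr g) :
      IsPrecoderExpr fun H => f H * g H
  | norm {m : ℕ} {f : Fin m → Matrix κ ν ℂ → ℂ} (hf : ∀ k, IsPrecoderExpr (f k)) :
      IsPrecoderExpr fun H => ((√(∑ k, ‖f k H‖ ^ 2) : ℝ) : ℂ)
  | pinv {m n : ℕ} {A : Fin m → Fin n → Matrix κ ν ℂ → ℂ} (hA : ∀ k l, IsPrecoderExpr (A k l))
      (l : Fin n) (k : Fin m) :
      IsPrecoderExpr fun H => NetworkMISO.pinv (Matrix.of fun k' l' => A k' l' H) l k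

/-- Zero-forcing precoding algorithms `V`, as functions of a channel estimate `H`. The law of each
channel estimate is that of a matrix with i.i.d. standard complex normal entries, whatever the
SNR, and "almost surely" and all expectations refer to that law. Column `i` of `V H` is the
precoding vector of the symbols for receiver `i`. -/
structure IsZFScheme {K : ℕ} {ν : Type} [Fintype ν]
    (V : Matrix (Fin K) ν ℂ → Matrix ν (Fin K) ℂ) : Prop where
  /-- The precoder is built by sums, products, norms and generalized inverses. -/
  expr : ∀ a i, IsPrecoderExpr fun H => V H a i
  /-- Per-antenna power constraint. -/
  power : ∀ H, PowerFeasible (V H)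
  /-- Zero-forcing condition. -/
  zero_forcing : ∀ᵐ H ∂(stdComplexNormalMatrix (Fin K) ν), ∀ i l, l ≠ i → (H * V H) i l = 0
  /-- The inverse modulus of each precoding coefficient has a finite expectation. -/
  inv_moment : ∀ a i, ∫⁻ H, ‖V H a i‖ₑ⁻¹ ∂(stdComplexNormalMatrix (Fin K) ν) < ∞
  /-- The norm of each precoding vector has a bounded probability density function. -/
  bounded_density : ∀ i, ∃ C : ℝ≥0, ∀ s : Set ℝ, MeasurableSet s →
    stdComplexNormalMatrix (Fin K) ν {H | √(∑ a, ‖V H a i‖ ^ 2) ∈ s} ≤ C * volume s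
  /-- No user is nulled by its own precoding vector. -/
  signal_ne_zero : ∀ᵐ H ∂(stdComplexNormalMatrix (Fin K) ν), ∀ i, (H * V H) i i ≠ 0

/-! ### Consistent distributed zero-forcing -/

/-- The scalar uniform quantizer with step `q`. -/
def quantizeReal (q x : ℝ) : ℝ := q * (⌊x / q + 1 / 2⌋ : ℝ)

/-- Element-wise uniform quantization of real and imaginary parts. -/
def quantize {κ ν : Type*} (q : ℝ) (A : Matrix κ ν ℂ) : Matrix κ ν ℂ :=
  A.map fun x => ⟨quantizeReal q x.re, quantizeReal q x.im⟩

/-- `e` is a maximum a posteriori estimation rule for the random matrix `Y`, with values in the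
countable set `S`, from the observation `X`: `e x` maximizes `y ↦ Pr(Y = y | X = x)` over `S`. -/
structure IsMAPEstimator {Ω : Type*} [MeasurableSpace Ω] (μ : Measure Ω) [IsFiniteMeasure μ]
    {κ ν : Type*} [Fintype κ] [Fintype ν] (X Y : Ω → Matrix κ ν ℂ) (S : Set (Matrix κ ν ℂ))
    (e : Matrix κ ν ℂ → Matrix κ ν ℂ) : Prop where
  measurable : Measurable e
  mem : ∀ x, e x ∈ S
  maximal : ∀ᵐ x ∂(μ.map X), ∀ y ∈ S, condDistrib Y X μ x {y} ≤ condDistrib Y X μ x {e x}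

/-- The (unscaled) precoder that results when each transmitter `j` applies its own part of the
algorithm `V` to its own matrix `G j`. -/
def naivePrecoder {M K : ℕ} {N : Fin M → ℕ}
    (V : Matrix (Fin K) (Ant N) ℂ → Matrix (Ant N) (Fin K) ℂ)
    (G : Fin M → Matrix (Fin K) (Ant N) ℂ) : Matrix (Ant N) (Fin K) ℂ :=
  Matrix.of fun a i => V (G a.1) a i

/-- The correction `φ_l` of the best-informed transmitter (number `0`) for the symbols of receiver
`l`: the pseudo-inverse of the channel from transmitter `0` to the receivers other than `l`, times
the channel from the other transmitters to those receivers, times the difference on the antennas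
of the other transmitters between the column `l` of the centralized precoder and of the precoder
in use. Here `H1` is the estimate at transmitter `0`. -/
def correction {M K : ℕ} [NeZero M] {N : Fin M → ℕ} (H1 : Matrix (Fin K) (Ant N) ℂ)
    (Vc W : Matrix (Ant N) (Fin K) ℂ) (l : Fin K) : Fin (N 0) → ℂ :=
  (pinv (H1.submatrix (fun i : {i : Fin K // i ≠ l} => i.1)
      (fun n : Fin (N 0) => (⟨0, n⟩ : Ant N))) *
    H1.submatrix (fun i : {i : Fin K // i ≠ l} => i.1)
      (fun a : {a : Ant N // a.1 ≠ 0} => a.1)) *ᵥ fun a => Vc a.1 l - W a.1 l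

/-- The precoding matrix that transmitter `0` computes from its estimate `H1`, the estimates `G j`
of the quantized matrices in use at the transmitters `j ≠ 0`, and the power back-off `m`. -/
def bestPrecoder {M K : ℕ} [NeZero M] {N : Fin M → ℕ}
    (V : Matrix (Fin K) (Ant N) ℂ → Matrix (Ant N) (Fin K) ℂ) (m : ℝ)
    (H1 : Matrix (Fin K) (Ant N) ℂ) (G : Fin M → Matrix (Fin K) (Ant N) ℂ) :
    Matrix (Fin (N 0)) (Fin K) ℂ :=
  Matrix.of fun n l => (m : ℂ) * (V H1 ⟨0, n⟩ l + correction H1 (V H1) (naivePrecoder V G) l n)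

open Classical in
/-- The precoding matrix of the CD-ZF scheme, for the estimates `Hhat j` at the transmitters, the
quantization step `q`, the power back-off `m` and the MAP rules `e j` of transmitter `0`.
Transmitter `j ≠ 0` applies `V` to its quantized estimate. Transmitter `0` uses the corrected
precoder when it satisfies the power constraint; in a power outage, which it detects from its own
estimate, it uses `fallback` instead. -/
def cdzf {M K : ℕ} [NeZero M] {N : Fin M → ℕ}
    (V : Matrix (Fin K) (Ant N) ℂ → Matrix (Ant N) (Fin K) ℂ) (q m : ℝ)
    (e : Fin M → Matrix (Fin K) (Ant N) ℂ → Matrix (Fin K) (Ant N) ℂ)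
    (fallback : Matrix (Fin K) (Ant N) ℂ → Matrix (Fin (N 0)) (Fin K) ℂ)
    (Hhat : Fin M → Matrix (Fin K) (Ant N) ℂ) : Matrix (Ant N) (Fin K) ℂ :=
  Matrix.of fun a i =>
    if h : a.1 = 0 then
      (if PowerFeasible (bestPrecoder V m (Hhat 0) fun j => e j (Hhat 0)) then
        bestPrecoder V m (Hhat 0) fun j => e j (Hhat 0)
      else fallback (Hhat 0)) (h ▸ a.2) i
    else (m : ℂ) * naivePrecoder V (fun j => quantize q (Hhat j)) a i

end

end NetworkMISO

open NetworkMISO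

/-!
The two precoders are compared through the received amplitudes `(H * T) i l`. If those of the
distributed precoder agree with those of the centralized one up to a relative error `δ`, for signals
and for interference alike, then every instantaneous rate changes by at most
`2 * logb 2 ((1 + δ) / (1 - δ))`, whatever the SNR (`abs_instRate_sub_le`). Hence it suffices to
find such a bound with `δ → 0` outside of events whose probability decays like a power of the SNR:
on these events the rates are at most of the order of `log P` plus an integrable function, and this
contributes `o(1)` (`tendsto_expectedSumRate_sub`).

*Relative errors of the interference.* Both precoders force zeros with respect to the estimate `X`
of the best-informed transmitter, the distributed one thanks to the correction term, since the
channel from the `N 0 ≥ K - 1` antennas to `K - 1` receivers has full row rank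
(`zero_forcing_of_correction`, `ae_crossChannel_mul_pinv`). By rotation invariance of the Gaussian
law, `H = c X - z Y` with a residual `Y` that is independent of `X` (`hasLaw_estimate_residual`).
So the interference is `-z (Y * T) i l` for both precoders, with the *same* small factor `z`, which
cancels from the relative error (`relative_error_le`). It remains to see that `(Y * V X) i l` and
the signals `(X * V X) i i` are rarely small, and that the two precoders are close.

*Consistency.* The quantization step is coarser than all estimation errors by a power of the SNR,
so all transmitters obtain the quantized matrix `Q(X)` unless some coordinate of `X` lies close to
the boundary of a quantization cell, which is unlikely (`isPolySmall_quantize_ne`). Quantizing the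
own estimate is thus a good guess of the others' matrices for the best-informed transmitter, and
the MAP rule errs at most as often as this guess (`IsMAPEstimator.measure_ne_le`).

*Regularity.* Neither the precoder nor the pseudo-inverse in the correction is continuous
everywhere, so some quantitative control of `V (Q(X)) - V X` is needed. A function is called tame
if, at each point, its size and its Lipschitz constant nearby are bounded by the inverse of a gauge,
a function that is smaller than `t` with probability at most `C t ^ b` only. Sums, products,
conjugates and norms of tame functions are tame. For inverses, with `0⁻¹ = 0`, a lower bound for the
nonzero values is needed, and this is where algebraicity over the polynomials enters: at a nonzero
value, the constant coefficient of a polynomial equation bounds the modulus from below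
(`exists_gauge_isSeparatedBy`), and nonzero polynomials of Gaussian variables are rarely small
(`hasSmallBall_eval`). Finally, the Moore-Penrose inverse is an expression in sums, products,
conjugates and such inverses, obtained from the characteristic polynomial of the Gram matrix
(`pinv_eq_sum`). So all entries of a zero-forcing algorithm are tame
(`IsPrecoderExpr.isTameMatrixFun`); the change of the precoder and the correction are then of the
order of the quantization step up to an arbitrarily small power of the SNR, which fits into the
power back-off (`cdzf_close`), so the power constraint does not interfere.
-/

namespace NetworkMISO

noncomputable section

/-! ### Power-law small-ball estimates -/

/-- The function `g` is small with at most polynomial probability: `γ {g < t} ≤ C t ^ b` for all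
`t ∈ (0, 1]`, for some `C` and some exponent `b > 0`. The sets need not be measurable. -/
def HasSmallBall {E : Type*} [MeasurableSpace E] (γ : Measure E) (g : E → ℝ) : Prop :=
  ∃ C : ℝ, 0 < C ∧ ∃ b : ℝ, 0 < b ∧ ∀ t : ℝ, 0 < t → t ≤ 1 →
    γ {x | g x < t} ≤ ENNReal.ofReal (C * t ^ b)

section SmallBall

variable {E : Type*} [MeasurableSpace E] {γ : Measure E}

lemma HasSmallBall.mono_ae {f g : E → ℝ} (hf : HasSmallBall γ f) (h : ∀ᵐ x ∂γ, f x ≤ g x) :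
    HasSmallBall γ g := by
  obtain ⟨C, hC, b, hb, H⟩ := hf
  refine ⟨C, hC, b, hb, fun t ht ht1 => (measure_mono_ae ?_).trans (H t ht ht1)⟩
  filter_upwards [h] with x hx hxt
  exact lt_of_le_of_lt hx hxt

lemma HasSmallBall.mono {f g : E → ℝ} (hf : HasSmallBall γ f) (h : ∀ x, f x ≤ g x) :
    HasSmallBall γ g := hf.mono_ae (ae_of_all _ h)

lemma hasSmallBall_const [IsProbabilityMeasure γ] {c : ℝ} (hc : 0 < c) :
    HasSmallBall γ fun _ => c := by
  refine ⟨1 / c, by positivity, 1, one_pos, fun t ht _ => ?_⟩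
  by_cases h : c < t
  · refine prob_le_one.trans ?_
    rw [← ENNReal.ofReal_one]
    apply ENNReal.ofReal_le_ofReal
    rw [Real.rpow_one, div_mul_eq_mul_div, one_mul, one_le_div hc]
    exact h.le
  · simp [h]

lemma HasSmallBall.mul {f g : E → ℝ} (hf : HasSmallBall γ f) (hg : HasSmallBall γ g)
    (hf0 : ∀ x, 0 ≤ f x) : HasSmallBall γ fun x => f x * g x := by
  obtain ⟨C, hC, b, hb, H⟩ := hf
  obtain ⟨C', hC', b', hb', H'⟩ := hg
  refine ⟨C + C', by positivity, min b b' / 2, by positivity, fun t ht ht1 => ?_⟩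
  have hs : 0 < √t := Real.sqrt_pos.2 ht
  have hs1 : √t ≤ 1 := Real.sqrt_le_one.2 ht1
  have hsub : {x | f x * g x < t} ⊆ {x | f x < √t} ∪ {x | g x < √t} := by
    intro x hx
    by_contra hcon
    simp only [Set.mem_union, Set.mem_ofPred_eq, not_or, not_lt] at hcon hx
    have := mul_le_mul hcon.1 hcon.2 hs.le (hf0 x)
    rw [Real.mul_self_sqrt ht.le] at this
    linarith
  have hpow : ∀ b'' : ℝ, min b b' ≤ b'' → √t ^ b'' ≤ t ^ (min b b' / 2) := by
    intro b'' hb''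
    calc √t ^ b'' ≤ √t ^ (min b b') := Real.rpow_le_rpow_of_exponent_ge hs hs1 hb''
      _ = t ^ (min b b' / 2) := by
        rw [Real.sqrt_eq_rpow, ← Real.rpow_mul ht.le]; ring_nf
  calc γ {x | f x * g x < t} ≤ γ {x | f x < √t} + γ {x | g x < √t} :=
        (measure_mono hsub).trans (measure_union_le _ _)
    _ ≤ ENNReal.ofReal (C * √t ^ b) + ENNReal.ofReal (C' * √t ^ b') :=
        add_le_add (H _ hs hs1) (H' _ hs hs1)
    _ = ENNReal.ofReal (C * √t ^ b + C' * √t ^ b') :=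
        (ENNReal.ofReal_add (by positivity) (by positivity)).symm
    _ ≤ _ := by
        apply ENNReal.ofReal_le_ofReal
        rw [add_mul]
        gcongr
        · exact hpow b (min_le_left _ _)
        · exact hpow b' (min_le_right _ _)

lemma HasSmallBall.ae_pos {f : E → ℝ} (hf : HasSmallBall γ f) : ∀ᵐ x ∂γ, 0 < f x := by
  obtain ⟨C, hC, b, hb, H⟩ := hf
  rw [ae_iff]
  refine le_antisymm (ge_of_tendsto (x := 𝓝[>] (0 : ℝ))
    (f := fun t => ENNReal.ofReal (C * t ^ b)) ?_ ?_) zero_le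
  · have h1 : Tendsto (fun t : ℝ => C * t ^ b) (𝓝 0) (𝓝 (C * 0 ^ b)) :=
      ((Real.continuousAt_rpow_const 0 b (Or.inr hb.le)).tendsto).const_mul C
    rw [Real.zero_rpow hb.ne', mul_zero] at h1
    simpa using (ENNReal.tendsto_ofReal h1).mono_left nhdsWithin_le_nhds
  · have h1 : ∀ᶠ t : ℝ in 𝓝[>] 0, t ≤ 1 :=
      (eventually_le_nhds (by norm_num : (0 : ℝ) < 1)).filter_mono nhdsWithin_le_nhds
    filter_upwards [h1, self_mem_nhdsWithin] with t ht1 ht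
    refine (measure_mono fun x hx => ?_).trans (H t ht ht1)
    simp only [Set.mem_ofPred_eq, not_lt] at hx ⊢
    exact lt_of_le_of_lt hx ht

lemma HasSmallBall.comp {F : Type*} [MeasurableSpace F] {γ' : Measure F} {g : F → ℝ}
    (hg : HasSmallBall γ' g) {X : E → F} (hX : HasLaw X γ' γ) :
    HasSmallBall γ fun x => g (X x) := by
  obtain ⟨C, hC, b, hb, H⟩ := hg
  refine ⟨C, hC, b, hb, fun t ht ht1 => le_trans ?_ (H t ht ht1)⟩
  rw [← hX.map_eq]
  exact Measure.le_map_apply hX.aemeasurable {y | g y < t}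

end SmallBall

/-! ### Small-ball estimates for polynomials -/

/-- A law on the line that charges each interval of length `2 r` by at most `2 r`. -/
def IsAntiConcentrated (ν : Measure ℝ) : Prop :=
  ∀ s r : ℝ, ν {y | |y - s| < r} ≤ ENNReal.ofReal (2 * r)

lemma gaussianReal_half_le_volume : gaussianReal 0 (1 / 2) ≤ volume := by
  have hv : (1 / 2 : ℝ≥0) ≠ 0 := by norm_num
  rw [gaussianReal_of_var_ne_zero _ hv]
  refine (withDensity_mono (ae_of_all _ fun x => ?_)).trans_eq withDensity_one
  rw [Pi.one_apply, gaussianPDF_def, ← ENNReal.ofReal_one]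
  apply ENNReal.ofReal_le_ofReal
  rw [gaussianPDFReal_def]
  have h1 : Real.exp (-(x - 0) ^ 2 / (2 * ((1 / 2 : ℝ≥0) : ℝ))) ≤ 1 :=
    Real.exp_le_one_iff.2 (div_nonpos_of_nonpos_of_nonneg (by nlinarith) (by positivity))
  have h2 : 1 ≤ √(2 * Real.pi * ((1 / 2 : ℝ≥0) : ℝ)) := by
    apply Real.le_sqrt_of_sq_le
    have := Real.pi_gt_three
    push_cast
    linarith
  exact mul_le_one₀ (inv_le_one_of_one_le₀ h2) (Real.exp_nonneg _) h1

lemma isAntiConcentrated_gaussianReal : IsAntiConcentrated (gaussianReal 0 (1 / 2)) := by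
  intro s r
  refine (gaussianReal_half_le_volume _).trans ?_
  have : {y | |y - s| < r} = Metric.ball s r := by ext y; simp [Real.dist_eq]
  rw [this, Real.volume_ball]

/-- A univariate polynomial is small compared to its leading coefficient only near its roots. -/
lemma IsAntiConcentrated.measure_eval_lt {ν : Measure ℝ} (hν : IsAntiConcentrated ν)
    (p : Polynomial ℂ) (d : ℕ) (hd : p.natDegree = d) {u : ℝ} (hu : 0 < u) (hu1 : u ≤ 1) :
    ν {y : ℝ | ‖p.eval (y : ℂ)‖ < u * ‖p.leadingCoeff‖} ≤
      ENNReal.ofReal (2 * d * u ^ (1 / (d + 1 : ℝ))) := by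
  classical
  set r : ℝ := u ^ (1 / (d + 1 : ℝ)) with hr
  have hr0 : 0 < r := Real.rpow_pos_of_pos hu _
  have hr1 : r ≤ 1 := Real.rpow_le_one hu.le hu1 (by positivity)
  have hrd : r ^ (d + 1) = u := by
    rw [hr, ← Real.rpow_natCast, ← Real.rpow_mul hu.le]
    push_cast
    rw [one_div_mul_cancel (by positivity), Real.rpow_one]
  have hsplit : p.Splits := IsAlgClosed.splits p
  have hcard : p.roots.card = d := by rw [← hd, hsplit.natDegree_eq_card_roots]
  have hsub : {y : ℝ | ‖p.eval (y : ℂ)‖ < u * ‖p.leadingCoeff‖} ⊆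
      ⋃ s ∈ p.roots.toFinset, {y : ℝ | |y - s.re| < r} := by
    intro y hy
    by_contra hcon
    simp only [Set.mem_iUnion, Set.mem_ofPred_eq, not_exists, not_lt, Multiset.mem_toFinset] at hcon
    rw [Set.mem_ofPred_eq, hsplit.eval_eq_prod_roots, norm_mul, mul_comm u] at hy
    have h1 : r ^ d ≤ ‖(p.roots.map fun s => (y : ℂ) - s).prod‖ := by
      have h2 := Multiset.prod_map_le_prod_map₀ (s := p.roots) (fun _ => r)
        (fun s => ‖(y : ℂ) - s‖) (fun _ _ => hr0.le) (fun s hs => (hcon s hs).trans ?_)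
      · rw [Multiset.map_const', Multiset.prod_replicate, hcard] at h2
        refine h2.trans_eq ?_
        exact (Multiset.prod_hom' p.roots (normHom : ℂ →*₀ ℝ) _)
      · simpa using Complex.abs_re_le_norm ((y : ℂ) - s)
    have h3 : u ≤ r ^ d := by
      rw [← hrd]; exact pow_le_pow_of_le_one hr0.le hr1 (Nat.le_succ d)
    have := lt_of_mul_lt_mul_left hy (norm_nonneg _)
    linarith
  calc _ ≤ ν (⋃ s ∈ p.roots.toFinset, {y : ℝ | |y - s.re| < r}) := measure_mono hsub
    _ ≤ ∑ s ∈ p.roots.toFinset, ν {y : ℝ | |y - s.re| < r} := measure_biUnion_finset_le _ _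
    _ ≤ ∑ s ∈ p.roots.toFinset, ENNReal.ofReal (2 * r) := Finset.sum_le_sum fun s _ => hν _ _
    _ = p.roots.toFinset.card * ENNReal.ofReal (2 * r) := by simp
    _ ≤ d * ENNReal.ofReal (2 * r) := by
        gcongr
        rw [← hcard]
        exact Multiset.toFinset_card_le _
    _ = _ := by
        rw [← ENNReal.ofReal_natCast, ← ENNReal.ofReal_mul (by positivity)]
        ring_nf

/-- A nonzero polynomial satisfies a small-ball estimate: by induction on the number of variables,
as a polynomial in the last variable with the leading coefficient controlled by induction. -/
lemma hasSmallBall_eval_fin {ν : Measure ℝ} [IsProbabilityMeasure ν] (hν : IsAntiConcentrated ν) :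
    ∀ (n : ℕ) (p : MvPolynomial (Fin n) ℂ), p ≠ 0 →
      HasSmallBall (Measure.pi fun _ : Fin n => ν)
        fun x => ‖MvPolynomial.eval (fun i => (x i : ℂ)) p‖ := by
  intro n
  induction n with
  | zero =>
    intro p hp
    obtain ⟨c, rfl⟩ := MvPolynomial.C_surjective (R := ℂ) (Fin 0) p
    have hc : c ≠ 0 := by rintro rfl; simp at hp
    simpa using hasSmallBall_const (norm_pos_iff.2 hc)
  | succ n ih =>
    intro p hp
    set Q := MvPolynomial.finSuccEquiv ℂ n p with hQ
    have hQ0 : Q ≠ 0 := by simpa [hQ] using hp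
    set d := Q.natDegree with hd
    set a : (Fin n → ℝ) → ℂ := fun x => MvPolynomial.eval (fun i => (x i : ℂ))
      Q.leadingCoeff with ha
    have hsb : HasSmallBall (Measure.pi fun _ : Fin n => ν) fun x => ‖a x‖ :=
      ih _ (Polynomial.leadingCoeff_ne_zero.2 hQ0)
    obtain ⟨C, hC, b, hb, H⟩ := hsb
    have hpos : (0 : ℝ) < d + 1 := by positivity
    refine ⟨C + 2 * d, by positivity, min b (1 / (d + 1)) / 2, by positivity, fun t ht ht1 => ?_⟩
    set e := MeasurableEquiv.piFinSuccAbove (fun _ : Fin (n + 1) => ℝ) 0 with he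
    have hmp := measurePreserving_piFinSuccAbove (fun _ : Fin (n + 1) => ν) 0
    have hs : 0 < √t := Real.sqrt_pos.2 ht
    have hs1 : √t ≤ 1 := Real.sqrt_le_one.2 ht1
    have heval : ∀ x : Fin (n + 1) → ℝ, MvPolynomial.eval (fun i => (x i : ℂ)) p =
        (Q.map (MvPolynomial.eval fun i => ((x (Fin.succ i) : ℝ) : ℂ))).eval ((x 0 : ℝ) : ℂ) := by
      intro x
      rw [hQ, ← MvPolynomial.eval_eq_eval_mv_eval']
      congr 2
      funext i
      refine Fin.cases rfl (fun j => rfl) i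
    set S : Set (ℝ × (Fin n → ℝ)) := {z | ‖(Q.map (MvPolynomial.eval fun i =>
      ((z.2 i : ℝ) : ℂ))).eval (z.1 : ℂ)‖ < t} with hS
    have hcont : Continuous fun z : ℝ × (Fin n → ℝ) => (Q.map (MvPolynomial.eval fun i =>
      ((z.2 i : ℝ) : ℂ))).eval (z.1 : ℂ) := by
      simp_rw [Polynomial.eval_map, Polynomial.eval₂_eq_sum_range]
      refine continuous_finsetSum _ fun i _ => Continuous.mul ?_ (by fun_prop)
      have := MvPolynomial.continuous_eval (Q.coeff i)
      exact this.comp (by fun_prop)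
    have hSm : MeasurableSet S := measurableSet_lt hcont.norm.measurable measurable_const
    have hset : {x : Fin (n + 1) → ℝ | ‖MvPolynomial.eval (fun i => (x i : ℂ)) p‖ < t} =
        e ⁻¹' S := by
      ext x
      simp only [Set.mem_ofPred_eq, heval, hS, Set.mem_preimage]
      rfl
    rw [hset, hmp.measure_preimage hSm.nullMeasurableSet, Measure.prod_apply_symm hSm]
    set A : Set (Fin n → ℝ) := {x | ‖a x‖ < √t} with hA
    have hacont : Continuous a := by
      have := MvPolynomial.continuous_eval Q.leadingCoeff
      exact this.comp (by fun_prop)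
    have hAm : MeasurableSet A := measurableSet_lt hacont.norm.measurable measurable_const
    have hbound : ∀ x : Fin n → ℝ, ν ((fun y => (y, x)) ⁻¹' S) ≤
        A.indicator 1 x + ENNReal.ofReal (2 * d * √t ^ (1 / (d + 1 : ℝ))) := by
      intro x
      by_cases hx : x ∈ A
      · rw [Set.indicator_of_mem hx]
        exact prob_le_one.trans le_self_add
      · rw [Set.indicator_of_notMem hx, zero_add]
        simp only [hA, Set.mem_ofPred_eq, not_lt] at hx
        set q := Q.map (MvPolynomial.eval fun i => ((x i : ℝ) : ℂ)) with hq
        have hne : MvPolynomial.eval (fun i => ((x i : ℝ) : ℂ)) Q.leadingCoeff ≠ 0 := by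
          intro h0
          rw [ha] at hx
          simp only [h0, norm_zero] at hx
          linarith
        have hdeg : q.natDegree = d := Polynomial.natDegree_map_of_leadingCoeff_ne_zero _ hne
        have hlead : q.leadingCoeff = a x :=
          Polynomial.leadingCoeff_map_of_leadingCoeff_ne_zero _ hne
        refine (measure_mono fun y hy => ?_).trans (hν.measure_eval_lt q d hdeg hs hs1)
        simp only [hS, Set.mem_preimage, Set.mem_ofPred_eq] at hy ⊢
        rw [hlead]
        refine hy.trans_le ?_
        calc t = √t * √t := (Real.mul_self_sqrt ht.le).symm
          _ ≤ √t * ‖a x‖ := by gcongr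
    have hpow : ∀ b'' : ℝ, min b (1 / (d + 1 : ℝ)) ≤ b'' →
        √t ^ b'' ≤ t ^ (min b (1 / (d + 1 : ℝ)) / 2) := by
      intro b'' hb''
      calc √t ^ b'' ≤ √t ^ (min b (1 / (d + 1 : ℝ))) :=
            Real.rpow_le_rpow_of_exponent_ge hs hs1 hb''
        _ = _ := by rw [Real.sqrt_eq_rpow, ← Real.rpow_mul ht.le]; ring_nf
    calc _ ≤ ∫⁻ x, (A.indicator 1 x + ENNReal.ofReal (2 * d * √t ^ (1 / (d + 1 : ℝ))))
            ∂(Measure.pi fun _ : Fin n => ν) := lintegral_mono hbound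
      _ = (Measure.pi fun _ : Fin n => ν) A + ENNReal.ofReal (2 * d * √t ^ (1 / (d + 1 : ℝ))) := by
          rw [lintegral_add_right _ measurable_const, lintegral_indicator_one hAm]
          simp
      _ ≤ ENNReal.ofReal (C * √t ^ b) + ENNReal.ofReal (2 * d * √t ^ (1 / (d + 1 : ℝ))) := by
          gcongr
          exact H _ hs hs1
      _ = ENNReal.ofReal (C * √t ^ b + 2 * d * √t ^ (1 / (d + 1 : ℝ))) :=
          (ENNReal.ofReal_add (by positivity) (by positivity)).symm
      _ ≤ _ := by
          apply ENNReal.ofReal_le_ofReal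
          rw [add_mul]
          gcongr
          · exact hpow b (min_le_left _ _)
          · exact hpow _ (min_le_right _ _)

lemma hasSmallBall_eval {ν : Measure ℝ} [IsProbabilityMeasure ν] (hν : IsAntiConcentrated ν)
    {ι : Type*} [Fintype ι] (p : MvPolynomial ι ℂ) (hp : p ≠ 0) :
    HasSmallBall (Measure.pi fun _ : ι => ν)
      fun x => ‖MvPolynomial.eval (fun i => (x i : ℂ)) p‖ := by
  set e := Fintype.equivFin ι
  have h := hasSmallBall_eval_fin hν (Fintype.card ι) (MvPolynomial.rename e p)
    (by simpa using (MvPolynomial.rename_injective _ e.injective).ne hp)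
  have hmp := measurePreserving_piCongrLeft (fun _ : Fin (Fintype.card ι) => ν) e
  refine (h.comp hmp.hasLaw).mono fun x => le_of_eq ?_
  rw [MvPolynomial.eval_rename]
  congr 3
  funext i
  have := Equiv.piCongrLeft_apply_apply (fun _ : Fin (Fintype.card ι) => ℝ) e x i
  simp [MeasurableEquiv.coe_piCongrLeft, this]

lemma hasSmallBall_of_lintegral_inv {E : Type*} [MeasurableSpace E] {γ : Measure E} {g : E → ℝ}
    (hg : AEMeasurable g γ) (h : ∫⁻ x, (ENNReal.ofReal (g x))⁻¹ ∂γ < ∞) : HasSmallBall γ g := by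
  set I := ∫⁻ x, (ENNReal.ofReal (g x))⁻¹ ∂γ with hI
  refine ⟨I.toReal + 1, by positivity, 1, one_pos, fun t ht _ => ?_⟩
  have hsub : {x | g x < t} ⊆ {x | (ENNReal.ofReal t)⁻¹ ≤ (ENNReal.ofReal (g x))⁻¹} := fun x hx =>
    ENNReal.inv_le_inv.2 (ENNReal.ofReal_le_ofReal (le_of_lt hx))
  have ht0 : ENNReal.ofReal t ≠ 0 := by simpa using ht
  have hmk := meas_ge_le_lintegral_div (μ := γ) (f := fun x => (ENNReal.ofReal (g x))⁻¹)
    hg.ennreal_ofReal.inv (ε := (ENNReal.ofReal t)⁻¹) (by simp) (by simpa using ht)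
  refine ((measure_mono hsub).trans hmk).trans ?_
  rw [ENNReal.div_eq_inv_mul, inv_inv, Real.rpow_one, mul_comm, ENNReal.ofReal_mul (by positivity)]
  gcongr
  calc I = ENNReal.ofReal I.toReal := (ENNReal.ofReal_toReal h.ne).symm
    _ ≤ _ := ENNReal.ofReal_le_ofReal (by linarith)

/-! ### Gauges: quantitative local Lipschitz bounds off small sets -/

section Gauge

variable {E : Type*} [MeasurableSpace E] {γ : Measure E} {w w' : E → ℝ}

/-- A gauge is a function with values in `[0, 1]` that is small with small probability only. It
measures how far a point is from the exceptional set where some function behaves badly. -/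
structure IsGauge (γ : Measure E) (w : E → ℝ) : Prop where
  nonneg : ∀ x, 0 ≤ w x
  le_one : ∀ x, w x ≤ 1
  small : HasSmallBall γ w

lemma IsGauge.mul (hw : IsGauge γ w) (hw' : IsGauge γ w') : IsGauge γ fun x => w x * w' x where
  nonneg x := mul_nonneg (hw.nonneg x) (hw'.nonneg x)
  le_one x := mul_le_one₀ (hw.le_one x) (hw'.nonneg x) (hw'.le_one x)
  small := hw.small.mul hw'.small hw.nonneg

lemma isGauge_const [IsProbabilityMeasure γ] {c : ℝ} (hc : 0 < c) (hc1 : c ≤ 1) :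
    IsGauge γ fun _ => c where
  nonneg _ := hc.le
  le_one _ := hc1
  small := hasSmallBall_const hc

lemma IsGauge.const_mul [IsProbabilityMeasure γ] (hw : IsGauge γ w) {c : ℝ} (hc : 0 < c)
    (hc1 : c ≤ 1) : IsGauge γ fun x => c * w x :=
  (isGauge_const hc hc1).mul hw

lemma IsGauge.mul_le_left (hw : IsGauge γ w) (hw' : IsGauge γ w') (x : E) : w x * w' x ≤ w x :=
  mul_le_of_le_one_right (hw.nonneg x) (hw'.le_one x)

lemma IsGauge.mul_le_right (hw : IsGauge γ w) (hw' : IsGauge γ w') (x : E) : w x * w' x ≤ w' x :=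
  mul_le_of_le_one_left (hw'.nonneg x) (hw.le_one x)

variable [PseudoMetricSpace E] {f g : E → ℂ}

/-- The function `f` is bounded by `1 / w x` at `x`, and on the ball of radius `w x` around `x`
it changes by at most `1 / w x` times the distance to `x`. -/
def IsControlledBy (f : E → ℂ) (w : E → ℝ) : Prop :=
  ∀ x, w x * ‖f x‖ ≤ 1 ∧ ∀ x', dist x' x ≤ w x → w x * ‖f x' - f x‖ ≤ dist x' x

/-- A function is tame if it is controlled by a gauge. -/
def IsTame (γ : Measure E) (f : E → ℂ) : Prop :=
  ∃ w, IsGauge γ w ∧ IsControlledBy f w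

omit [MeasurableSpace E] in
lemma IsControlledBy.mono (hf : IsControlledBy f w) (h : ∀ x, w' x ≤ w x) :
    IsControlledBy f w' := by
  refine fun x => ⟨le_trans ?_ (hf x).1, fun x' hx' => le_trans ?_ ((hf x).2 x' (hx'.trans (h x)))⟩
  · exact mul_le_mul_of_nonneg_right (h x) (norm_nonneg _)
  · exact mul_le_mul_of_nonneg_right (h x) (norm_nonneg _)

/-- Finitely many tame functions are controlled by a common gauge. -/
lemma exists_common_gauge [IsProbabilityMeasure γ] {ι : Type*} (s : Finset ι) {F : ι → E → ℂ}
    (hF : ∀ i ∈ s, IsTame γ (F i)) : ∃ w, IsGauge γ w ∧ ∀ i ∈ s, IsControlledBy (F i) w := by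
  classical
  induction s using Finset.induction_on with
  | empty => exact ⟨_, isGauge_const one_pos le_rfl, by simp⟩
  | insert i s hi ih =>
    obtain ⟨w, hw, h⟩ := ih fun j hj => hF j (by simp [hj])
    obtain ⟨v, hv, h'⟩ := hF i (by simp)
    refine ⟨_, hv.mul hw, fun j hj => ?_⟩
    rcases Finset.mem_insert.1 hj with rfl | hj
    · exact h'.mono (hv.mul_le_left hw)
    · exact (h j hj).mono (hv.mul_le_right hw)

lemma isTame_const [IsProbabilityMeasure γ] (c : ℂ) : IsTame γ fun _ : E => c := by
  have hc : (0 : ℝ) < 1 + ‖c‖ := by positivity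
  refine ⟨_, isGauge_const (c := 1 / (1 + ‖c‖)) (by positivity) ?_, fun x => ⟨?_, fun x' _ => ?_⟩⟩
  · rw [div_le_one hc]; linarith [norm_nonneg c]
  · rw [div_mul_eq_mul_div, one_mul, div_le_one hc]; linarith
  · simp

lemma IsTame.add [IsProbabilityMeasure γ] (hf : IsTame γ f) (hg : IsTame γ g) :
    IsTame γ fun x => f x + g x := by
  obtain ⟨u, hu, hfu⟩ := hf
  obtain ⟨v, hv, hgv⟩ := hg
  have hw := hu.mul hv
  have hfw := hfu.mono (hu.mul_le_left hv)
  have hgw := hgv.mono (hu.mul_le_right hv)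
  refine ⟨_, hw.const_mul (c := 1 / 2) (by norm_num) (by norm_num), fun x => ⟨?_, fun x' hx' => ?_⟩⟩
  · have := mul_le_mul_of_nonneg_left (norm_add_le (f x) (g x)) (hw.nonneg x)
    linarith [(hfw x).1, (hgw x).1]
  · have h1 : dist x' x ≤ u x * v x := by linarith [hw.nonneg x]
    have h2 := mul_le_mul_of_nonneg_left (norm_add_le (f x' - f x) (g x' - g x)) (hw.nonneg x)
    have h3 : f x' + g x' - (f x + g x) = (f x' - f x) + (g x' - g x) := by ring
    rw [h3]
    linarith [(hfw x).2 x' h1, (hgw x).2 x' h1]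

lemma IsTame.mul [IsProbabilityMeasure γ] (hf : IsTame γ f) (hg : IsTame γ g) :
    IsTame γ fun x => f x * g x := by
  obtain ⟨u, hu, hfu⟩ := hf
  obtain ⟨v, hv, hgv⟩ := hg
  have hw := hu.mul hv
  refine ⟨_, hw.const_mul (c := 1 / 3) (by norm_num) (by norm_num), fun x => ⟨?_, fun x' hx' => ?_⟩⟩
  · have h1 := mul_le_one₀ (hfu x).1 (mul_nonneg (hv.nonneg x) (norm_nonneg _)) (hgv x).1
    have h0 := mul_nonneg (mul_nonneg (hu.nonneg x) (norm_nonneg (f x)))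
      (mul_nonneg (hv.nonneg x) (norm_nonneg (g x)))
    rw [norm_mul]
    nlinarith
  · have h1 : dist x' x ≤ u x * v x := by linarith [hw.nonneg x]
    have h1u := h1.trans (hu.mul_le_left hv x)
    have h1v := h1.trans (hu.mul_le_right hv x)
    have hd : 0 ≤ dist x' x := dist_nonneg
    have e1 := (hfu x).2 x' h1u
    have e2 := (hgv x).2 x' h1v
    have e3 : u x * ‖f x'‖ ≤ 2 := by
      have := mul_le_mul_of_nonneg_left (norm_le_norm_add_norm_sub' (f x') (f x)) (hu.nonneg x)
      have := (hfu x).1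
      have := hu.le_one x
      linarith
    have h3 : f x' * g x' - f x * g x = f x' * (g x' - g x) + (f x' - f x) * g x := by ring
    have h4 : ‖f x' * g x' - f x * g x‖ ≤ ‖f x'‖ * ‖g x' - g x‖ + ‖f x' - f x‖ * ‖g x‖ := by
      rw [h3]; exact (norm_add_le _ _).trans_eq (by rw [norm_mul, norm_mul])
    have h5 : (u x * ‖f x'‖) * (v x * ‖g x' - g x‖) ≤ 2 * dist x' x :=
      mul_le_mul e3 e2 (mul_nonneg (hv.nonneg x) (norm_nonneg _)) (by norm_num)
    have h6 : (u x * ‖f x' - f x‖) * (v x * ‖g x‖) ≤ dist x' x * 1 :=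
      mul_le_mul e1 (hgv x).1 (mul_nonneg (hv.nonneg x) (norm_nonneg _)) hd
    have h7 := mul_le_mul_of_nonneg_left h4 (hw.nonneg x)
    nlinarith

lemma IsTame.star (hf : IsTame γ f) : IsTame γ fun x => star (f x) := by
  obtain ⟨w, hw, h⟩ := hf
  refine ⟨w, hw, fun x => ?_⟩
  simpa only [← star_sub, norm_star] using h x

lemma IsTame.norm [IsProbabilityMeasure γ] {m : ℕ} {F : Fin m → E → ℂ}
    (hF : ∀ k, IsTame γ (F k)) : IsTame γ fun x => ((√(∑ k, ‖F k x‖ ^ 2) : ℝ) : ℂ) := by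
  obtain ⟨w, hw, h⟩ := exists_common_gauge Finset.univ fun k _ => hF k
  have hm : (0 : ℝ) < m + 1 := by positivity
  set c : ℝ := 1 / (m + 1)
  have hc : 0 < c := by positivity
  have hc1 : c ≤ 1 := by rw [div_le_one hm]; linarith [(Nat.cast_nonneg m : (0 : ℝ) ≤ m)]
  have hcm : c * m ≤ 1 := by rw [div_mul_eq_mul_div, div_le_one hm]; linarith
  -- the Euclidean norm is a norm, so it is Lipschitz, and it is at most the sum of the moduli
  have hnorm : ∀ x, √(∑ k, ‖F k x‖ ^ 2) = ‖WithLp.toLp 2 fun k => F k x‖ := fun x => by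
    rw [EuclideanSpace.norm_eq]
  have hle : ∀ v : Fin m → ℂ, ‖WithLp.toLp 2 v‖ ≤ ∑ k, ‖v k‖ := by
    intro v
    rw [EuclideanSpace.norm_eq]
    apply Real.sqrt_le_iff.2
    refine ⟨Finset.sum_nonneg fun _ _ => norm_nonneg _, ?_⟩
    exact Finset.sum_sq_le_sq_sum_of_nonneg fun _ _ => norm_nonneg _
  refine ⟨_, hw.const_mul hc hc1, fun x => ⟨?_, fun x' hx' => ?_⟩⟩
  · rw [Complex.norm_real, Real.norm_eq_abs, abs_of_nonneg (Real.sqrt_nonneg _), hnorm]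
    have h1 := mul_le_mul_of_nonneg_left (hle fun k => F k x) (hw.nonneg x)
    have h2 : w x * ∑ k, ‖F k x‖ ≤ m := by
      rw [Finset.mul_sum]
      refine (Finset.sum_le_sum fun k hk => (h k hk x).1).trans_eq ?_
      simp
    nlinarith
  · rw [← Complex.ofReal_sub, Complex.norm_real, hnorm, hnorm, Real.norm_eq_abs]
    have h0 := abs_norm_sub_norm_le (WithLp.toLp 2 fun k => F k x') (WithLp.toLp 2 fun k => F k x)
    rw [← WithLp.toLp_sub] at h0
    have h1 := mul_le_mul_of_nonneg_left (h0.trans (hle _)) (hw.nonneg x)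
    have hwx : dist x' x ≤ w x := hx'.trans (mul_le_of_le_one_left (hw.nonneg x) hc1)
    have h2 : w x * ∑ k, ‖((fun k => F k x') - fun k => F k x) k‖ ≤ m * dist x' x := by
      rw [Finset.mul_sum]
      refine (Finset.sum_le_sum fun k hk => (h k hk x).2 x' hwx).trans_eq ?_
      simp
    have h3 := mul_le_mul_of_nonneg_left (h1.trans h2) hc.le
    have h4 : c * m * dist x' x ≤ 1 * dist x' x := mul_le_mul_of_nonneg_right hcm dist_nonneg
    nlinarith

/-- Near each point `x`, the values of `f` are either `0` or of modulus at least `u x`. -/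
def IsSeparatedBy (f : E → ℂ) (u : E → ℝ) : Prop :=
  ∀ x x', dist x' x ≤ u x → f x' = 0 ∨ u x ≤ ‖f x'‖

/-- The pointwise inverse (with `0⁻¹ = 0`) of a tame function is tame, if the values of the
function are separated from `0` by a gauge. -/
lemma IsTame.inv [IsProbabilityMeasure γ] (hf : IsTame γ f) {u : E → ℝ} (hu : IsGauge γ u)
    (hfu : IsSeparatedBy f u) : IsTame γ fun x => (f x)⁻¹ := by
  obtain ⟨w, hw, h⟩ := hf
  have hg := hw.mul (hu.mul hu)
  have hgu : ∀ x, w x * (u x * u x) ≤ u x := fun x =>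
    (hw.mul_le_right (hu.mul hu) x).trans (hu.mul_le_left hu x)
  refine ⟨_, hg.const_mul (c := 1 / 2) (by norm_num) (by norm_num), fun x => ?_⟩
  have hu0 := hu.nonneg x
  have hw0 := hw.nonneg x
  have hu1 := hu.le_one x
  have hw1 := hw.le_one x
  have hself := hfu x x (by simpa using hu0)
  rcases hu0.eq_or_lt with hux | hux
  · refine ⟨by simp [← hux], fun x' hx' => by simp [← hux]⟩
  refine ⟨?_, fun x' hx' => ?_⟩
  · rcases hself with h0 | h0
    · simp [h0]
    · rw [norm_inv]
      have h1 : u x * ‖f x‖⁻¹ ≤ 1 := by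
        rw [← div_eq_mul_inv]; exact div_le_one_of_le₀ h0 (norm_nonneg _)
      have h2 := mul_le_mul_of_nonneg_right (hgu x) (inv_nonneg.2 (norm_nonneg (f x)))
      have h3 := mul_nonneg (hg.nonneg x) (inv_nonneg.2 (norm_nonneg (f x)))
      nlinarith
  · have hd : 0 ≤ dist x' x := dist_nonneg
    have hd1 : dist x' x ≤ w x * (u x * u x) := by linarith [hg.nonneg x]
    have hdw : dist x' x ≤ w x := hd1.trans (hw.mul_le_left (hu.mul hu) x)
    have hdu : dist x' x ≤ u x := hd1.trans (hgu x)
    have hlip := (h x).2 x' hdw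
    -- the values at `x` and `x'` differ by less than `u x`
    have hlt : 0 < w x → ‖f x' - f x‖ ≤ u x / 2 := by
      intro hwx
      have : w x * ‖f x' - f x‖ ≤ w x * (u x / 2) := by nlinarith
      exact le_of_mul_le_mul_left this hwx
    rcases hw0.eq_or_lt with hwx | hwx
    · simp [← hwx]
    have hlt := hlt hwx
    rcases hself with h0 | h0
    · rcases hfu x x' hdu with h0' | h0'
      · simp [h0, h0']
      · rw [h0, sub_zero] at hlt; linarith
    · rcases hfu x x' hdu with h0' | h0'
      · rw [h0', zero_sub, norm_neg] at hlt; linarith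
      · have hne : f x ≠ 0 := norm_pos_iff.1 (hux.trans_le h0)
        have hne' : f x' ≠ 0 := norm_pos_iff.1 (hux.trans_le h0')
        have e1 : (f x')⁻¹ - (f x)⁻¹ = -(f x' - f x) / (f x' * f x) := by field_simp; ring
        rw [e1, norm_div, norm_neg, norm_mul, mul_div_assoc', div_le_iff₀ (by positivity)]
        have h5 : u x * u x ≤ ‖f x'‖ * ‖f x‖ := mul_le_mul h0' h0 hux.le (norm_nonneg _)
        have h6 : w x * ‖f x' - f x‖ * (u x * u x) ≤ dist x' x * (‖f x'‖ * ‖f x‖) :=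
          mul_le_mul hlip h5 (by positivity) hd
        have h7 : 0 ≤ w x * ‖f x' - f x‖ * (u x * u x) := by positivity
        nlinarith

end Gauge

/-! ### Tame algebraic functions of Gaussian coordinates -/

/-- The law of independent centred real Gaussian coordinates with variance `1 / 2`. -/
def realGaussian (ι : Type*) [Fintype ι] : Measure (ι → ℝ) :=
  Measure.pi fun _ => gaussianReal 0 (1 / 2)

instance {ι : Type*} [Fintype ι] : IsProbabilityMeasure (realGaussian ι) := by
  unfold realGaussian; infer_instance

/-- Evaluation of real polynomials at the point `x`, with values in `ℂ`. -/
def polyEval {ι : Type*} (x : ι → ℝ) : MvPolynomial ι ℝ →+* ℂ :=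
  Complex.ofRealHom.comp (MvPolynomial.eval x)

/-- Complex-valued functions of real coordinates form an algebra over the real polynomials. -/
instance polyAlgebra (ι : Type*) : Algebra (MvPolynomial ι ℝ) ((ι → ℝ) → ℂ) :=
  (RingHom.pi polyEval).toAlgebra

section Algebraic

variable {ι : Type*} {f : (ι → ℝ) → ℂ}

lemma isAlgebraic_iff_eval₂ : IsAlgebraic (MvPolynomial ι ℝ) f ↔
    ∃ Q : Polynomial (MvPolynomial ι ℝ), Q ≠ 0 ∧ ∀ x, Q.eval₂ (polyEval x) (f x) = 0 := by
  refine exists_congr fun Q => and_congr_right fun _ => ?_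
  rw [Polynomial.aeval_def, funext_iff]
  refine forall_congr' fun x => ?_
  have := Polynomial.hom_eval₂ Q (algebraMap (MvPolynomial ι ℝ) ((ι → ℝ) → ℂ))
    (Pi.evalRingHom (fun _ : ι → ℝ => ℂ) x) f
  rw [Pi.evalRingHom_apply] at this
  rw [this]
  rfl

lemma isAlgebraic_star (hf : IsAlgebraic (MvPolynomial ι ℝ) f) :
    IsAlgebraic (MvPolynomial ι ℝ) fun x => star (f x) := by
  rw [isAlgebraic_iff_eval₂] at hf ⊢
  obtain ⟨Q, hQ, h⟩ := hf
  refine ⟨Q, hQ, fun x => ?_⟩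
  have h1 := congrArg (starRingEnd ℂ) (h x)
  rw [Polynomial.hom_eval₂, map_zero] at h1
  have h2 : (starRingEnd ℂ).comp (polyEval x) = polyEval x := by
    ext <;> simp [polyEval]
  rwa [h2] at h1

lemma isAlgebraic_inv (hf : IsAlgebraic (MvPolynomial ι ℝ) f) :
    IsAlgebraic (MvPolynomial ι ℝ) fun x => (f x)⁻¹ := by
  rw [isAlgebraic_iff_eval₂] at hf ⊢
  obtain ⟨Q, hQ, h⟩ := hf
  refine ⟨Polynomial.X * Q.reverse, mul_ne_zero Polynomial.X_ne_zero (by simpa using hQ),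
    fun x => ?_⟩
  rw [Polynomial.eval₂_mul, Polynomial.eval₂_X]
  by_cases hx : f x = 0
  · simp [hx]
  · let _ := invertibleOfNonzero hx
    have := (Polynomial.eval₂_reverse_eq_zero_iff (polyEval x) (f x) Q).2 (h x)
    rw [invOf_eq_inv] at this
    rw [this, mul_zero]

lemma isAlgebraic_const (c : ℂ) : IsAlgebraic (MvPolynomial ι ℝ) fun _ : ι → ℝ => c := by
  have hc : IsAlgebraic ℝ c := Algebra.IsAlgebraic.isAlgebraic c
  obtain ⟨p, hp, h⟩ := hc
  rw [isAlgebraic_iff_eval₂]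
  refine ⟨p.map MvPolynomial.C,
    by simpa [Polynomial.map_ne_zero_iff (MvPolynomial.C_injective ι ℝ)],
    fun x => ?_⟩
  rw [Polynomial.eval₂_map]
  convert h using 1
  rw [Polynomial.aeval_def]
  congr 1
  ext
  simp [polyEval]

/-- Away from its zeros, an algebraic function satisfies an equation with a nonzero constant
coefficient. -/
lemma exists_coeff_zero_ne_zero (hf : IsAlgebraic (MvPolynomial ι ℝ) f) :
    ∃ Q : Polynomial (MvPolynomial ι ℝ), Q.coeff 0 ≠ 0 ∧
      ∀ x, f x ≠ 0 → Q.eval₂ (polyEval x) (f x) = 0 := by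
  rw [isAlgebraic_iff_eval₂] at hf
  obtain ⟨Q, hQ, h⟩ := hf
  suffices H : ∀ n (Q : Polynomial (MvPolynomial ι ℝ)), Q.natDegree ≤ n → Q ≠ 0 →
      (∀ x, f x ≠ 0 → Q.eval₂ (polyEval x) (f x) = 0) →
      ∃ Q : Polynomial (MvPolynomial ι ℝ), Q.coeff 0 ≠ 0 ∧
        ∀ x, f x ≠ 0 → Q.eval₂ (polyEval x) (f x) = 0 from
    H _ Q le_rfl hQ fun x _ => h x
  intro n
  induction n with
  | zero =>
    intro Q hn hQ h
    refine ⟨Q, fun h0 => hQ ?_, h⟩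
    rw [Polynomial.eq_C_of_natDegree_le_zero hn, h0, map_zero]
  | succ n ih =>
    intro Q hn hQ h
    by_cases h0 : Q.coeff 0 = 0
    · have hX : Q.divX * Polynomial.X = Q := by
        have := Polynomial.divX_mul_X_add Q
        rwa [h0, map_zero, add_zero] at this
      refine ih Q.divX ?_ ?_ fun x hx => ?_
      · rw [Polynomial.natDegree_divX_eq_natDegree_tsub_one]; omega
      · intro h1; rw [h1, zero_mul] at hX; exact hQ hX.symm
      · have := h x hx
        rw [← hX, Polynomial.eval₂_mul, Polynomial.eval₂_X] at this
        exact (mul_eq_zero.1 this).resolve_right hx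
    · exact ⟨Q, h0, h⟩

variable [Fintype ι]

lemma isTame_coord (i : ι) : IsTame (realGaussian ι) fun x => (x i : ℂ) := by
  have hpos : ∀ x : ι → ℝ, 0 < 1 + |x i| := fun x => by positivity
  refine ⟨fun x => (1 + |x i|)⁻¹, ⟨fun x => inv_nonneg.2 (hpos x).le, fun x =>
    inv_le_one_of_one_le₀ (by linarith [abs_nonneg (x i)]), ?_⟩, fun x => ⟨?_, fun x' hx' => ?_⟩⟩
  · refine hasSmallBall_of_lintegral_inv (Measurable.aemeasurable (by fun_prop)) ?_
    have h1 : ∀ x : ι → ℝ, (ENNReal.ofReal (1 + |x i|)⁻¹)⁻¹ = ENNReal.ofReal (1 + |x i|) := by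
      intro x
      rw [ENNReal.ofReal_inv_of_pos (hpos x), inv_inv]
    simp_rw [h1]
    have hint : Integrable (fun x : ι → ℝ => 1 + |x i|) (realGaussian ι) := by
      have h2 : Integrable (fun y : ℝ => 1 + |y|) (gaussianReal 0 (1 / 2)) :=
        (integrable_const 1).add (IsGaussian.integrable_id.abs)
      have hmp := measurePreserving_eval (fun _ : ι => gaussianReal 0 (1 / 2)) i
      exact hmp.integrable_comp_of_integrable h2
    exact hint.lintegral_lt_top
  · rw [Complex.norm_real, Real.norm_eq_abs, inv_mul_eq_div, div_le_one (hpos x)]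
    linarith
  · rw [← Complex.ofReal_sub, Complex.norm_real, Real.norm_eq_abs]
    have h1 := dist_le_pi_dist x' x i
    rw [Real.dist_eq] at h1
    have h2 : (1 + |x i|)⁻¹ ≤ 1 := inv_le_one_of_one_le₀ (by linarith [abs_nonneg (x i)])
    calc (1 + |x i|)⁻¹ * |x' i - x i| ≤ 1 * |x' i - x i| :=
          mul_le_mul_of_nonneg_right h2 (abs_nonneg _)
      _ ≤ _ := by linarith

lemma isTame_polyEval (p : MvPolynomial ι ℝ) : IsTame (realGaussian ι) fun x => polyEval x p := by
  induction p using MvPolynomial.induction_on with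
  | C a => simpa [polyEval] using isTame_const (γ := realGaussian ι) (a : ℂ)
  | add p q hp hq => simpa only [map_add] using hp.add hq
  | mul_X p i hp =>
    simp only [map_mul]
    refine hp.mul ?_
    simpa [polyEval] using isTame_coord i

lemma hasSmallBall_polyEval (p : MvPolynomial ι ℝ) (hp : p ≠ 0) :
    HasSmallBall (realGaussian ι) fun x => ‖polyEval x p‖ := by
  have h := hasSmallBall_eval isAntiConcentrated_gaussianReal (p.map Complex.ofRealHom)
    (by simpa using (MvPolynomial.map_injective _ Complex.ofRealHom.injective).ne hp)
  refine h.mono fun x => le_of_eq ?_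
  rw [MvPolynomial.eval_map]
  congr 1
  rw [← MvPolynomial.coe_eval₂Hom]
  refine DFunLike.congr_fun (?_ : _ = polyEval x) p
  apply MvPolynomial.ringHom_ext <;> simp [polyEval]

/-- The values of an algebraic function are separated from `0` by a gauge: where the function
does not vanish, its modulus is at least that of the constant coefficient of an equation,
divided by the size of the other coefficients. -/
lemma exists_gauge_isSeparatedBy (hf : IsAlgebraic (MvPolynomial ι ℝ) f) :
    ∃ u, IsGauge (realGaussian ι) u ∧ IsSeparatedBy f u := by
  obtain ⟨Q, hQ0, hQ⟩ := exists_coeff_zero_ne_zero hf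
  set d := Q.natDegree with hd
  set a : ℕ → (ι → ℝ) → ℂ := fun i x => polyEval x (Q.coeff i) with ha
  obtain ⟨w, hw, hctrl⟩ := exists_common_gauge (γ := realGaussian ι) (Finset.range (d + 1))
    (F := a) fun i _ => isTame_polyEval _
  have hd0 : (0 : ℝ) < d + 1 := by positivity
  set c : ℝ := 1 / (4 * (d + 1)) with hc
  have hcpos : 0 < c := by positivity
  have hc1 : c ≤ 1 / 4 := by
    rw [hc]; apply one_div_le_one_div_of_le <;> linarith [(Nat.cast_nonneg d : (0 : ℝ) ≤ d)]
  have hcd : c * (4 * d) ≤ 1 := by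
    rw [hc, div_mul_eq_mul_div, one_mul, div_le_one (by positivity)]; linarith
  have h0mem : 0 ∈ Finset.range (d + 1) := by simp
  -- the truncated constant coefficient is a gauge
  have hwa : IsGauge (realGaussian ι) fun x => w x * ‖a 0 x‖ :=
    ⟨fun x => mul_nonneg (hw.nonneg x) (norm_nonneg _), fun x => (hctrl 0 h0mem x).1,
      hw.small.mul (hasSmallBall_polyEval _ hQ0) hw.nonneg⟩
  have hwwa := hw.mul hwa
  refine ⟨_, hwwa.const_mul hcpos (by linarith), fun x x' hx' => ?_⟩
  rw [or_iff_not_imp_left]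
  intro hfx
  have hle := hwwa.le_one x
  have hnn := hwwa.nonneg x
  have hw0 := hw.nonneg x
  have hw1 := hw.le_one x
  rcases hw0.eq_or_lt with hwx | hwx
  · simp [← hwx]
  by_cases hbig : 1 ≤ ‖f x'‖
  · nlinarith
  push Not at hbig
  have hwle : w x * (w x * ‖a 0 x‖) ≤ w x := hw.mul_le_left hwa x
  have hdist : dist x' x ≤ w x := by nlinarith
  have hcoef : ∀ i ∈ Finset.range (d + 1), w x * ‖a i x'‖ ≤ 2 := by
    intro i hi
    have h1 := mul_le_mul_of_nonneg_left (norm_le_norm_add_norm_sub' (a i x') (a i x)) hw0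
    have h2 := (hctrl i hi x).1
    have h3 := (hctrl i hi x).2 x' hdist
    linarith
  have ha0 : ‖a 0 x‖ / 2 ≤ ‖a 0 x'‖ := by
    have h1 := norm_le_norm_add_norm_sub (a 0 x') (a 0 x)
    have h2 := (hctrl 0 h0mem x).2 x' hdist
    have h3 : w x * ‖a 0 x' - a 0 x‖ ≤ w x * (‖a 0 x‖ / 2) := by
      refine h2.trans (hx'.trans ?_)
      have h4 : 0 ≤ w x * ‖a 0 x‖ := by positivity
      have h5 : w x * (w x * ‖a 0 x‖) ≤ w x * ‖a 0 x‖ := mul_le_of_le_one_left h4 hw1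
      nlinarith
    have h4 := le_of_mul_le_mul_left h3 hwx
    linarith
  have hsum : ‖a 0 x'‖ ≤ ‖f x'‖ * ∑ i ∈ Finset.range d, ‖a (i + 1) x'‖ := by
    have h1 := hQ x' hfx
    rw [Polynomial.eval₂_eq_sum_range, ← hd, Finset.sum_range_succ'] at h1
    have h2 : a 0 x' = -∑ i ∈ Finset.range d, a (i + 1) x' * f x' ^ (i + 1) := by
      rw [pow_zero, mul_one] at h1
      exact eq_neg_of_add_eq_zero_right h1
    rw [h2, norm_neg, Finset.mul_sum]
    refine (norm_sum_le _ _).trans (Finset.sum_le_sum fun i _ => ?_)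
    rw [norm_mul, norm_pow, mul_comm]
    refine mul_le_mul_of_nonneg_right ?_ (norm_nonneg _)
    rw [pow_succ]
    exact mul_le_of_le_one_left (norm_nonneg _) (pow_le_one₀ (norm_nonneg _) hbig.le)
  have hS : w x * ∑ i ∈ Finset.range d, ‖a (i + 1) x'‖ ≤ 2 * d := by
    rw [Finset.mul_sum]
    refine (Finset.sum_le_sum fun i hi => hcoef (i + 1) ?_).trans_eq ?_
    · simp only [Finset.mem_range] at hi ⊢; omega
    · simp [mul_comm]
  have hfin : w x * ‖a 0 x‖ ≤ ‖f x'‖ * (4 * d) := by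
    have h1 := mul_le_mul_of_nonneg_left hS (norm_nonneg (f x'))
    have h2 := mul_le_mul_of_nonneg_left (ha0.trans hsum) hw0
    nlinarith
  calc c * (w x * (w x * ‖a 0 x‖)) ≤ c * (w x * ‖a 0 x‖) := by
        refine mul_le_mul_of_nonneg_left (mul_le_of_le_one_left (by positivity) hw1) hcpos.le
    _ ≤ c * (‖f x'‖ * (4 * d)) := mul_le_mul_of_nonneg_left hfin hcpos.le
    _ = (c * (4 * d)) * ‖f x'‖ := by ring
    _ ≤ ‖f x'‖ := mul_le_of_le_one_left (norm_nonneg _) hcd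

/-- Measurable algebraic functions of Gaussian coordinates that are tame. -/
structure IsTameAlgebraic (f : (ι → ℝ) → ℂ) : Prop where
  measurable : Measurable f
  tame : IsTame (realGaussian ι) f
  algebraic : IsAlgebraic (MvPolynomial ι ℝ) f

namespace IsTameAlgebraic

variable {g : (ι → ℝ) → ℂ}

lemma const (c : ℂ) : IsTameAlgebraic fun _ : ι → ℝ => c :=
  ⟨measurable_const, isTame_const c, isAlgebraic_const c⟩

lemma coord (i : ι) : IsTameAlgebraic fun x : ι → ℝ => (x i : ℂ) where
  measurable := by fun_prop
  tame := isTame_coord i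
  algebraic := by
    convert isAlgebraic_algebraMap (A := (ι → ℝ) → ℂ) (MvPolynomial.X i : MvPolynomial ι ℝ) using 1
    funext x
    change _ = polyEval x (MvPolynomial.X i)
    simp [polyEval]

lemma add (hf : IsTameAlgebraic f) (hg : IsTameAlgebraic g) :
    IsTameAlgebraic fun x => f x + g x :=
  ⟨hf.measurable.add hg.measurable, hf.tame.add hg.tame, hf.algebraic.add hg.algebraic⟩

lemma mul (hf : IsTameAlgebraic f) (hg : IsTameAlgebraic g) :
    IsTameAlgebraic fun x => f x * g x :=
  ⟨hf.measurable.mul hg.measurable, hf.tame.mul hg.tame, hf.algebraic.mul hg.algebraic⟩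

lemma star (hf : IsTameAlgebraic f) : IsTameAlgebraic fun x => star (f x) :=
  ⟨continuous_star.measurable.comp hf.measurable, hf.tame.star, isAlgebraic_star hf.algebraic⟩

lemma inv (hf : IsTameAlgebraic f) : IsTameAlgebraic fun x => (f x)⁻¹ :=
  ⟨hf.measurable.inv,
    let ⟨_, hu, h⟩ := exists_gauge_isSeparatedBy hf.algebraic; hf.tame.inv hu h,
    isAlgebraic_inv hf.algebraic⟩

lemma sum {κ : Type*} (s : Finset κ) {F : κ → (ι → ℝ) → ℂ}
    (hF : ∀ k ∈ s, IsTameAlgebraic (F k)) : IsTameAlgebraic fun x => ∑ k ∈ s, F k x := by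
  classical
  induction s using Finset.induction_on with
  | empty => simpa using const (ι := ι) 0
  | insert i s hi ih =>
    simp only [Finset.sum_insert hi]
    exact (hF i (by simp)).add (ih fun j hj => hF j (by simp [hj]))

lemma norm {m : ℕ} {F : Fin m → (ι → ℝ) → ℂ} (hF : ∀ k, IsTameAlgebraic (F k)) :
    IsTameAlgebraic fun x => ((√(∑ k, ‖F k x‖ ^ 2) : ℝ) : ℂ) where
  measurable := by
    have := fun k => (hF k).measurable
    fun_prop
  tame := IsTame.norm fun k => (hF k).tame
  algebraic := by
    refine IsAlgebraic.of_pow two_pos ?_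
    have h := (sum Finset.univ fun k _ => (hF k).mul (hF k).star).algebraic
    convert h using 1
    funext x
    rw [Pi.pow_apply, ← Complex.ofReal_pow,
      Real.sq_sqrt (Finset.sum_nonneg fun _ _ => by positivity), Complex.ofReal_sum]
    refine Finset.sum_congr rfl fun k _ => ?_
    rw [Complex.star_def, Complex.mul_conj, Complex.normSq_eq_norm_sq]

/-- A tame algebraic function that does not vanish almost everywhere is rarely small. -/
lemma hasSmallBall (hf : IsTameAlgebraic f) (h : ∀ᵐ x ∂(realGaussian ι), f x ≠ 0) :
    HasSmallBall (realGaussian ι) fun x => ‖f x‖ := by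
  obtain ⟨u, hu, hfu⟩ := exists_gauge_isSeparatedBy hf.algebraic
  refine hu.small.mono_ae ?_
  filter_upwards [h] with x hx
  exact (hfu x x (by simpa using hu.nonneg x)).resolve_left hx

end IsTameAlgebraic

end Algebraic

/-! ### The Moore-Penrose inverse as a rational expression -/

section PinvFormula

variable {κ ν : Type*} [Fintype κ] [Fintype ν]

lemma isMoorePenrose_pinv (A : Matrix κ ν ℂ) : IsMoorePenrose A (pinv A) :=
  (exists_isMoorePenrose A).choose_spec

lemma IsMoorePenrose.unique {A : Matrix κ ν ℂ} {X Y : Matrix ν κ ℂ} (hX : IsMoorePenrose A X)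
    (hY : IsMoorePenrose A Y) : X = Y := by
  have h1 : A * X = A * Y := by
    have e : A * Y * (A * X) = A * X := by rw [← Matrix.mul_assoc, hY.mul_mul]
    have e' := congrArg Matrix.conjTranspose e
    rw [Matrix.conjTranspose_mul, hX.hermitian_left, hY.hermitian_left, ← Matrix.mul_assoc,
      hX.mul_mul] at e'
    exact e'.symm
  have h2 : X * A = Y * A := by
    have e : X * A * (Y * A) = X * A := by rw [Matrix.mul_assoc, ← Matrix.mul_assoc A, hY.mul_mul]
    have e' := congrArg Matrix.conjTranspose e
    rw [Matrix.conjTranspose_mul, hX.hermitian_right, hY.hermitian_right, Matrix.mul_assoc,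
      ← Matrix.mul_assoc A, hX.mul_mul] at e'
    exact e'.symm
  rw [← hX.mul_mul', h2, Matrix.mul_assoc, h1, ← Matrix.mul_assoc, hY.mul_mul']

lemma star_charpoly_coeff_of_isHermitian [DecidableEq ν] {B : Matrix ν ν ℂ} (hB : Bᴴ = B) (k : ℕ) :
    star (B.charpoly.coeff k) = B.charpoly.coeff k := by
  have h := Matrix.charpoly_map B (starRingEnd ℂ)
  have h2 : B.map (starRingEnd ℂ) = Bᵀ := by
    conv_rhs => rw [← hB]
    ext i j; simp [Matrix.conjTranspose_apply]
  rw [h2, Matrix.charpoly_transpose] at h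
  conv_rhs => rw [h]
  rw [Polynomial.coeff_map]
  rfl

open scoped ComplexOrder in
lemma mul_eq_zero_of_hermitian_pow_mul {B G : Matrix ν ν ℂ} [DecidableEq ν] (hB : Bᴴ = B) (k : ℕ)
    (h : B ^ k * G = 0) : B * G = 0 := by
  induction k with
  | zero => rw [pow_zero, Matrix.one_mul] at h; rw [h, Matrix.mul_zero]
  | succ k ih =>
    cases k with
    | zero => simpa using h
    | succ k =>
      apply ih
      rw [← Matrix.conjTranspose_mul_self_eq_zero, Matrix.conjTranspose_mul,
        Matrix.conjTranspose_pow, hB, Matrix.mul_assoc, ← Matrix.mul_assoc (B ^ (k + 1)),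
        ← pow_add, show k + 1 + (k + 1) = k + (k + 1 + 1) by ring, pow_add, Matrix.mul_assoc, h]
      simp

open scoped ComplexOrder in
/-- If the characteristic polynomial of `B = Aᴴ * A` has trailing degree `d`, the Moore-Penrose
inverse of `A` is `p(B) * Aᴴ` for an explicit polynomial `p`: dividing the characteristic
polynomial by `X ^ d` leaves an annihilator `g` of `B` on the orthogonal complement of its kernel,
and `p = -(g - g(0)) / (g(0) X)` inverts `B` there. -/
lemma pinv_eq_of_trailing [DecidableEq ν] (A : Matrix κ ν ℂ) (d : ℕ)
    (hlt : ∀ j < d, (Aᴴ * A).charpoly.coeff j = 0) (hd : (Aᴴ * A).charpoly.coeff d ≠ 0) :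
    pinv A = -((Aᴴ * A).charpoly.coeff d)⁻¹ •
      ((∑ k ∈ Finset.range (Fintype.card ν + 1),
        (Aᴴ * A).charpoly.coeff (k + 1 + d) • (Aᴴ * A) ^ k) * Aᴴ) := by
  set B := Aᴴ * A with hBdef
  have hB : Bᴴ = B := by simp [hBdef]
  set c := B.charpoly.coeff with hc
  obtain ⟨g, hg⟩ := Polynomial.X_pow_dvd_iff.2 hlt
  have hgc : ∀ k, g.coeff k = c (k + d) := fun k => by
    rw [hc, hg, Polynomial.coeff_X_pow_mul]
  set G := Polynomial.aeval B g with hG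
  set S := ∑ k ∈ Finset.range (Fintype.card ν + 1), c (k + 1 + d) • B ^ k with hS
  have hS' : Polynomial.aeval B g.divX = S := by
    have hdeg : g.divX.natDegree < Fintype.card ν + 1 := by
      have hg0 : g ≠ 0 := by
        rintro rfl
        exact hd (by simpa using (hgc 0).symm)
      have h1 := congrArg Polynomial.natDegree hg
      rw [Matrix.charpoly_natDegree_eq_dim, Polynomial.natDegree_X_pow_mul _ hg0] at h1
      rw [Polynomial.natDegree_divX_eq_natDegree_tsub_one]
      omega
    rw [Polynomial.aeval_eq_sum_range' hdeg]
    refine Finset.sum_congr rfl fun k _ => ?_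
    rw [Polynomial.coeff_divX, hgc]
  have hGS : G = S * B + c d • (1 : Matrix ν ν ℂ) := by
    rw [hG]
    conv_lhs => rw [← Polynomial.divX_mul_X_add g]
    rw [map_add, map_mul, Polynomial.aeval_X, hS', Polynomial.aeval_C, hgc, zero_add,
      Algebra.algebraMap_eq_smul_one]
  have hcomm : S * B = B * S := by
    rw [← hS']
    have := (Commute.all g.divX Polynomial.X).map (Polynomial.aeval B)
    simpa using this.eq
  have hcommG : G * B = B * G := by
    rw [hG]
    have := (Commute.all g Polynomial.X).map (Polynomial.aeval B)
    simpa using this.eq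
  have hpow : B ^ d * G = 0 := by
    have := Matrix.aeval_self_charpoly B
    rwa [hg, map_mul, map_pow, Polynomial.aeval_X] at this
  have hBG : B * G = 0 := mul_eq_zero_of_hermitian_pow_mul hB d hpow
  have hAG : A * G = 0 := by
    rw [← Matrix.conjTranspose_mul_self_eq_zero, Matrix.conjTranspose_mul, Matrix.mul_assoc,
      ← Matrix.mul_assoc Aᴴ, ← hBdef, hBG, Matrix.mul_zero]
  have hGA : G * Aᴴ = 0 := by
    rw [← Matrix.self_mul_conjTranspose_eq_zero, Matrix.conjTranspose_mul,
      Matrix.conjTranspose_conjTranspose, Matrix.mul_assoc, ← Matrix.mul_assoc Aᴴ, ← hBdef,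
      ← Matrix.mul_assoc, hcommG, hBG, Matrix.zero_mul]
  have hSstar : Sᴴ = S := by
    rw [hS, Matrix.conjTranspose_sum]
    refine Finset.sum_congr rfl fun k _ => ?_
    rw [Matrix.conjTranspose_smul, Matrix.conjTranspose_pow, hB, hc,
      star_charpoly_coeff_of_isHermitian hB]
  have hcd : star (c d) = c d := star_charpoly_coeff_of_isHermitian hB d
  obtain ⟨Y, hY⟩ : ∃ Y : Matrix ν ν ℂ, Y = -(c d)⁻¹ • S := ⟨_, rfl⟩
  have hYstar : Yᴴ = Y := by
    rw [hY, Matrix.conjTranspose_smul, hSstar, star_neg, star_inv₀, hcd]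
  have hYB : Y * B = 1 - (c d)⁻¹ • G := by
    rw [hGS, smul_add, smul_smul, inv_mul_cancel₀ hd, one_smul, hY, Matrix.smul_mul, neg_smul]
    abel
  have hBY : B * Y = Y * B := by
    rw [hY, Matrix.smul_mul, Matrix.mul_smul, hcomm]
  have hX : -(c d)⁻¹ • (S * Aᴴ) = Y * Aᴴ := by rw [hY, Matrix.smul_mul]
  rw [hX]
  refine (isMoorePenrose_pinv A).unique ⟨?_, ?_, ?_, ?_⟩
  · rw [Matrix.mul_assoc, Matrix.mul_assoc Y, ← hBdef, hYB, Matrix.mul_sub, Matrix.mul_one,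
      Matrix.mul_smul, hAG, smul_zero, sub_zero]
  · rw [Matrix.mul_assoc Y, ← hBdef, ← Matrix.mul_assoc, hYB, Matrix.sub_mul, Matrix.sub_mul,
      Matrix.one_mul, Matrix.smul_mul, Matrix.smul_mul]
    have : G * Y = Y * G := by
      have h0 : G * S = S * G := by
        rw [hG, ← hS']
        exact ((Commute.all g g.divX).map (Polynomial.aeval B)).eq
      rw [hY, Matrix.mul_smul, Matrix.smul_mul, h0]
    rw [this, Matrix.mul_assoc Y, hGA, Matrix.mul_zero, smul_zero, sub_zero]
  · rw [Matrix.conjTranspose_mul, Matrix.conjTranspose_mul, Matrix.conjTranspose_conjTranspose,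
      hYstar, Matrix.mul_assoc]
  · rw [Matrix.mul_assoc, ← hBdef, Matrix.conjTranspose_mul, hYstar, hB, hBY]

/-- The Moore-Penrose inverse by sums, products, conjugation and total inverses only: the products
of the factors `1 - c j * (c j)⁻¹`, with `0⁻¹ = 0`, select the trailing degree. -/
lemma pinv_eq_sum [DecidableEq ν] (A : Matrix κ ν ℂ) :
    pinv A = ∑ d ∈ Finset.range (Fintype.card ν + 1),
      (∏ j ∈ Finset.range d, (1 - (Aᴴ * A).charpoly.coeff j * ((Aᴴ * A).charpoly.coeff j)⁻¹)) •
        (-((Aᴴ * A).charpoly.coeff d)⁻¹ •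
          ((∑ k ∈ Finset.range (Fintype.card ν + 1),
            (Aᴴ * A).charpoly.coeff (k + 1 + d) • (Aᴴ * A) ^ k) * Aᴴ)) := by
  set p := (Aᴴ * A).charpoly with hp
  have hp0 : p ≠ 0 := (Matrix.charpoly_monic _).ne_zero
  set d := p.natTrailingDegree with hd
  have hlt : ∀ j < d, p.coeff j = 0 := fun j hj =>
    Polynomial.coeff_eq_zero_of_lt_natTrailingDegree hj
  have hne : p.coeff d ≠ 0 := Polynomial.trailingCoeff_nonzero_iff_nonzero.2 hp0
  have hmem : d ∈ Finset.range (Fintype.card ν + 1) := by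
    have h1 := Polynomial.natTrailingDegree_le_natDegree p
    rw [hp, Matrix.charpoly_natDegree_eq_dim, ← hp] at h1
    simp only [Finset.mem_range]; omega
  rw [Finset.sum_eq_single_of_mem d hmem]
  · rw [Finset.prod_eq_one, one_smul]
    · exact pinv_eq_of_trailing A d hlt hne
    · intro j hj
      rw [hlt j (Finset.mem_range.1 hj), zero_mul, sub_zero]
  · intro j _ hj
    rcases lt_or_gt_of_ne hj with h | h
    · rw [hlt j h]; simp
    · rw [Finset.prod_eq_zero (Finset.mem_range.2 h), zero_smul]
      rw [mul_inv_cancel₀ hne, sub_self]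

end PinvFormula

/-- The ring of tame algebraic functions. -/
def tameAlgebraic (ι : Type*) [Fintype ι] : Subring ((ι → ℝ) → ℂ) where
  carrier := {f | IsTameAlgebraic f}
  mul_mem' hf hg := hf.mul hg
  one_mem' := IsTameAlgebraic.const 1
  add_mem' hf hg := hf.add hg
  zero_mem' := IsTameAlgebraic.const 0
  neg_mem' {f} hf := by
    have h : IsTameAlgebraic fun x => -1 * f x := (IsTameAlgebraic.const (-1)).mul hf
    simp only [neg_one_mul] at h
    exact h

lemma isTameAlgebraic_pinv {ι κ ν : Type*} [Fintype ι] [Fintype κ] [Fintype ν]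
    {F : κ → ν → (ι → ℝ) → ℂ} (hF : ∀ k l, IsTameAlgebraic (F k l)) (l : ν) (k : κ) :
    IsTameAlgebraic fun x => pinv (Matrix.of fun k' l' => F k' l' x) l k := by
  classical
  set A : (ι → ℝ) → Matrix κ ν ℂ := fun x => Matrix.of fun k' l' => F k' l' x with hA
  -- the Gram matrix over the ring of tame algebraic functions
  set B : Matrix ν ν (tameAlgebraic ι) := Matrix.of fun i j =>
    ⟨fun x => ∑ k', star (F k' i x) * F k' j x,
      IsTameAlgebraic.sum Finset.univ fun k' _ => (hF k' i).star.mul (hF k' j)⟩ with hB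
  set ev : (ι → ℝ) → tameAlgebraic ι →+* ℂ := fun x =>
    (Pi.evalRingHom (fun _ : ι → ℝ => ℂ) x).comp (tameAlgebraic ι).subtype with hev
  have hmap : ∀ x, (A x)ᴴ * A x = B.map (ev x) := by
    intro x
    ext i j
    simp [hA, hB, hev, Matrix.mul_apply]
  have hmem : ∀ f : tameAlgebraic ι, IsTameAlgebraic fun x => ev x f := fun f => f.2
  have hc : ∀ j, IsTameAlgebraic fun x => ((A x)ᴴ * A x).charpoly.coeff j := by
    intro j
    have h := hmem (B.charpoly.coeff j)
    convert h using 1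
    funext x
    rw [hmap, Matrix.charpoly_map, Polynomial.coeff_map]
  have hpow : ∀ n i j, IsTameAlgebraic fun x => (((A x)ᴴ * A x) ^ n : Matrix ν ν ℂ) i j := by
    intro n i j
    have h := hmem ((B ^ n) i j)
    convert h using 1
    funext x
    rw [hmap]
    have := Matrix.map_pow B (ev x) n
    rw [← this, Matrix.map_apply]
  have hneg : ∀ {f : (ι → ℝ) → ℂ}, IsTameAlgebraic f → IsTameAlgebraic fun x => -f x :=
    fun hf => (tameAlgebraic ι).neg_mem hf
  have hsub : ∀ {f g : (ι → ℝ) → ℂ}, IsTameAlgebraic f → IsTameAlgebraic g →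
      IsTameAlgebraic fun x => f x - g x := fun hf hg => (tameAlgebraic ι).sub_mem hf hg
  have hprod : ∀ d, IsTameAlgebraic fun x => ∏ j ∈ Finset.range d,
      (1 - ((A x)ᴴ * A x).charpoly.coeff j * (((A x)ᴴ * A x).charpoly.coeff j)⁻¹) := by
    intro d
    induction d with
    | zero => simpa using IsTameAlgebraic.const (ι := ι) 1
    | succ d ih =>
      simp only [Finset.prod_range_succ]
      exact ih.mul (hsub (IsTameAlgebraic.const 1) ((hc d).mul (hc d).inv))
  have hformula : ∀ x, pinv (A x) l k = ∑ d ∈ Finset.range (Fintype.card ν + 1),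
      (∏ j ∈ Finset.range d, (1 - ((A x)ᴴ * A x).charpoly.coeff j *
        (((A x)ᴴ * A x).charpoly.coeff j)⁻¹)) *
        (-(((A x)ᴴ * A x).charpoly.coeff d)⁻¹ *
          ∑ i, (∑ n ∈ Finset.range (Fintype.card ν + 1),
            ((A x)ᴴ * A x).charpoly.coeff (n + 1 + d) * (((A x)ᴴ * A x) ^ n : Matrix ν ν ℂ) l i) *
              star (F k i x)) := by
    intro x
    rw [pinv_eq_sum (A x)]
    simp [Matrix.sum_apply, Matrix.mul_apply, hA]
  change IsTameAlgebraic fun x => pinv (A x) l k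
  rw [funext hformula]
  refine IsTameAlgebraic.sum _ fun d _ => (hprod d).mul ((hneg (hc d).inv).mul ?_)
  refine IsTameAlgebraic.sum _ fun i _ => IsTameAlgebraic.mul ?_ (hF k i).star
  exact IsTameAlgebraic.sum _ fun n _ => (hc _).mul (hpow n l i)

/-! ### Gaussian matrices in real coordinates -/

section Coordinates

variable {κ ν : Type*}

/-- The real and imaginary parts of the entries of a matrix. -/
def toCoord (A : Matrix κ ν ℂ) : κ × ν × Fin 2 → ℝ :=
  fun p => if p.2.2 = 0 then (A p.1 p.2.1).re else (A p.1 p.2.1).im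

/-- The matrix with prescribed real and imaginary parts of its entries. -/
def ofCoord (x : κ × ν × Fin 2 → ℝ) : Matrix κ ν ℂ :=
  Matrix.of fun i a => ⟨x (i, a, 0), x (i, a, 1)⟩

lemma toCoord_ofCoord (x : κ × ν × Fin 2 → ℝ) : toCoord (ofCoord x) = x := by
  funext ⟨i, a, b⟩
  fin_cases b <;> simp [toCoord, ofCoord]

lemma ofCoord_toCoord (A : Matrix κ ν ℂ) : ofCoord (toCoord A) = A := by
  ext i a
  simp [toCoord, ofCoord]

lemma ofCoord_apply (x : κ × ν × Fin 2 → ℝ) (i : κ) (a : ν) :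
    ofCoord x i a = (x (i, a, 0) : ℂ) + Complex.I * (x (i, a, 1) : ℂ) := by
  apply Complex.ext <;> simp [ofCoord]

lemma measurable_entry (i : κ) (a : ν) : Measurable fun A : Matrix κ ν ℂ => A i a :=
  (measurable_pi_apply a).comp (measurable_pi_apply i)

lemma measurable_matrix {E : Type*} [MeasurableSpace E] {F : E → Matrix κ ν ℂ}
    (hF : ∀ i a, Measurable fun x => F x i a) : Measurable F :=
  measurable_pi_iff.2 fun i => measurable_pi_iff.2 fun a => hF i a

lemma measurable_toCoord : Measurable (toCoord : Matrix κ ν ℂ → _) := by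
  refine measurable_pi_iff.2 fun p => ?_
  have h := measurable_entry p.1 p.2.1
  by_cases hp : p.2.2 = 0
  · simp only [toCoord, hp, if_true]
    exact Complex.measurable_re.comp h
  · simp only [toCoord, hp, if_false]
    exact Complex.measurable_im.comp h

lemma measurable_ofCoord : Measurable (ofCoord : _ → Matrix κ ν ℂ) := by
  refine measurable_matrix fun i a => ?_
  simp only [ofCoord_apply]
  fun_prop

instance : IsProbabilityMeasure stdComplexNormal :=
  Measure.isProbabilityMeasure_map (MeasurableEquiv.measurable _).aemeasurable

variable [Fintype κ] [Fintype ν]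

instance : IsProbabilityMeasure (stdComplexNormalMatrix κ ν) := by
  unfold stdComplexNormalMatrix
  exact inferInstanceAs (IsProbabilityMeasure
    (Measure.pi fun _ : κ => Measure.pi fun _ : ν => stdComplexNormal))

lemma measurePreserving_curry {α β X : Type*} [Fintype α] [Fintype β] [MeasurableSpace X]
    (μ : Measure X) [IsProbabilityMeasure μ] :
    MeasurePreserving (Function.curry : (α × β → X) → α → β → X) (Measure.pi fun _ => μ)
      (Measure.pi fun _ => Measure.pi fun _ => μ) := by
  have h := Measure.infinitePi_map_curry (fun (_ : α) (_ : β) => μ)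
  simp only [Measure.infinitePi_eq_pi] at h
  exact ⟨(MeasurableEquiv.curry α β X).measurable, h⟩

lemma measurePreserving_ofCoord :
    MeasurePreserving (ofCoord : _ → Matrix κ ν ℂ) (realGaussian (κ × ν × Fin 2))
      (stdComplexNormalMatrix κ ν) := by
  set g := gaussianReal 0 (1 / 2)
  have h1 := measurePreserving_curry (α := κ) (β := ν × Fin 2) g
  have h2 := measurePreserving_pi (fun _ : κ => Measure.pi fun _ : ν × Fin 2 => g) _
    fun _ => measurePreserving_curry (α := ν) (β := Fin 2) g
  have h3 : MeasurePreserving (fun y : Fin 2 → ℝ => (⟨y 0, y 1⟩ : ℂ))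
      (Measure.pi fun _ : Fin 2 => g) stdComplexNormal := by
    have e1 := measurePreserving_finTwoArrow g
    have e2 : MeasurePreserving Complex.measurableEquivRealProd.symm (g.prod g) stdComplexNormal :=
      ⟨MeasurableEquiv.measurable _, rfl⟩
    exact e2.comp e1
  have h4 := measurePreserving_pi (fun _ : κ => Measure.pi fun _ : ν => Measure.pi
    fun _ : Fin 2 => g) _ fun _ => measurePreserving_pi (fun _ : ν => Measure.pi
      fun _ : Fin 2 => g) (fun _ => stdComplexNormal) fun _ => h3
  exact h4.comp (h2.comp h1)

lemma measurePreserving_toCoord :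
    MeasurePreserving (toCoord : Matrix κ ν ℂ → _) (stdComplexNormalMatrix κ ν)
      (realGaussian (κ × ν × Fin 2)) := by
  refine ⟨measurable_toCoord, ?_⟩
  rw [← measurePreserving_ofCoord.map_eq, Measure.map_map measurable_toCoord measurable_ofCoord]
  have : (toCoord ∘ ofCoord : (κ × ν × Fin 2 → ℝ) → _) = id := funext toCoord_ofCoord
  rw [this, Measure.map_id]

/-! ### Matrix functions -/

/-- Functions of a matrix that are tame algebraic functions of the real and imaginary parts of its
entries. -/
def IsTameMatrixFun (f : Matrix κ ν ℂ → ℂ) : Prop := IsTameAlgebraic fun x => f (ofCoord x)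

lemma IsTameMatrixFun.measurable {f : Matrix κ ν ℂ → ℂ} (hf : IsTameMatrixFun f) :
    Measurable f := by
  have := (IsTameAlgebraic.measurable hf).comp measurable_toCoord
  convert this using 1
  funext A
  simp [ofCoord_toCoord]

lemma isTameMatrixFun_entry (i : κ) (a : ν) : IsTameMatrixFun fun A : Matrix κ ν ℂ => A i a := by
  simp only [IsTameMatrixFun, ofCoord_apply]
  exact (IsTameAlgebraic.coord _).add ((IsTameAlgebraic.const _).mul (IsTameAlgebraic.coord _))

lemma IsTameMatrixFun.mul {f g : Matrix κ ν ℂ → ℂ} (hf : IsTameMatrixFun f)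
    (hg : IsTameMatrixFun g) : IsTameMatrixFun fun A => f A * g A :=
  IsTameAlgebraic.mul hf hg

lemma IsTameMatrixFun.sum {τ : Type*} (s : Finset τ) {F : τ → Matrix κ ν ℂ → ℂ}
    (hF : ∀ k ∈ s, IsTameMatrixFun (F k)) : IsTameMatrixFun fun A => ∑ k ∈ s, F k A :=
  IsTameAlgebraic.sum s hF

lemma isTameMatrixFun_pinv {σ τ : Type*} [Fintype σ] [Fintype τ]
    {F : Matrix κ ν ℂ → Matrix σ τ ℂ} (hF : ∀ k l, IsTameMatrixFun fun A => F A k l)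
    (l : τ) (k : σ) : IsTameMatrixFun fun A => pinv (F A) l k :=
  isTameAlgebraic_pinv (F := fun k l x => F (ofCoord x) k l) hF l k

lemma IsPrecoderExpr.isTameMatrixFun {κ ν : Type} [Fintype κ] [Fintype ν]
    {f : Matrix κ ν ℂ → ℂ} (hf : IsPrecoderExpr f) : IsTameMatrixFun f := by
  induction hf with
  | entry i a => exact isTameMatrixFun_entry i a
  | const c => exact IsTameAlgebraic.const c
  | conj _ ih => exact IsTameAlgebraic.star ih
  | add _ _ ih ih' => exact IsTameAlgebraic.add ih ih'
  | mul _ _ ih ih' => exact IsTameAlgebraic.mul ih ih'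
  | norm _ ih => exact IsTameAlgebraic.norm ih
  | pinv _ l k ih => exact isTameMatrixFun_pinv ih l k

/-- Finitely many tame functions of a Gaussian matrix are controlled by a common gauge, distances
between matrices being measured by the largest entry. -/
lemma exists_matrix_gauge {τ : Type*} (s : Finset τ) {F : τ → Matrix κ ν ℂ → ℂ}
    (hF : ∀ k ∈ s, IsTameMatrixFun (F k)) :
    ∃ w : Matrix κ ν ℂ → ℝ, HasSmallBall (stdComplexNormalMatrix κ ν) w ∧ ∀ k ∈ s, ∀ A,
      w A * ‖F k A‖ ≤ 1 ∧ ∀ A' r, 0 ≤ r → r ≤ w A → (∀ i a, ‖A' i a - A i a‖ ≤ r) →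
        w A * ‖F k A' - F k A‖ ≤ r := by
  obtain ⟨w, hw, h⟩ := exists_common_gauge (γ := realGaussian (κ × ν × Fin 2)) s
    (F := fun k x => F k (ofCoord x)) fun k hk => (hF k hk).tame
  refine ⟨fun A => w (toCoord A), hw.small.comp measurePreserving_toCoord.hasLaw,
    fun k hk A => ?_⟩
  have h' := h k hk (toCoord A)
  simp only [ofCoord_toCoord] at h'
  refine ⟨h'.1, fun A' r hr hrw hA' => ?_⟩
  have hdist : dist (toCoord A') (toCoord A) ≤ r := by
    refine (dist_pi_le_iff hr).2 fun p => ?_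
    have h1 := hA' p.1 p.2.1
    rw [Real.dist_eq]
    by_cases hp : p.2.2 = 0
    · have := (Complex.abs_re_le_norm _).trans h1
      simpa [toCoord, hp] using this
    · have := (Complex.abs_im_le_norm _).trans h1
      simpa [toCoord, hp] using this
  have h2 := h'.2 (toCoord A') (hdist.trans hrw)
  rw [ofCoord_toCoord] at h2
  exact h2.trans hdist

lemma IsTameMatrixFun.hasSmallBall {f : Matrix κ ν ℂ → ℂ} (hf : IsTameMatrixFun f)
    (h : ∀ᵐ A ∂(stdComplexNormalMatrix κ ν), f A ≠ 0) :
    HasSmallBall (stdComplexNormalMatrix κ ν) fun A => ‖f A‖ := by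
  have h1 := IsTameAlgebraic.hasSmallBall hf
    (measurePreserving_ofCoord.quasiMeasurePreserving.ae h)
  have h2 := h1.comp measurePreserving_toCoord.hasLaw
  simpa only [ofCoord_toCoord] using h2

/-- A square submatrix of a Gaussian matrix is almost surely invertible. -/
lemma ae_det_submatrix_ne_zero {τ : Type*} [Fintype τ] [DecidableEq τ] (r : τ → κ) (s : τ → ν)
    (hr : r.Injective) (hs : s.Injective) :
    ∀ᵐ A ∂(stdComplexNormalMatrix κ ν), (A.submatrix r s).det ≠ 0 := by
  classical
  set Q : MvPolynomial (κ × ν × Fin 2) ℂ := (Matrix.of fun i j : τ =>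
    (MvPolynomial.X (r i, s j, 0) + MvPolynomial.C Complex.I * MvPolynomial.X (r i, s j, 1) :
      MvPolynomial (κ × ν × Fin 2) ℂ)).det with hQ
  have heval : ∀ x : κ × ν × Fin 2 → ℝ, MvPolynomial.eval (fun i => (x i : ℂ)) Q =
      ((ofCoord x).submatrix r s).det := by
    intro x
    rw [hQ, RingHom.map_det]
    congr 1
    ext i j
    simp [ofCoord_apply]
  have hQ0 : Q ≠ 0 := by
    intro h0
    have h1 := heval fun p => if p.2.2 = 0 ∧ ∃ i, r i = p.1 ∧ s i = p.2.1 then 1 else 0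
    rw [h0, map_zero] at h1
    have h2 : (ofCoord fun p : κ × ν × Fin 2 =>
        if p.2.2 = 0 ∧ ∃ i, r i = p.1 ∧ s i = p.2.1 then (1 : ℝ) else 0).submatrix r s =
        (1 : Matrix τ τ ℂ) := by
      ext i j
      have : (∃ i', r i' = r i ∧ s i' = s j) ↔ i = j :=
        ⟨fun ⟨k, h, h'⟩ => (hr h).symm.trans (hs h'), fun h => ⟨i, rfl, by rw [h]⟩⟩
      simp only [Matrix.submatrix_apply, ofCoord_apply, this, Matrix.one_apply]
      by_cases hij : i = j <;> simp [hij]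
    rw [h2, Matrix.det_one] at h1
    exact zero_ne_one h1
  have h3 := (hasSmallBall_eval isAntiConcentrated_gaussianReal Q hQ0).ae_pos
  have h4 := measurePreserving_toCoord.quasiMeasurePreserving.ae h3
  filter_upwards [h4] with A hA
  rw [heval, ofCoord_toCoord] at hA
  exact norm_pos_iff.1 hA

/-- A matrix with an invertible square submatrix on all of its rows has its Moore-Penrose inverse
as a right inverse. -/
lemma mul_pinv_eq_one [DecidableEq κ] (A : Matrix κ ν ℂ) (s : κ → ν)
    (h : (A.submatrix id s).det ≠ 0) : A * pinv A = 1 := by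
  set B := A.submatrix id s with hB
  have h1 : A * pinv A * B = B := by
    have := congrArg (fun C : Matrix κ ν ℂ => C.submatrix id s) (isMoorePenrose_pinv A).mul_mul
    ext i j
    have h2 := congrFun (congrFun this i) j
    simpa [Matrix.mul_apply, hB] using h2
  have hu : IsUnit B.det := isUnit_iff_ne_zero.2 h
  calc A * pinv A = A * pinv A * B * B⁻¹ := by
        rw [Matrix.mul_assoc _ B, Matrix.mul_nonsing_inv _ hu, Matrix.mul_one]
    _ = 1 := by rw [h1, Matrix.mul_nonsing_inv _ hu]

end Coordinates

/-! ### Rotation invariance and products of independent Gaussian matrices -/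

section Rotation

variable {κ ν : Type*} [Fintype κ] [Fintype ν]

instance {ι : Type*} [Fintype ι] : IsGaussian (realGaussian ι) := by
  have h := iIndepFun.hasGaussianLaw (P := realGaussian ι) (X := fun i (x : ι → ℝ) => x i)
    (fun i => ⟨by
      have := (measurePreserving_eval (fun _ : ι => gaussianReal 0 (1 / 2)) i).map_eq
      change IsGaussian (Measure.map (Function.eval i) (realGaussian ι))
      rw [realGaussian, this]; infer_instance⟩)
    (iIndepFun_pi (X := fun _ => id) fun _ => aemeasurable_id)
  have h2 := h.isGaussian_map
  rwa [show (fun (ω : ι → ℝ) (x : ι) => ω x) = id from rfl, Measure.map_id] at h2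

lemma map_rotation_realGaussian {ι : Type*} [Fintype ι] (θ : ℝ) :
    ((realGaussian ι).prod (realGaussian ι)).map (ContinuousLinearMap.rotation θ) =
      (realGaussian ι).prod (realGaussian ι) := by
  refine IsGaussian.map_rotation_eq_self ?_ θ
  funext i
  have hint : Integrable (fun x : ι → ℝ => x) (realGaussian ι) := IsGaussian.integrable_id
  have h1 := (ContinuousLinearMap.proj (R := ℝ) (φ := fun _ : ι => ℝ) i).integral_comp_comm hint
  simp only [ContinuousLinearMap.proj_apply] at h1
  change (∫ x, x ∂(realGaussian ι)) i = 0
  rw [← h1]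
  have hmp := measurePreserving_eval (fun _ : ι => gaussianReal 0 (1 / 2)) i
  have h2 := integral_map (μ := realGaussian ι) (φ := Function.eval i) (f := fun y : ℝ => y)
    (measurable_pi_apply i).aemeasurable (by fun_prop)
  rw [realGaussian, hmp.map_eq] at h2
  rw [realGaussian]
  refine h2.symm.trans ?_
  exact integral_id_gaussianReal

/-- An orthogonal combination of two independent Gaussian matrices is again a pair of independent
Gaussian matrices. -/
lemma hasLaw_rotation {Ω : Type*} [MeasurableSpace Ω] {μ : Measure Ω} [IsProbabilityMeasure μ]
    {H D : Ω → Matrix κ ν ℂ} (hH : HasLaw H (stdComplexNormalMatrix κ ν) μ)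
    (hD : HasLaw D (stdComplexNormalMatrix κ ν) μ) (hHD : IndepFun H D μ) {c z : ℝ}
    (hcz : c ^ 2 + z ^ 2 = 1) :
    HasLaw (fun ω => ((c : ℂ) • H ω + (z : ℂ) • D ω, -(z : ℂ) • H ω + (c : ℂ) • D ω))
      ((stdComplexNormalMatrix κ ν).prod (stdComplexNormalMatrix κ ν)) μ := by
  obtain ⟨θ, hc, hz⟩ : ∃ θ : ℝ, Real.cos θ = c ∧ Real.sin θ = z := by
    refine ⟨Complex.arg ⟨c, z⟩, ?_, ?_⟩
    · have h0 : (⟨c, z⟩ : ℂ) ≠ 0 := by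
        intro h
        have h1 := congrArg Complex.re h
        have h2 := congrArg Complex.im h
        simp only [Complex.zero_re, Complex.zero_im] at h1 h2
        rw [h1, h2] at hcz; norm_num at hcz
      have hn : ‖(⟨c, z⟩ : ℂ)‖ = 1 := by
        rw [Complex.norm_eq_sqrt_sq_add_sq]; simp [hcz]
      rw [Complex.cos_arg h0, hn, div_one]
    · have hn : ‖(⟨c, z⟩ : ℂ)‖ = 1 := by
        rw [Complex.norm_eq_sqrt_sq_add_sq]; simp [hcz]
      rw [Complex.sin_arg, hn, div_one]
  have hpair := (indepFun_iff_hasLaw_prodMk_prod hH hD).1 hHD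
  set G := realGaussian (κ × ν × Fin 2)
  have hto := (measurePreserving_toCoord (κ := κ) (ν := ν)).prod
    (measurePreserving_toCoord (κ := κ) (ν := ν))
  have hof := (measurePreserving_ofCoord (κ := κ) (ν := ν)).prod
    (measurePreserving_ofCoord (κ := κ) (ν := ν))
  have hrot : MeasurePreserving (ContinuousLinearMap.rotation (E := κ × ν × Fin 2 → ℝ) θ)
      (G.prod G) (G.prod G) := ⟨by fun_prop, map_rotation_realGaussian θ⟩
  have h := (hof.comp (hrot.comp hto)).comp_hasLaw hpair
  convert h using 1
  funext ω
  simp only [Function.comp_apply, Prod.map_apply, ContinuousLinearMap.rotation_apply, hc, hz]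
  refine Prod.ext ?_ ?_
  · ext i a
    apply Complex.ext <;> simp [ofCoord, toCoord]
  · ext i a
    apply Complex.ext <;> simp [ofCoord, toCoord]

lemma stdComplexNormal_re_add_lt (s t : ℝ) :
    stdComplexNormal {y | |y.re + s| < t} ≤ ENNReal.ofReal (2 * t) := by
  have hm : MeasurableSet {y : ℂ | |y.re + s| < t} :=
    measurableSet_lt (by fun_prop) measurable_const
  rw [stdComplexNormal, Measure.map_apply (MeasurableEquiv.measurable _) hm]
  have : Complex.measurableEquivRealProd.symm ⁻¹' {y : ℂ | |y.re + s| < t} =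
      {y : ℝ | |y - -s| < t} ×ˢ Set.univ := by
    ext p
    simp [Complex.measurableEquivRealProd]
  rw [this, Measure.prod_prod, measure_univ, mul_one]
  exact isAntiConcentrated_gaussianReal _ _

/-- A linear combination of independent standard complex normal variables is unlikely to be small
compared to any one of its coefficients. -/
lemma pi_stdComplexNormal_sum_lt (v : ν → ℂ) (a : ν) (ha : v a ≠ 0) (t : ℝ) :
    (Measure.pi fun _ : ν => stdComplexNormal) {y | ‖∑ b, y b * v b‖ < t} ≤
      ENNReal.ofReal (2 * (t / ‖v a‖)) := by
  classical
  set π := Measure.pi fun _ : ν => stdComplexNormal with hπ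
  have hind : iIndepFun (fun (b : ν) (y : ν → ℂ) => y b * v b) π :=
    iIndepFun_pi (X := fun b z => z * v b) fun b => (measurable_id.mul_const _).aemeasurable
  have hZW := (hind.indepFun_finsetSum_of_notMem (fun b => by fun_prop)
    (s := Finset.univ.erase a) (i := a) (by simp)).symm
  set Z : (ν → ℂ) → ℂ := fun y => y a * v a with hZ
  set W : (ν → ℂ) → ℂ := ∑ b ∈ Finset.univ.erase a, fun y => y b * v b with hW
  have hZm : Measurable Z := by fun_prop
  have hWm : Measurable W := by
    have : W = fun y => ∑ b ∈ Finset.univ.erase a, y b * v b := by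
      funext y; simp [hW]
    rw [this]; fun_prop
  have hprod := (indepFun_iff_map_prod_eq_prod_map_map hZm.aemeasurable hWm.aemeasurable).1 hZW
  set S : Set (ℂ × ℂ) := {p | ‖p.1 + p.2‖ < t} with hS
  have hSm : MeasurableSet S := measurableSet_lt (by fun_prop) measurable_const
  have hset : {y : ν → ℂ | ‖∑ b, y b * v b‖ < t} = (fun y => (Z y, W y)) ⁻¹' S := by
    ext y
    simp only [Set.mem_ofPred_eq, Set.mem_preimage, hS, hZ, hW, Finset.sum_apply]
    rw [Finset.add_sum_erase _ (fun b => y b * v b) (Finset.mem_univ a)]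
  have hpm1 : IsProbabilityMeasure (π.map Z) := Measure.isProbabilityMeasure_map hZm.aemeasurable
  have hpm2 : IsProbabilityMeasure (π.map W) := Measure.isProbabilityMeasure_map hWm.aemeasurable
  rw [hset, ← Measure.map_apply (hZm.prodMk hWm) hSm, hprod, Measure.prod_apply_symm hSm]
  have hbound : ∀ w, (π.map Z) ((fun z => (z, w)) ⁻¹' S) ≤ ENNReal.ofReal (2 * (t / ‖v a‖)) := by
    intro w
    rw [Measure.map_apply hZm (hSm.preimage (by fun_prop))]
    have hmp := measurePreserving_eval (fun _ : ν => stdComplexNormal) a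
    have hm : MeasurableSet {y : ℂ | |y.re + (w / v a).re| < t / ‖v a‖} :=
      measurableSet_lt (by fun_prop) measurable_const
    refine (measure_mono ?_).trans ((hmp.measure_preimage hm.nullMeasurableSet).trans_le
      (stdComplexNormal_re_add_lt _ _))
    intro y hy
    simp only [Set.mem_preimage, hS, hZ, Set.mem_ofPred_eq, Function.eval] at hy ⊢
    rw [lt_div_iff₀ (norm_pos_iff.2 ha)]
    refine lt_of_le_of_lt ?_ hy
    have e : y a * v a + w = (y a + w / v a) * v a := by field_simp
    rw [e, norm_mul]
    refine mul_le_mul_of_nonneg_right ?_ (norm_nonneg _)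
    simpa using Complex.abs_re_le_norm (y a + w / v a)
  refine (lintegral_mono hbound).trans ?_
  simp

/-- For independent Gaussian matrices `X` and `Y`, an entry of `Y * V X` is rarely small. -/
lemma hasSmallBall_mul_indep {ρ : Type*} {V : Matrix κ ν ℂ → Matrix ν ρ ℂ}
    (hV : ∀ a l, Measurable fun x => V x a l) (i : κ) (l : ρ) (a : ν)
    (ha : HasSmallBall (stdComplexNormalMatrix κ ν) fun x => ‖V x a l‖) :
    HasSmallBall ((stdComplexNormalMatrix κ ν).prod (stdComplexNormalMatrix κ ν))
      fun p => ‖(p.2 * V p.1) i l‖ := by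
  set γ := stdComplexNormalMatrix κ ν with hγ
  -- split according to the modulus of the coefficient: the quotient is small with small
  -- probability, uniformly in `X`
  have hquot : HasSmallBall (γ.prod γ) fun p => ‖(p.2 * V p.1) i l‖ / ‖V p.1 a l‖ := by
    refine ⟨2, two_pos, 1, one_pos, fun t ht _ => ?_⟩
    set A : Set (Matrix κ ν ℂ) := {x | V x a l = 0} with hA
    have hAm : MeasurableSet A := measurableSet_eq_fun (hV a l) measurable_const
    have hA0 : γ A = 0 := by
      have := ha.ae_pos
      rw [ae_iff] at this
      simpa using this
    have hm : Measurable fun p : Matrix κ ν ℂ × Matrix κ ν ℂ =>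
        ‖(p.2 * V p.1) i l‖ / ‖V p.1 a l‖ := by
      have h1 : Measurable fun p : Matrix κ ν ℂ × Matrix κ ν ℂ => (p.2 * V p.1) i l := by
        simp only [Matrix.mul_apply]
        refine Finset.measurable_fun_sum _ fun b _ => Measurable.mul ?_ ?_
        · exact (measurable_entry i b).comp measurable_snd
        · exact (hV b l).comp measurable_fst
      exact h1.norm.div ((hV a l).comp measurable_fst).norm
    rw [Measure.prod_apply (measurableSet_lt hm measurable_const)]
    have hae : ∀ᵐ x ∂γ, γ (Prod.mk x ⁻¹' {p : Matrix κ ν ℂ × Matrix κ ν ℂ |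
        ‖(p.2 * V p.1) i l‖ / ‖V p.1 a l‖ < t}) ≤ ENNReal.ofReal (2 * t ^ (1 : ℝ)) := by
      filter_upwards [measure_eq_zero_iff_ae_notMem.1 hA0] with x hx
      have hx0 : V x a l ≠ 0 := hx
      have hpos : 0 < ‖V x a l‖ := norm_pos_iff.2 hx0
      have hmp : MeasurePreserving (fun y : Matrix κ ν ℂ => y i) γ
          (Measure.pi fun _ : ν => stdComplexNormal) :=
        measurePreserving_eval (fun _ : κ => Measure.pi fun _ : ν => stdComplexNormal) i
      have hm2 : MeasurableSet {y : ν → ℂ | ‖∑ b, y b * V x b l‖ < t * ‖V x a l‖} :=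
        measurableSet_lt (by fun_prop) measurable_const
      have h2 := (hmp.measure_preimage hm2.nullMeasurableSet).trans_le
        (pi_stdComplexNormal_sum_lt (fun b => V x b l) a hx0 (t * ‖V x a l‖))
      rw [mul_div_assoc, div_self hpos.ne', mul_one] at h2
      rw [Real.rpow_one]
      refine (measure_mono fun y hy => ?_).trans h2
      simp only [Set.mem_preimage, Set.mem_ofPred_eq, Matrix.mul_apply] at hy ⊢
      rwa [div_lt_iff₀ hpos] at hy
    refine (lintegral_mono_ae hae).trans ?_
    simp
  have hfst : HasLaw (Prod.fst : Matrix κ ν ℂ × Matrix κ ν ℂ → _) γ (γ.prod γ) :=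
    measurePreserving_fst.hasLaw
  refine (hquot.mul (ha.comp hfst) fun p => by positivity).mono fun p => ?_
  by_cases h0 : ‖V p.1 a l‖ = 0
  · rw [h0, mul_zero]; exact norm_nonneg _
  · rw [div_mul_cancel₀ _ h0]

end Rotation

/-! ### Maximum a posteriori estimation -/

section MAP

variable {Ω : Type*} [MeasurableSpace Ω] {μ : Measure Ω} [IsProbabilityMeasure μ]
  {κ ν : Type*} [Fintype κ] [Fintype ν] {X Y : Ω → Matrix κ ν ℂ}

/-- The error probability of a decision rule as an integral over the posterior distributions. -/
lemma measure_ne_comp_eq (hX : AEMeasurable X μ) (hY : AEMeasurable Y μ)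
    {g : Matrix κ ν ℂ → Matrix κ ν ℂ} (hg : Measurable g) :
    μ {ω | Y ω ≠ g (X ω)} = 1 - ∫⁻ x, condDistrib Y X μ x {g x} ∂(μ.map X) := by
  set S : Set (Matrix κ ν ℂ × Matrix κ ν ℂ) := {p | p.2 = g p.1} with hS
  have hSm : MeasurableSet S := measurableSet_eq_fun measurable_snd (hg.comp measurable_fst)
  have hXY : AEMeasurable (fun ω => (X ω, Y ω)) μ := hX.prodMk hY
  have hp : IsProbabilityMeasure (μ.map fun ω => (X ω, Y ω)) := Measure.isProbabilityMeasure_map hXY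
  have hpX : IsProbabilityMeasure (μ.map X) := Measure.isProbabilityMeasure_map hX
  have h1 : μ {ω | Y ω ≠ g (X ω)} = (μ.map fun ω => (X ω, Y ω)) Sᶜ := by
    rw [Measure.map_apply_of_aemeasurable hXY hSm.compl]; rfl
  rw [h1, prob_compl_eq_one_sub hSm, ← compProd_map_condDistrib hY, Measure.compProd_apply hSm]
  rfl

/-- A maximum a posteriori rule has the smallest error probability of all decision rules. -/
lemma IsMAPEstimator.measure_ne_le {S : Set (Matrix κ ν ℂ)} {e g : Matrix κ ν ℂ → Matrix κ ν ℂ}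
    (he : IsMAPEstimator μ X Y S e) (hX : AEMeasurable X μ) (hY : AEMeasurable Y μ)
    (hg : Measurable g) (hgS : ∀ x, g x ∈ S) :
    μ {ω | Y ω ≠ e (X ω)} ≤ μ {ω | Y ω ≠ g (X ω)} := by
  rw [measure_ne_comp_eq hX hY he.measurable, measure_ne_comp_eq hX hY hg]
  refine tsub_le_tsub_left (lintegral_mono_ae ?_) 1
  filter_upwards [he.maximal] with x hx
  exact hx _ (hgS x)

end MAP

/-! ### Quantization -/

lemma abs_quantizeReal_sub_le {q : ℝ} (hq : 0 < q) (x : ℝ) : |quantizeReal q x - x| ≤ q / 2 := by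
  have h1 := Int.floor_le (x / q + 1 / 2)
  have h2 := Int.lt_floor_add_one (x / q + 1 / 2)
  have hx : x = q * (x / q) := by field_simp
  rw [quantizeReal, abs_le]
  constructor <;> nlinarith

/-- Two close points that are rounded differently lie near a boundary between two cells. -/
lemma exists_boundary_of_quantizeReal_ne {q δ : ℝ} (hq : 0 < q) {x y : ℝ} (hxy : |y - x| ≤ δ)
    (h : quantizeReal q y ≠ quantizeReal q x) : ∃ k : ℤ, |x - q * (k + 1 / 2)| ≤ δ := by
  have hne : ⌊y / q + 1 / 2⌋ ≠ ⌊x / q + 1 / 2⌋ := fun h' => h (by rw [quantizeReal, h']; rfl)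
  have hx : x = q * (x / q) := by field_simp
  have hy : y = q * (y / q) := by field_simp
  have hx1 := Int.floor_le (x / q + 1 / 2)
  have hx2 := Int.lt_floor_add_one (x / q + 1 / 2)
  have hy1 := Int.floor_le (y / q + 1 / 2)
  have hy2 := Int.lt_floor_add_one (y / q + 1 / 2)
  rw [abs_le] at hxy
  rcases lt_or_gt_of_ne hne with hlt | hlt
  · have h3 : ((⌊y / q + 1 / 2⌋ : ℝ)) + 1 ≤ (⌊x / q + 1 / 2⌋ : ℝ) := by exact_mod_cast hlt
    refine ⟨⌊y / q + 1 / 2⌋, ?_⟩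
    have e1 : y ≤ q * (⌊y / q + 1 / 2⌋ + 1 / 2) := by nlinarith
    have e2 : q * (⌊y / q + 1 / 2⌋ + 1 / 2) ≤ x := by nlinarith
    rw [abs_le]; constructor <;> linarith
  · have h3 : ((⌊x / q + 1 / 2⌋ : ℝ)) + 1 ≤ (⌊y / q + 1 / 2⌋ : ℝ) := by exact_mod_cast hlt
    refine ⟨⌊x / q + 1 / 2⌋, ?_⟩
    have e1 : x ≤ q * (⌊x / q + 1 / 2⌋ + 1 / 2) := by nlinarith
    have e2 : q * (⌊x / q + 1 / 2⌋ + 1 / 2) ≤ y := by nlinarith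
    rw [abs_le]; constructor <;> linarith

/-- A Gaussian variable in a bounded range is rarely close to the boundary between two cells: the
probability is at most the number of boundaries in the range times the length of an interval. -/
lemma gaussianReal_boundary_le {q δ R : ℝ} (hq : 0 < q) (hδ : 0 < δ) (hR : 0 ≤ R) :
    gaussianReal 0 (1 / 2) {x | |x| ≤ R ∧ ∃ k : ℤ, |x - q * (k + 1 / 2)| ≤ δ} ≤
      ENNReal.ofReal ((2 * ((R + δ) / q) + 4) * (4 * δ)) := by
  set n : ℕ := ⌈(R + δ) / q + 1 / 2⌉₊ with hn
  have hnn : 0 ≤ (R + δ) / q := by positivity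
  have hn1 : (R + δ) / q + 1 / 2 ≤ n := Nat.le_ceil _
  have hn2 : (n : ℝ) < (R + δ) / q + 1 / 2 + 1 := Nat.ceil_lt_add_one (by positivity)
  have hsub : {x | |x| ≤ R ∧ ∃ k : ℤ, |x - q * (k + 1 / 2)| ≤ δ} ⊆
      ⋃ k ∈ Finset.Icc (-(n : ℤ)) n, {x : ℝ | |x - q * (k + 1 / 2)| < 2 * δ} := by
    rintro x ⟨hx, k, hk⟩
    simp only [Set.mem_iUnion, Finset.mem_Icc, Set.mem_ofPred_eq]
    refine ⟨k, ?_, by linarith⟩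
    rw [abs_le] at hx hk
    have e1 : (k : ℝ) + 1 / 2 ≤ (R + δ) / q := by rw [le_div_iff₀ hq]; linarith
    have e2 : -((R + δ) / q) ≤ (k : ℝ) + 1 / 2 := by
      rw [neg_le, le_div_iff₀ hq]; linarith
    constructor
    · have : (-(n : ℝ)) ≤ k := by linarith
      exact_mod_cast this
    · have : (k : ℝ) ≤ n := by linarith
      exact_mod_cast this
  refine (measure_mono hsub).trans ((measure_biUnion_finset_le _ _).trans ?_)
  refine (Finset.sum_le_sum fun k _ => isAntiConcentrated_gaussianReal _ _).trans ?_
  have hcard : (Finset.Icc (-(n : ℤ)) n).card = 2 * n + 1 := by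
    rw [Int.card_Icc]; omega
  rw [Finset.sum_const, hcard, nsmul_eq_mul, ← ENNReal.ofReal_natCast,
    ← ENNReal.ofReal_mul (by positivity)]
  apply ENNReal.ofReal_le_ofReal
  push_cast
  nlinarith

section Quantize

variable {κ ν : Type*}

lemma measurable_quantizeReal (q : ℝ) : Measurable (quantizeReal q) := by
  unfold quantizeReal
  have : Measurable fun x : ℝ => ((⌊x / q + 1 / 2⌋ : ℤ) : ℝ) :=
    (measurable_from_top (f := fun k : ℤ => (k : ℝ))).comp
      (Int.measurable_floor.comp (by fun_prop))
  exact this.const_mul q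

lemma measurable_quantize (q : ℝ) : Measurable (quantize q : Matrix κ ν ℂ → _) := by
  refine measurable_matrix fun i a => ?_
  have h := measurable_entry (κ := κ) (ν := ν) i a
  have h1 := (measurable_quantizeReal q).comp (Complex.measurable_re.comp h)
  have h2 := (measurable_quantizeReal q).comp (Complex.measurable_im.comp h)
  have h3 := Complex.measurableEquivRealProd.symm.measurable.comp (h1.prodMk h2)
  exact h3

lemma norm_quantize_sub_le {q : ℝ} (hq : 0 < q) (A : Matrix κ ν ℂ) (i : κ) (a : ν) :
    ‖quantize q A i a - A i a‖ ≤ q := by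
  refine (Complex.norm_le_abs_re_add_abs_im _).trans ?_
  have h1 := abs_quantizeReal_sub_le hq (A i a).re
  have h2 := abs_quantizeReal_sub_le hq (A i a).im
  simp only [quantize, Matrix.map_apply, Complex.sub_re, Complex.sub_im]
  linarith

lemma quantize_eq_of_forall_boundary {q δ : ℝ} (hq : 0 < q) {A B : Matrix κ ν ℂ}
    (hAB : ∀ i a, ‖B i a - A i a‖ ≤ δ)
    (hA : ∀ p, ¬ ∃ k : ℤ, |toCoord A p - q * (k + 1 / 2)| ≤ δ) : quantize q B = quantize q A := by
  ext i a
  apply Complex.ext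
  · by_contra h
    refine hA (i, a, 0) ?_
    have := exists_boundary_of_quantizeReal_ne hq (x := (A i a).re) (y := (B i a).re)
      ((Complex.abs_re_le_norm (B i a - A i a)).trans (hAB i a)) h
    simpa [toCoord] using this
  · by_contra h
    refine hA (i, a, 1) ?_
    have := exists_boundary_of_quantizeReal_ne hq (x := (A i a).im) (y := (B i a).im)
      ((Complex.abs_im_le_norm (B i a - A i a)).trans (hAB i a)) h
    simpa [toCoord] using this

end Quantize

/-! ### Events of polynomially small probability -/

/-- A family of events whose probability decays at least like a power of the SNR. -/
def IsPolySmall {Ω : Type*} [MeasurableSpace Ω] (μ : Measure Ω) (F : ℝ → Set Ω) : Prop :=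
  ∃ C : ℝ, 0 < C ∧ ∃ b : ℝ, 0 < b ∧ ∀ᶠ P : ℝ in atTop, μ (F P) ≤ ENNReal.ofReal (C * √P ^ (-b))

lemma tendsto_sqrt_rpow_neg {b : ℝ} (hb : 0 < b) :
    Tendsto (fun P : ℝ => √P ^ (-b)) atTop (𝓝 0) :=
  (tendsto_rpow_neg_atTop hb).comp Real.tendsto_sqrt_atTop

/-- A constant factor is absorbed by an arbitrarily small increase of the exponent. -/
lemma eventually_const_mul_sqrt_rpow_le (C : ℝ) {a b : ℝ} (hab : a < b) :
    ∀ᶠ P : ℝ in atTop, C * √P ^ a ≤ √P ^ b := by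
  have h := (tendsto_sqrt_rpow_neg (sub_pos.2 hab)).const_mul C
  rw [mul_zero] at h
  filter_upwards [h.eventually_le_const one_pos, eventually_gt_atTop 0] with P hP hP0
  have hs : 0 < √P := Real.sqrt_pos.2 hP0
  have e : √P ^ a = √P ^ (-(b - a)) * √P ^ b := by rw [← Real.rpow_add hs]; ring_nf
  rw [e, ← mul_assoc]
  exact mul_le_of_le_one_left (Real.rpow_nonneg hs.le _) hP

section PolySmall

variable {Ω : Type*} [MeasurableSpace Ω] {μ : Measure Ω} {F G : ℝ → Set Ω}

lemma IsPolySmall.of_le (hF : IsPolySmall μ F) (h : ∀ᶠ P in atTop, μ (G P) ≤ μ (F P)) :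
    IsPolySmall μ G := by
  obtain ⟨C, hC, b, hb, H⟩ := hF
  exact ⟨C, hC, b, hb, by filter_upwards [H, h] with P h1 h2 using h2.trans h1⟩

lemma IsPolySmall.mono (hF : IsPolySmall μ F) (h : ∀ᶠ P in atTop, G P ⊆ F P) :
    IsPolySmall μ G :=
  hF.of_le (h.mono fun _ hP => measure_mono hP)

lemma isPolySmall_of_null (h : ∀ᶠ P in atTop, μ (F P) = 0) : IsPolySmall μ F :=
  ⟨1, one_pos, 1, one_pos, h.mono fun P hP => by rw [hP]; exact zero_le⟩

lemma IsPolySmall.union (hF : IsPolySmall μ F) (hG : IsPolySmall μ G) :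
    IsPolySmall μ fun P => F P ∪ G P := by
  obtain ⟨C, hC, b, hb, H⟩ := hF
  obtain ⟨C', hC', b', hb', H'⟩ := hG
  refine ⟨C + C', by positivity, min b b', by positivity, ?_⟩
  filter_upwards [H, H', eventually_ge_atTop 1] with P h h' hP
  have hs : 1 ≤ √P := Real.one_le_sqrt.2 hP
  have hs0 : 0 < √P := by linarith
  refine (measure_union_le _ _).trans ((add_le_add h h').trans ?_)
  rw [← ENNReal.ofReal_add (by positivity) (by positivity)]
  apply ENNReal.ofReal_le_ofReal
  rw [add_mul]
  gcongr
  · exact min_le_left _ _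
  · exact min_le_right _ _

lemma isPolySmall_iUnion {τ : Type*} [Finite τ] {F : τ → ℝ → Set Ω}
    (hF : ∀ k, IsPolySmall μ (F k)) : IsPolySmall μ fun P => ⋃ k, F k P := by
  classical
  have := Fintype.ofFinite τ
  have h : ∀ s : Finset τ, IsPolySmall μ fun P => ⋃ k ∈ s, F k P := by
    intro s
    induction s using Finset.induction_on with
    | empty => exact isPolySmall_of_null (by simp)
    | insert i s hi ih =>
      simp only [Finset.set_biUnion_insert]
      exact (hF i).union ih
  simpa using h Finset.univ

lemma HasSmallBall.isPolySmall {E : Type*} [MeasurableSpace E] {γ : Measure E} {g : E → ℝ}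
    (hg : HasSmallBall γ g) {X : ℝ → Ω → E} (hX : ∀ᶠ P in atTop, HasLaw (X P) γ μ) {s : ℝ}
    (hs : 0 < s) : IsPolySmall μ fun P => {ω | g (X P ω) < √P ^ (-s)} := by
  obtain ⟨C, hC, b, hb, H⟩ := hg
  refine ⟨C, hC, s * b, by positivity, ?_⟩
  filter_upwards [hX, eventually_ge_atTop 1] with P hP hP1
  have hs1 : 1 ≤ √P := Real.one_le_sqrt.2 hP1
  have hs0 : 0 < √P := by linarith
  have h1 := H (√P ^ (-s)) (by positivity) (Real.rpow_le_one_of_one_le_of_nonpos hs1 (by linarith))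
  rw [← Real.rpow_mul hs0.le, neg_mul, ← hP.map_eq] at h1
  exact (Measure.le_map_apply hP.aemeasurable _).trans h1

variable {κ ν : Type*} [Fintype κ] [Fintype ν]

lemma isPolySmall_entry_gt {X : ℝ → Ω → Matrix κ ν ℂ}
    (hX : ∀ᶠ P in atTop, HasLaw (X P) (stdComplexNormalMatrix κ ν) μ) {s : ℝ} (hs : 0 < s) :
    IsPolySmall μ fun P => {ω | ∃ i a, √P ^ s < ‖X P ω i a‖} := by
  obtain ⟨w, hw, h⟩ := exists_matrix_gauge (Finset.univ : Finset (κ × ν))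
    (F := fun p A => A p.1 p.2) fun p _ => isTameMatrixFun_entry p.1 p.2
  refine (hw.isPolySmall hX hs).mono ?_
  filter_upwards [eventually_ge_atTop 1] with P hP
  rintro ω ⟨i, a, hia⟩
  have h1 := (h (i, a) (Finset.mem_univ _) (X P ω)).1
  have hs1 : 1 ≤ √P := Real.one_le_sqrt.2 hP
  have hs0 : 0 < √P ^ s := Real.rpow_pos_of_pos (by linarith) _
  by_contra hcon
  simp only [Set.mem_ofPred_eq, not_lt] at hcon
  rw [Real.rpow_neg (by linarith)] at hcon
  have h2 : (√P ^ s)⁻¹ * √P ^ s < w (X P ω) * ‖X P ω i a‖ :=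
    mul_lt_mul' hcon hia hs0.le (lt_of_lt_of_le (by positivity) hcon)
  rw [inv_mul_cancel₀ hs0.ne'] at h2
  linarith

/-- If the accuracy of the estimates is finer than the quantization step by a power of the SNR,
then estimates rarely come close to the boundary between two cells. -/
lemma isPolySmall_boundary {X : ℝ → Ω → Matrix κ ν ℂ}
    (hX : ∀ᶠ P in atTop, HasLaw (X P) (stdComplexNormalMatrix κ ν) μ) {s a b : ℝ} (hs : 0 < s)
    (hb : 0 < b) (hab : 2 * s + b < a) :
    IsPolySmall μ fun P => {ω | ∃ p, |toCoord (X P ω) p| ≤ √P ^ s ∧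
      ∃ k : ℤ, |toCoord (X P ω) p - √P ^ (-b) * (k + 1 / 2)| ≤ 3 * √P ^ (s - a)} := by
  have hp : ∀ p, IsPolySmall μ fun P => {ω | |toCoord (X P ω) p| ≤ √P ^ s ∧
      ∃ k : ℤ, |toCoord (X P ω) p - √P ^ (-b) * (k + 1 / 2)| ≤ 3 * √P ^ (s - a)} := by
    intro p
    refine ⟨96, by norm_num, a - 2 * s - b, by linarith, ?_⟩
    filter_upwards [hX, eventually_ge_atTop 1, eventually_const_mul_sqrt_rpow_le 3
      (show s - a < 0 by linarith)] with P hP hP1 hδ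
    have hs1 : 1 ≤ √P := Real.one_le_sqrt.2 hP1
    have hs0 : 0 < √P := by linarith
    have hlaw : HasLaw (fun ω => toCoord (X P ω) p) (gaussianReal 0 (1 / 2)) μ :=
      (measurePreserving_eval (fun _ : κ × ν × Fin 2 => gaussianReal 0 (1 / 2)) p).comp_hasLaw
        (measurePreserving_toCoord.comp_hasLaw hP)
    have h1 := gaussianReal_boundary_le (q := √P ^ (-b)) (δ := 3 * √P ^ (s - a)) (R := √P ^ s)
      (by positivity) (by positivity) (by positivity)
    rw [← hlaw.map_eq] at h1
    refine (Measure.le_map_apply hlaw.aemeasurable _).trans (h1.trans ?_)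
    apply ENNReal.ofReal_le_ofReal
    have hR1 : 1 ≤ √P ^ s := Real.one_le_rpow hs1 hs.le
    have hδ1 : 3 * √P ^ (s - a) ≤ √P ^ s := by
      rw [Real.rpow_zero] at hδ; linarith
    have hq1 : 1 ≤ √P ^ b := Real.one_le_rpow hs1 hb.le
    have e1 : √P ^ (-(a - 2 * s - b)) = √P ^ s * √P ^ b * √P ^ (s - a) := by
      rw [← Real.rpow_add hs0, ← Real.rpow_add hs0]; ring_nf
    rw [e1, Real.rpow_neg hs0.le, div_inv_eq_mul]
    have e2 : (√P ^ s + 3 * √P ^ (s - a)) * √P ^ b ≤ 2 * (√P ^ s * √P ^ b) := by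
      have := mul_le_mul_of_nonneg_right hδ1 (by positivity : 0 ≤ √P ^ b)
      rw [add_mul]; linarith
    have e3 : 1 ≤ √P ^ s * √P ^ b := one_le_mul_of_one_le_of_one_le hR1 hq1
    have e4 : 0 < √P ^ (s - a) := by positivity
    nlinarith
  refine (isPolySmall_iUnion hp).mono (Eventually.of_forall fun P ω hω => ?_)
  obtain ⟨p, hp⟩ := hω
  exact Set.mem_iUnion.2 ⟨p, hp⟩

end PolySmall

/-! ### Comparison of rates -/

section Rates

variable {K : ℕ} {ν : Type*} [Fintype ν]

lemma instRate_nonneg {P : ℝ} (hP : 0 ≤ P) (H : Matrix (Fin K) ν ℂ) (T : Matrix ν (Fin K) ℂ)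
    (i : Fin K) : 0 ≤ instRate P H T i := by
  refine Real.logb_nonneg one_lt_two ?_
  have : 0 ≤ P * ‖(H * T) i i‖ ^ 2 / (1 + ∑ l ∈ Finset.univ.erase i, P * ‖(H * T) i l‖ ^ 2) := by
    positivity
  linarith

lemma PowerFeasible.norm_entry_le {ι κ : Type*} [Fintype κ] {T : Matrix ι κ ℂ}
    (hT : PowerFeasible T) (a : ι) (l : κ) : ‖T a l‖ ≤ 1 := by
  refine le_trans (Real.le_sqrt_of_sq_le ?_) (hT a)
  exact Finset.single_le_sum (f := fun i => ‖T a i‖ ^ 2) (fun _ _ => by positivity)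
    (Finset.mem_univ l)

lemma norm_mul_apply_le_of_powerFeasible {H : Matrix (Fin K) ν ℂ} {T : Matrix ν (Fin K) ℂ}
    (hT : PowerFeasible T) (i l : Fin K) : ‖(H * T) i l‖ ≤ ∑ a, ‖H i a‖ := by
  rw [Matrix.mul_apply]
  refine (norm_sum_le _ _).trans (Finset.sum_le_sum fun a _ => ?_)
  rw [norm_mul]
  exact mul_le_of_le_one_right (norm_nonneg _) (hT.norm_entry_le a l)

/-- Under the power constraint, the rate grows at most logarithmically in the SNR and in the
channel gain. -/
lemma instRate_le {P : ℝ} (hP : 0 ≤ P) (H : Matrix (Fin K) ν ℂ) {T : Matrix ν (Fin K) ℂ}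
    (hT : PowerFeasible T) (i : Fin K) :
    instRate P H T i ≤ Real.logb 2 (1 + P) + 2 / Real.log 2 * ∑ a, ‖H i a‖ := by
  set U := ∑ a, ‖H i a‖ with hU
  have hU0 : 0 ≤ U := Finset.sum_nonneg fun _ _ => norm_nonneg _
  have hlog2 : 0 < Real.log 2 := Real.log_pos one_lt_two
  have h1 : ‖(H * T) i i‖ ≤ U := norm_mul_apply_le_of_powerFeasible hT i i
  have hI : 0 ≤ ∑ l ∈ Finset.univ.erase i, P * ‖(H * T) i l‖ ^ 2 := by positivity
  have h2 : 1 + P * ‖(H * T) i i‖ ^ 2 / (1 + ∑ l ∈ Finset.univ.erase i, P * ‖(H * T) i l‖ ^ 2) ≤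
      (1 + P) * (1 + U) ^ 2 := by
    have h3 : P * ‖(H * T) i i‖ ^ 2 / (1 + ∑ l ∈ Finset.univ.erase i, P * ‖(H * T) i l‖ ^ 2) ≤
        P * ‖(H * T) i i‖ ^ 2 := div_le_self (by positivity) (by linarith)
    have h4 : P * ‖(H * T) i i‖ ^ 2 ≤ P * U ^ 2 := by gcongr
    nlinarith [mul_nonneg hP hU0, sq_nonneg U]
  calc instRate P H T i ≤ Real.logb 2 ((1 + P) * (1 + U) ^ 2) :=
        Real.logb_le_logb_of_le one_lt_two (by positivity) h2
    _ = Real.logb 2 (1 + P) + 2 * Real.logb 2 (1 + U) := by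
        rw [Real.logb_mul (by positivity) (by positivity), Real.logb_pow]; push_cast; ring
    _ ≤ _ := by
        have h5 : Real.log (1 + U) ≤ U := by
          have := Real.log_le_sub_one_of_pos (show 0 < 1 + U by linarith)
          linarith
        have h6 : Real.logb 2 (1 + U) ≤ U / Real.log 2 := by
          rw [Real.logb]; gcongr
        have h7 : 2 / Real.log 2 * U = 2 * (U / Real.log 2) := by ring
        linarith

lemma one_add_div_le {c d S I S' I' : ℝ} (hc : 0 < c) (hc1 : c ≤ 1) (hd : 1 ≤ d) (hS0 : 0 ≤ S)
    (hI0 : 0 ≤ I) (hS : S' ≤ d ^ 2 * S) (hI : c ^ 2 * I ≤ I') :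
    1 + S' / (1 + I') ≤ (d / c) ^ 2 * (1 + S / (1 + I)) := by
  have h0 : c ^ 2 ≤ 1 := pow_le_one₀ hc.le hc1
  have h2 : c ^ 2 * (1 + I) ≤ 1 + I' := by linarith
  have hc2 : 0 < c ^ 2 := by positivity
  have h3 : 0 < c ^ 2 * (1 + I) := mul_pos hc2 (by linarith)
  have h4 : S' / (1 + I') ≤ (d / c) ^ 2 * (S / (1 + I)) := by
    calc S' / (1 + I') ≤ d ^ 2 * S / (1 + I') :=
          div_le_div_of_nonneg_right hS (h3.le.trans h2)
      _ ≤ d ^ 2 * S / (c ^ 2 * (1 + I)) :=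
          div_le_div_of_nonneg_left (mul_nonneg (sq_nonneg d) hS0) h3 h2
      _ = _ := by rw [div_pow, mul_div_mul_comm]
  have h5 : 1 ≤ (d / c) ^ 2 := by
    apply one_le_pow₀
    rw [le_div_iff₀ hc]; linarith
  rw [mul_add, mul_one]
  exact add_le_add h5 h4

lemma instRate_le_add_of_relative {P : ℝ} (hP : 0 ≤ P) {H : Matrix (Fin K) ν ℂ}
    {T T' : Matrix ν (Fin K) ℂ} {i : Fin K} {c d : ℝ} (hc : 0 < c) (hc1 : c ≤ 1) (hd : 1 ≤ d)
    (hS : ‖(H * T') i i‖ ≤ d * ‖(H * T) i i‖) (hI : ∀ l, c * ‖(H * T) i l‖ ≤ ‖(H * T') i l‖) :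
    instRate P H T' i ≤ instRate P H T i + 2 * Real.logb 2 (d / c) := by
  have hsq : ∀ {x y z : ℝ}, 0 ≤ x → x ≤ y * z → P * x ^ 2 ≤ y ^ 2 * (P * z ^ 2) := by
    intro x y z hx hxy
    have := mul_le_mul_of_nonneg_left (pow_le_pow_left₀ hx hxy 2) hP
    calc P * x ^ 2 ≤ P * (y * z) ^ 2 := this
      _ = _ := by ring
  have h3 := one_add_div_le hc hc1 hd (by positivity)
    (Finset.sum_nonneg fun l _ => by positivity) (hsq (norm_nonneg _) hS)
    (I := ∑ l ∈ Finset.univ.erase i, P * ‖(H * T) i l‖ ^ 2)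
    (I' := ∑ l ∈ Finset.univ.erase i, P * ‖(H * T') i l‖ ^ 2) (by
      rw [Finset.mul_sum]
      refine Finset.sum_le_sum fun l _ => ?_
      have := mul_le_mul_of_nonneg_left
        (pow_le_pow_left₀ (mul_nonneg hc.le (norm_nonneg _)) (hI l) 2) hP
      calc c ^ 2 * (P * ‖(H * T) i l‖ ^ 2) = P * (c * ‖(H * T) i l‖) ^ 2 := by ring
        _ ≤ _ := this)
  have hdc : 0 < d / c := div_pos (by linarith) hc
  have hdiv : ∀ T : Matrix ν (Fin K) ℂ, 0 < 1 + P * ‖(H * T) i i‖ ^ 2 /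
      (1 + ∑ l ∈ Finset.univ.erase i, P * ‖(H * T) i l‖ ^ 2) := fun T => by positivity
  refine (Real.logb_le_logb_of_le one_lt_two (hdiv T') h3).trans_eq ?_
  rw [Real.logb_mul (pow_pos hdc 2).ne' (hdiv T).ne', Real.logb_pow, add_comm]
  rfl

/-- If all received amplitudes agree up to a small relative error, then so do the rates. -/
lemma abs_instRate_sub_le {P δ : ℝ} (hP : 0 ≤ P) (hδ : 0 ≤ δ) (hδ1 : δ < 1)
    {H : Matrix (Fin K) ν ℂ} {T T' : Matrix ν (Fin K) ℂ} {i : Fin K}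
    (h : ∀ l, ‖(H * T) i l - (H * T') i l‖ ≤ δ * ‖(H * T) i l‖) :
    |instRate P H T i - instRate P H T' i| ≤ 2 * Real.logb 2 ((1 + δ) / (1 - δ)) := by
  have hup : ∀ l, ‖(H * T') i l‖ ≤ (1 + δ) * ‖(H * T) i l‖ := fun l => by
    have := norm_le_norm_add_norm_sub ((H * T) i l) ((H * T') i l)
    linarith [h l]
  have hlo : ∀ l, (1 - δ) * ‖(H * T) i l‖ ≤ ‖(H * T') i l‖ := fun l => by
    have := norm_le_norm_add_norm_sub' ((H * T) i l) ((H * T') i l)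
    linarith [h l]
  have h1 := instRate_le_add_of_relative hP (c := 1 - δ) (d := 1 + δ) (by linarith) (by linarith)
    (by linarith) (hup i) hlo
  have hpos : 0 < 1 + δ := by linarith
  have hpos' : 0 < 1 - δ := by linarith
  have h2 := instRate_le_add_of_relative hP (H := H) (T := T') (T' := T) (i := i)
    (c := (1 + δ)⁻¹) (d := (1 - δ)⁻¹) (by positivity) (inv_le_one_of_one_le₀ (by linarith))
    ((one_le_inv₀ hpos').2 (by linarith))
    (by rw [inv_mul_eq_div, le_div_iff₀ hpos']; linarith [hlo i])
    (fun l => by rw [inv_mul_eq_div, div_le_iff₀ hpos]; linarith [hup l])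
  rw [show (1 - δ)⁻¹ / (1 + δ)⁻¹ = (1 + δ) / (1 - δ) by field_simp] at h2
  rw [abs_le]
  constructor <;> linarith

lemma measurable_instRate {P : ℝ} (i : Fin K) :
    Measurable fun p : Matrix (Fin K) ν ℂ × Matrix ν (Fin K) ℂ => instRate P p.1 p.2 i := by
  have h : ∀ l, Measurable fun p : Matrix (Fin K) ν ℂ × Matrix ν (Fin K) ℂ => (p.1 * p.2) i l := by
    intro l
    simp only [Matrix.mul_apply]
    refine Finset.measurable_fun_sum _ fun b _ => Measurable.mul ?_ ?_
    · exact (measurable_entry i b).comp measurable_fst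
    · exact (measurable_entry b l).comp measurable_snd
  have hS : ∀ l, Measurable fun p : Matrix (Fin K) ν ℂ × Matrix ν (Fin K) ℂ =>
      P * ‖(p.1 * p.2) i l‖ ^ 2 := fun l => ((h l).norm.pow_const 2).const_mul P
  have hI := Finset.measurable_fun_sum (Finset.univ.erase i) fun l _ => hS l
  exact (Real.measurable_log.comp (((hS i).div (hI.const_add 1)).const_add 1)).div_const _

variable {Ω : Type*} [MeasurableSpace Ω] {μ : Measure Ω} [IsProbabilityMeasure μ]
  {H : Ω → Matrix (Fin K) ν ℂ}

omit [IsProbabilityMeasure μ] in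
lemma integrable_norm_entry (hH : HasLaw H (stdComplexNormalMatrix (Fin K) ν) μ) (i : Fin K)
    (a : ν) : Integrable (fun ω => ‖H ω i a‖) μ := by
  have hco : ∀ b : Fin 2, Integrable (fun ω => toCoord (H ω) (i, a, b)) μ := by
    intro b
    have hlaw : HasLaw (fun ω => toCoord (H ω) (i, a, b)) (gaussianReal 0 (1 / 2)) μ :=
      (measurePreserving_eval (fun _ : Fin K × ν × Fin 2 => gaussianReal 0 (1 / 2)) _).comp_hasLaw
        (measurePreserving_toCoord.comp_hasLaw hH)
    have h1 : Integrable (fun y : ℝ => y) (gaussianReal 0 (1 / 2)) := IsGaussian.integrable_id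
    rw [← hlaw.map_eq] at h1
    exact h1.comp_aemeasurable hlaw.aemeasurable
  refine ((hco 0).abs.add (hco 1).abs).mono' ?_ (ae_of_all _ fun ω => ?_)
  · exact ((measurable_entry i a).comp_aemeasurable hH.aemeasurable).norm.aestronglyMeasurable
  · rw [norm_norm]
    simpa [toCoord] using Complex.norm_le_abs_re_add_abs_im (H ω i a)

lemma integrable_instRate {P : ℝ} (hP : 0 ≤ P)
    (hH : HasLaw H (stdComplexNormalMatrix (Fin K) ν) μ) {T : Ω → Matrix ν (Fin K) ℂ}
    (hT : AEMeasurable T μ) (hTp : ∀ ω, PowerFeasible (T ω)) (i : Fin K) :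
    Integrable (fun ω => instRate P (H ω) (T ω) i) μ := by
  have h1 : Integrable (fun ω => Real.logb 2 (1 + P) + 2 / Real.log 2 * ∑ a, ‖H ω i a‖) μ :=
    (integrable_const _).add
      ((integrable_finsetSum _ fun a _ => integrable_norm_entry hH i a).const_mul _)
  refine h1.mono' ?_ (ae_of_all _ fun ω => ?_)
  · exact ((measurable_instRate (P := P) i).comp_aemeasurable
      (hH.aemeasurable.prodMk hT)).aestronglyMeasurable
  · rw [Real.norm_of_nonneg (instRate_nonneg hP _ _ _)]
    exact instRate_le hP _ (hTp ω) i

omit [IsProbabilityMeasure μ] in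
lemma IsPolySmall.tendsto_measure {F : ℝ → Set Ω} (hF : IsPolySmall μ F) :
    Tendsto (fun P => μ (F P)) atTop (𝓝 0) := by
  obtain ⟨C, hC, b, hb, h⟩ := hF
  have h1 := ENNReal.tendsto_ofReal ((tendsto_sqrt_rpow_neg hb).const_mul C)
  rw [mul_zero, ENNReal.ofReal_zero] at h1
  exact tendsto_of_tendsto_of_tendsto_of_le_of_le' tendsto_const_nhds h1
    (Eventually.of_forall fun _ => zero_le) h

omit [IsProbabilityMeasure μ] in
/-- Polynomially small probabilities beat the logarithmic growth of the rates. -/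
lemma IsPolySmall.tendsto_logb_mul {F : ℝ → Set Ω} (hF : IsPolySmall μ F) :
    Tendsto (fun P => Real.logb 2 (1 + P) * μ.real (F P)) atTop (𝓝 0) := by
  obtain ⟨C, hC, b, hb, h⟩ := hF
  have hlog2 : 0 < Real.log 2 := Real.log_pos one_lt_two
  have hlim := (tendsto_sqrt_rpow_neg (show 0 < b / 2 by positivity)).const_mul
    ((2 : ℝ) ^ (b / 4) / (b / 4) / Real.log 2 * C)
  rw [mul_zero] at hlim
  refine tendsto_of_tendsto_of_tendsto_of_le_of_le' tendsto_const_nhds hlim ?_ ?_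
  · filter_upwards [eventually_ge_atTop 0] with P hP
    exact mul_nonneg (Real.logb_nonneg one_lt_two (by linarith)) measureReal_nonneg
  · filter_upwards [h, eventually_ge_atTop 1] with P hP hP1
    have hs : 1 ≤ √P := Real.one_le_sqrt.2 hP1
    have hs0 : 0 < √P := by linarith
    have h1 : Real.logb 2 (1 + P) ≤ (2 : ℝ) ^ (b / 4) / (b / 4) / Real.log 2 * √P ^ (b / 2) := by
      have h2 : Real.log (1 + P) ≤ (1 + P) ^ (b / 4) / (b / 4) :=
        Real.log_le_rpow_div (by linarith) (by positivity)
      have h3 : (1 + P) ^ (b / 4) ≤ (2 * P) ^ (b / 4) := by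
        gcongr
        linarith
      have h4 : (2 * P) ^ (b / 4) = 2 ^ (b / 4) * √P ^ (b / 2) := by
        rw [Real.mul_rpow (by norm_num) (by linarith)]
        congr 1
        rw [Real.sqrt_eq_rpow, ← Real.rpow_mul (by linarith)]
        ring_nf
      rw [Real.logb]
      calc Real.log (1 + P) / Real.log 2 ≤ (2 ^ (b / 4) * √P ^ (b / 2)) / (b / 4) / Real.log 2 := by
            rw [← h4]
            gcongr
            exact h2.trans (by gcongr)
        _ = _ := by ring
    have h2 : μ.real (F P) ≤ C * √P ^ (-b) := ENNReal.toReal_le_of_le_ofReal (by positivity) hP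
    calc Real.logb 2 (1 + P) * μ.real (F P)
        ≤ ((2 : ℝ) ^ (b / 4) / (b / 4) / Real.log 2 * √P ^ (b / 2)) * (C * √P ^ (-b)) := by
          gcongr
      _ = (2 : ℝ) ^ (b / 4) / (b / 4) / Real.log 2 * C * (√P ^ (b / 2) * √P ^ (-b)) := by ring
      _ = _ := by rw [← Real.rpow_add hs0]; ring_nf

/-- Two precoders have asymptotically equal expected sum rates if the received amplitudes agree up
to a vanishing relative error, except on events of polynomially small probability. -/
lemma tendsto_expectedSumRate_sub {Tc Td : ℝ → Ω → Matrix ν (Fin K) ℂ}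
    (hH : HasLaw H (stdComplexNormalMatrix (Fin K) ν) μ)
    (hTc : ∀ P, 1 < P → AEMeasurable (Tc P) μ) (hTd : ∀ P, 1 < P → AEMeasurable (Td P) μ)
    (hTcp : ∀ P, 1 < P → ∀ ω, PowerFeasible (Tc P ω))
    (hTdp : ∀ P, 1 < P → ∀ ω, PowerFeasible (Td P ω)) {δ : ℝ → ℝ} (hδ0 : ∀ᶠ P in atTop, 0 ≤ δ P)
    (hδ : Tendsto δ atTop (𝓝 0)) {F : ℝ → Set Ω} (hF : IsPolySmall μ F)
    (h : ∀ᶠ P in atTop, ∀ ω, ω ∉ F P → ∀ i l,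
      ‖(H ω * Tc P ω) i l - (H ω * Td P ω) i l‖ ≤ δ P * ‖(H ω * Tc P ω) i l‖) :
    Tendsto (fun P => expectedSumRate μ P H (Tc P) - expectedSumRate μ P H (Td P)) atTop (𝓝 0) := by
  simp only [expectedSumRate, ← Finset.sum_sub_distrib]
  rw [show (0 : ℝ) = ∑ _i : Fin K, 0 by simp]
  refine tendsto_finsetSum _ fun i _ => ?_
  set U : Ω → ℝ := fun ω => ∑ a, ‖H ω i a‖ with hU
  have hUint : Integrable U μ := integrable_finsetSum _ fun a _ => integrable_norm_entry hH i a
  have hlog2 : 0 < Real.log 2 := Real.log_pos one_lt_two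
  set c : ℝ := 2 / Real.log 2 with hc
  set G : ℝ → Set Ω := fun P => toMeasurable μ (F P) with hG
  have hGF : IsPolySmall μ G := hF.of_le (Eventually.of_forall fun P => (measure_toMeasurable _).le)
  have hGm : ∀ P, MeasurableSet (G P) := fun P => measurableSet_toMeasurable _ _
  have hlim : Tendsto (fun P => 2 * Real.logb 2 ((1 + δ P) / (1 - δ P)) +
      (Real.logb 2 (1 + P) * μ.real (G P) + c * ∫ ω in G P, U ω ∂μ)) atTop (𝓝 0) := by
    have h1 : Tendsto (fun P => Real.logb 2 ((1 + δ P) / (1 - δ P))) atTop (𝓝 0) := by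
      have e1 : Tendsto (fun P => (1 + δ P) / (1 - δ P)) atTop (𝓝 ((1 + 0) / (1 - 0))) :=
        (hδ.const_add 1).div (hδ.const_sub 1) (by norm_num)
      have e2 := (e1.log (by norm_num)).div_const (Real.log 2)
      simpa [Real.logb] using e2
    have h2 := hUint.tendsto_setIntegral_nhds_zero (s := G) hGF.tendsto_measure
    simpa using (h1.const_mul 2).add (hGF.tendsto_logb_mul.add (h2.const_mul c))
  refine squeeze_zero_norm' ?_ hlim
  filter_upwards [h, hδ0, hδ.eventually_lt_const one_pos, eventually_gt_atTop 1]
    with P hP hδP hδP1 hP1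
  have hP0 : 0 ≤ P := by linarith
  have hic := integrable_instRate hP0 hH (hTc P hP1) (hTcp P hP1) i
  have hid := integrable_instRate hP0 hH (hTd P hP1) (hTdp P hP1) i
  have hε : 0 ≤ 2 * Real.logb 2 ((1 + δ P) / (1 - δ P)) := by
    refine mul_nonneg two_pos.le (Real.logb_nonneg one_lt_two ?_)
    rw [one_le_div (by linarith)]; linarith
  have hB0 : ∀ ω, 0 ≤ Real.logb 2 (1 + P) + c * U ω := fun ω =>
    (instRate_nonneg hP0 _ _ _).trans (instRate_le hP0 (H ω) (hTcp P hP1 ω) i)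
  have hBint : Integrable (fun ω => Real.logb 2 (1 + P) + c * U ω) μ :=
    (integrable_const _).add (hUint.const_mul _)
  have hpt : ∀ ω, ‖instRate P (H ω) (Tc P ω) i - instRate P (H ω) (Td P ω) i‖ ≤
      2 * Real.logb 2 ((1 + δ P) / (1 - δ P)) +
        (G P).indicator (fun ω => Real.logb 2 (1 + P) + c * U ω) ω := by
    intro ω
    rw [Real.norm_eq_abs]
    by_cases hω : ω ∈ G P
    · rw [Set.indicator_of_mem hω]
      have e1 := instRate_nonneg hP0 (H ω) (Tc P ω) i
      have e2 := instRate_nonneg hP0 (H ω) (Td P ω) i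
      have e3 := instRate_le hP0 (H ω) (hTcp P hP1 ω) i
      have e4 := instRate_le hP0 (H ω) (hTdp P hP1 ω) i
      simp only [hU, hc] at *
      rw [abs_le]; constructor <;> linarith
    · rw [Set.indicator_of_notMem hω, add_zero]
      exact abs_instRate_sub_le hP0 hδP hδP1
        (hP ω (fun hF => hω (subset_toMeasurable _ _ hF)) i)
  rw [← integral_sub hic hid]
  refine (norm_integral_le_of_norm_le ((integrable_const _).add (hBint.indicator (hGm P)))
    (ae_of_all _ hpt)).trans_eq ?_
  have e1 := integral_add (μ := μ) (integrable_const (2 * Real.logb 2 ((1 + δ P) / (1 - δ P))))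
    (hBint.indicator (hGm P))
  simp only [Pi.add_apply] at e1 ⊢
  rw [e1, integral_indicator (hGm P), integral_const, integral_add (integrable_const _)
    (hUint.integrableOn.const_mul c), integral_const, integral_const_mul]
  simp [mul_comm]

end Rates

/-! ### The precoder of the distributed scheme -/

section Scheme

variable {M K : ℕ} [NeZero M] {N : Fin M → ℕ}

lemma sum_ant {R : Type*} [AddCommMonoid R] (f : Ant N → R) :
    ∑ a, f a = ∑ n : Fin (N 0), f ⟨0, n⟩ + ∑ a : {a : Ant N // a.1 ≠ 0}, f a.1 := by
  rw [← Fintype.sum_subtype_add_sum_subtype (fun a : Ant N => a.1 = 0) f]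
  congr 1
  symm
  refine Fintype.sum_bijective (fun n : Fin (N 0) => (⟨⟨0, n⟩, rfl⟩ : {a : Ant N // a.1 = 0}))
    ⟨fun n n' h => ?_, fun ⟨⟨j, n⟩, h⟩ => ?_⟩ _ _ fun _ => rfl
  · simpa using h
  · obtain rfl : j = 0 := h
    exact ⟨n, rfl⟩

/-- The channel from the best-informed transmitter to the receivers other than `l`. -/
def crossChannel (H1 : Matrix (Fin K) (Ant N) ℂ) (l : Fin K) :
    Matrix {i : Fin K // i ≠ l} (Fin (N 0)) ℂ :=
  H1.submatrix (fun i => i.1) fun n => (⟨0, n⟩ : Ant N)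

/-- The matrix that turns the deviation of the other transmitters into the correction of the
best-informed one, for the symbols of receiver `l`. -/
def correctionGain (H1 : Matrix (Fin K) (Ant N) ℂ) (l : Fin K) :
    Matrix (Fin (N 0)) {a : Ant N // a.1 ≠ 0} ℂ :=
  pinv (crossChannel H1 l) *
    H1.submatrix (fun i : {i : Fin K // i ≠ l} => i.1) fun a : {a : Ant N // a.1 ≠ 0} => a.1

lemma correction_apply (H1 : Matrix (Fin K) (Ant N) ℂ) (Vc W : Matrix (Ant N) (Fin K) ℂ)
    (l : Fin K) (n : Fin (N 0)) : correction H1 Vc W l n =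
      ∑ a : {a : Ant N // a.1 ≠ 0}, correctionGain H1 l n a * (Vc a.1 l - W a.1 l) := rfl

lemma isTameMatrixFun_correctionGain (l : Fin K) (n : Fin (N 0)) (a : {a : Ant N // a.1 ≠ 0}) :
    IsTameMatrixFun fun H1 : Matrix (Fin K) (Ant N) ℂ => correctionGain H1 l n a := by
  simp only [correctionGain, Matrix.mul_apply]
  refine IsTameMatrixFun.sum _ fun i _ => IsTameMatrixFun.mul ?_ (isTameMatrixFun_entry _ _)
  exact isTameMatrixFun_pinv (F := fun H1 : Matrix (Fin K) (Ant N) ℂ => crossChannel H1 l)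
    (fun k n => isTameMatrixFun_entry k.1 (⟨0, n⟩ : Ant N)) n i

/-- With at least `K - 1` antennas at the best-informed transmitter, its channel to any `K - 1`
receivers almost surely has full row rank. -/
lemma ae_crossChannel_mul_pinv (hN : K - 1 ≤ N 0) :
    ∀ᵐ H1 ∂(stdComplexNormalMatrix (Fin K) (Ant N)), ∀ l,
      crossChannel H1 l * pinv (crossChannel H1 l) = 1 := by
  refine ae_all_iff.2 fun l => ?_
  have hcard : Fintype.card {i : Fin K // i ≠ l} ≤ Fintype.card (Fin (N 0)) := by
    simpa [Fintype.card_subtype_compl] using hN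
  obtain ⟨s⟩ := Function.Embedding.nonempty_of_card_le hcard
  have h := ae_det_submatrix_ne_zero (κ := Fin K) (ν := Ant N)
    (fun i : {i : Fin K // i ≠ l} => i.1) (fun i : {i : Fin K // i ≠ l} => (⟨0, s i⟩ : Ant N))
    Subtype.val_injective fun i j hij => s.injective (by simpa using hij)
  filter_upwards [h] with H1 h1
  exact mul_pinv_eq_one _ s h1

/-- The correction restores zero forcing with respect to the estimate `H1`. -/
lemma zero_forcing_of_correction {H1 : Matrix (Fin K) (Ant N) ℂ} {Vc W T : Matrix (Ant N) (Fin K) ℂ}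
    {m : ℂ} {i l : Fin K} (hil : i ≠ l)
    (hpinv : crossChannel H1 l * pinv (crossChannel H1 l) = 1) (hV : (H1 * Vc) i l = 0)
    (h0 : ∀ n, T ⟨0, n⟩ l = m * (Vc ⟨0, n⟩ l + correction H1 Vc W l n))
    (h1 : ∀ a : Ant N, a.1 ≠ 0 → T a l = m * W a l) : (H1 * T) i l = 0 := by
  set B := H1.submatrix (fun i : {i : Fin K // i ≠ l} => i.1)
    fun a : {a : Ant N // a.1 ≠ 0} => a.1 with hB
  have hcorr : ∑ n, H1 i ⟨0, n⟩ * correction H1 Vc W l n =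
      ∑ a : {a : Ant N // a.1 ≠ 0}, H1 i a.1 * (Vc a.1 l - W a.1 l) := by
    have e : crossChannel H1 l *ᵥ correction H1 Vc W l =
        B *ᵥ fun a : {a : Ant N // a.1 ≠ 0} => Vc a.1 l - W a.1 l := by
      change crossChannel H1 l *ᵥ (pinv (crossChannel H1 l) * B) *ᵥ _ = _
      rw [Matrix.mulVec_mulVec, ← Matrix.mul_assoc, hpinv, Matrix.one_mul]
    exact congrFun e ⟨i, hil⟩
  rw [Matrix.mul_apply, sum_ant] at hV ⊢
  calc ∑ n, H1 i ⟨0, n⟩ * T ⟨0, n⟩ l + ∑ a : {a : Ant N // a.1 ≠ 0}, H1 i a.1 * T a.1 l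
      = m * (∑ n, H1 i ⟨0, n⟩ * Vc ⟨0, n⟩ l + (∑ n, H1 i ⟨0, n⟩ * correction H1 Vc W l n +
          ∑ a : {a : Ant N // a.1 ≠ 0}, H1 i a.1 * W a.1 l)) := by
        simp only [mul_add, Finset.mul_sum, ← add_assoc, ← Finset.sum_add_distrib]
        congr 1
        · refine Finset.sum_congr rfl fun n _ => ?_
          rw [h0]; ring
        · refine Finset.sum_congr rfl fun a _ => ?_
          rw [h1 _ a.2]; ring
    _ = m * (∑ n, H1 i ⟨0, n⟩ * Vc ⟨0, n⟩ l +
          ∑ a : {a : Ant N // a.1 ≠ 0}, H1 i a.1 * Vc a.1 l) := by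
        rw [hcorr, ← Finset.sum_add_distrib]
        congr 2
        exact Finset.sum_congr rfl fun a _ => by ring
    _ = 0 := by rw [hV, mul_zero]

variable {V : Matrix (Fin K) (Ant N) ℂ → Matrix (Ant N) (Fin K) ℂ} {q m : ℝ}
  {e : Fin M → Matrix (Fin K) (Ant N) ℂ → Matrix (Fin K) (Ant N) ℂ}
  {fallback : Matrix (Fin K) (Ant N) ℂ → Matrix (Fin (N 0)) (Fin K) ℂ}
  {G : Fin M → Matrix (Fin K) (Ant N) ℂ}

lemma PowerFeasible.const_mul_row {ι : Type*} {T T' : Matrix ι (Fin K) ℂ} {a : ι}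
    (hT : PowerFeasible T) (hm0 : 0 ≤ m) (hm1 : m ≤ 1) (h : ∀ i, T' a i = m * T a i) :
    √(∑ i, ‖T' a i‖ ^ 2) ≤ 1 := by
  refine le_trans (Real.sqrt_le_sqrt (Finset.sum_le_sum fun i _ => ?_)) (hT a)
  rw [h i, norm_mul, Complex.norm_real, Real.norm_of_nonneg hm0]
  have : m * ‖T a i‖ ≤ ‖T a i‖ := mul_le_of_le_one_left (norm_nonneg _) hm1
  exact pow_le_pow_left₀ (by positivity) this 2

lemma cdzf_apply_of_ne (a : Ant N) (ha : a.1 ≠ 0) (l : Fin K) :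
    cdzf V q m e fallback G a l = m * V (quantize q (G a.1)) a l := by
  simp [cdzf, ha, naivePrecoder]

lemma cdzf_apply_zero (n : Fin (N 0)) (l : Fin K)
    (hp : PowerFeasible (bestPrecoder V m (G 0) fun j => e j (G 0))) :
    cdzf V q m e fallback G ⟨0, n⟩ l = bestPrecoder V m (G 0) (fun j => e j (G 0)) n l := by
  simp [cdzf, hp]

lemma cdzf_apply_zero_of_not (n : Fin (N 0)) (l : Fin K)
    (hp : ¬ PowerFeasible (bestPrecoder V m (G 0) fun j => e j (G 0))) :
    cdzf V q m e fallback G ⟨0, n⟩ l = fallback (G 0) n l := by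
  simp [cdzf, hp]

lemma powerFeasible_cdzf (hV : ∀ H, PowerFeasible (V H)) (hm0 : 0 ≤ m) (hm1 : m ≤ 1)
    (hf : ∀ H, PowerFeasible (fallback H)) : PowerFeasible (cdzf V q m e fallback G) := by
  rintro ⟨j, n⟩
  by_cases hj : j = 0
  · subst hj
    by_cases hp : PowerFeasible (bestPrecoder V m (G 0) fun j => e j (G 0))
    · simp only [cdzf_apply_zero n _ hp]
      exact hp n
    · simp only [cdzf_apply_zero_of_not n _ hp]
      exact hf (G 0) n
  · exact PowerFeasible.const_mul_row (T := V (quantize q (G j)))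
      (T' := cdzf V q m e fallback G) (a := (⟨j, n⟩ : Ant N)) (hV _) hm0 hm1
      fun i => cdzf_apply_of_ne (⟨j, n⟩ : Ant N) hj i

lemma measurable_bestPrecoder (hV : ∀ a i, Measurable fun H => V H a i)
    (he : ∀ j, j ≠ 0 → Measurable (e j)) (n : Fin (N 0)) (l : Fin K) :
    Measurable fun H1 => bestPrecoder V m H1 (fun j => e j H1) n l := by
  simp only [bestPrecoder, Matrix.of_apply, correction_apply, naivePrecoder]
  refine Measurable.const_mul ((hV _ _).add (Finset.measurable_fun_sum _ fun a _ => ?_)) _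
  exact (isTameMatrixFun_correctionGain l n a).measurable.mul
    ((hV _ _).sub ((hV _ _).comp (he _ a.2)))

lemma measurable_cdzf (hV : ∀ a i, Measurable fun H => V H a i)
    (he : ∀ j, j ≠ 0 → Measurable (e j)) (hf : Measurable fallback) :
    Measurable (cdzf V q m e fallback) := by
  classical
  refine measurable_matrix fun ⟨j, n⟩ l => ?_
  by_cases hj : j = 0
  · subst hj
    have hb : ∀ n l, Measurable fun G : Fin M → Matrix (Fin K) (Ant N) ℂ =>
        bestPrecoder V m (G 0) (fun j => e j (G 0)) n l := fun n l =>
      (measurable_bestPrecoder (m := m) hV he n l).comp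
        (g := fun H1 => bestPrecoder V m H1 (fun j => e j H1) n l) (measurable_pi_apply (0 : Fin M))
    have hset : MeasurableSet {G : Fin M → Matrix (Fin K) (Ant N) ℂ |
        PowerFeasible (bestPrecoder V m (G 0) fun j => e j (G 0))} := by
      simp only [PowerFeasible, Set.ofPred_forall]
      refine MeasurableSet.iInter fun n => measurableSet_le ?_ measurable_const
      exact (Finset.measurable_fun_sum _ fun l _ => (hb n l).norm.pow_const 2).sqrt
    have h := @Measurable.ite _ _ _ _ _ _ _ (fun _ => Classical.propDecidable _) hset (hb n l)
      ((measurable_entry n l).comp (hf.comp (measurable_pi_apply (0 : Fin M))))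
    convert h using 1
    funext G
    by_cases hp : PowerFeasible (bestPrecoder V m (G 0) fun j => e j (G 0)) <;> simp [cdzf, hp]
  · simp only [cdzf_apply_of_ne (⟨j, n⟩ : Ant N) hj]
    exact ((hV _ _).comp ((measurable_quantize q).comp (measurable_pi_apply j))).const_mul _

/-- When the estimates of the best-informed transmitter are correct and the other transmitters hold
the same quantized matrix `X'`, a small correction fits into the power back-off, so that the
corrected precoder is in use; it deviates little from the centralized one. -/
lemma cdzf_close {X' : Matrix (Fin K) (Ant N) ℂ} (hV : ∀ H, PowerFeasible (V H)) (hm0 : 0 ≤ m)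
    (hm1 : m ≤ 1) (hq : ∀ j, j ≠ 0 → quantize q (G j) = X') (heX : ∀ j, j ≠ 0 → e j (G 0) = X')
    {κ : ℝ} (hκ : 0 ≤ κ) (hκm : K * κ ≤ 1 - m)
    (hdiff : ∀ a l, ‖V X' a l - V (G 0) a l‖ ≤ κ)
    (hcorr : ∀ l n, ‖correction (G 0) (V (G 0)) (V X') l n‖ ≤ κ) :
    (∀ n l, cdzf V q m e fallback G ⟨0, n⟩ l =
      m * (V (G 0) ⟨0, n⟩ l + correction (G 0) (V (G 0)) (V X') l n)) ∧
    (∀ a : Ant N, a.1 ≠ 0 → ∀ l, cdzf V q m e fallback G a l = m * V X' a l) ∧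
    ∀ a l, ‖V (G 0) a l - cdzf V q m e fallback G a l‖ ≤ κ + (1 - m) := by
  have hbest : ∀ n l, bestPrecoder V m (G 0) (fun j => e j (G 0)) n l =
      m * (V (G 0) ⟨0, n⟩ l + correction (G 0) (V (G 0)) (V X') l n) := by
    intro n l
    simp only [bestPrecoder, Matrix.of_apply, correction_apply, naivePrecoder]
    congr 2
    exact Finset.sum_congr rfl fun a _ => by rw [heX _ a.2]
  have hp : PowerFeasible (bestPrecoder V m (G 0) fun j => e j (G 0)) := by
    intro n
    set v : EuclideanSpace ℂ (Fin K) := WithLp.toLp 2 fun l => V (G 0) ⟨0, n⟩ l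
    set u : EuclideanSpace ℂ (Fin K) := WithLp.toLp 2 fun l =>
      correction (G 0) (V (G 0)) (V X') l n
    have e1 : √(∑ l, ‖bestPrecoder V m (G 0) (fun j => e j (G 0)) n l‖ ^ 2) =
        ‖(m : ℂ) • (v + u)‖ := by
      rw [EuclideanSpace.norm_eq]
      simp only [hbest]
      rfl
    have e2 : ‖v‖ ≤ 1 := by
      rw [EuclideanSpace.norm_eq]
      exact hV (G 0) ⟨0, n⟩
    have e3 : ‖u‖ ≤ K * κ := by
      rw [EuclideanSpace.norm_eq]
      refine Real.sqrt_le_iff.2 ⟨by positivity, ?_⟩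
      refine (Finset.sum_sq_le_sq_sum_of_nonneg fun l _ => norm_nonneg _).trans ?_
      refine pow_le_pow_left₀ (Finset.sum_nonneg fun _ _ => norm_nonneg _) ?_ 2
      refine (Finset.sum_le_sum fun l _ => hcorr l n).trans_eq ?_
      simp
    rw [e1, norm_smul, Complex.norm_real, Real.norm_of_nonneg hm0]
    have e4 := norm_add_le v u
    have e5 : ‖v + u‖ ≤ 1 + (1 - m) := by linarith
    nlinarith [norm_nonneg (v + u), sq_nonneg (1 - m)]
  have hz : ∀ n l, cdzf V q m e fallback G ⟨0, n⟩ l =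
      m * (V (G 0) ⟨0, n⟩ l + correction (G 0) (V (G 0)) (V X') l n) := fun n l => by
    rw [cdzf_apply_zero n l hp, hbest]
  have ho : ∀ a : Ant N, a.1 ≠ 0 → ∀ l, cdzf V q m e fallback G a l = m * V X' a l :=
    fun a ha l => by rw [cdzf_apply_of_ne a ha, hq _ ha]
  refine ⟨hz, ho, fun a l => ?_⟩
  have key : ∀ x d : ℂ, ‖x‖ ≤ 1 → ‖d‖ ≤ κ → ‖x - m * (x + d)‖ ≤ κ + (1 - m) := by
    intro x d hx hd
    have e1 : x - m * (x + d) = ((1 - m : ℝ) : ℂ) * x - m * d := by push_cast; ring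
    rw [e1]
    refine (norm_sub_le _ _).trans ?_
    rw [norm_mul, norm_mul, Complex.norm_real, Complex.norm_real, Real.norm_of_nonneg hm0,
      Real.norm_of_nonneg (by linarith)]
    have e2 : m * ‖d‖ ≤ κ := (mul_le_of_le_one_left (norm_nonneg _) hm1).trans hd
    have e3 : (1 - m) * ‖x‖ ≤ 1 - m := mul_le_of_le_one_right (by linarith) hx
    linarith
  have hx := (hV (G 0)).norm_entry_le a l
  obtain ⟨j, n⟩ := a
  by_cases hj : j = 0
  · subst hj
    rw [hz]
    exact key _ _ hx (hcorr l n)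
  · rw [ho ⟨j, n⟩ hj]
    have := key _ _ hx (hdiff ⟨j, n⟩ l)
    rwa [add_sub_cancel] at this

lemma norm_mul_apply_le {κ ν ρ : Type*} [Fintype ν] {A : Matrix κ ν ℂ} {T : Matrix ν ρ ℂ}
    {b t : ℝ} (hb : 0 ≤ b) {i : κ} {l : ρ} (hA : ∀ a, ‖A i a‖ ≤ b) (hT : ∀ a, ‖T a l‖ ≤ t) :
    ‖(A * T) i l‖ ≤ Fintype.card ν * (b * t) := by
  rw [Matrix.mul_apply]
  refine (norm_sum_le _ _).trans ((Finset.sum_le_sum (g := fun _ => b * t) fun a _ => ?_).trans_eq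
    ?_)
  · rw [norm_mul]; exact mul_le_mul (hA a) (hT a) (norm_nonneg _) hb
  · simp

/-- Two close precoders that both force zeros with respect to the estimate `X` lead to the same
received amplitudes up to a small relative error: the leakage is caused by `Y` only. -/
lemma relative_error_le {ν : Type*} [Fintype ν] {H X Y : Matrix (Fin K) ν ℂ}
    {T T' : Matrix ν (Fin K) ℂ} {c z b η s δ : ℝ} (hH : H = (c : ℂ) • X - (z : ℂ) • Y)
    (hc : 1 / 2 ≤ c) (hz : 0 ≤ z) (hb : 0 ≤ b) (hs : 0 ≤ s) (hδ : 0 ≤ δ)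
    (hHb : ∀ i a, ‖H i a‖ ≤ b) (hYb : ∀ i a, ‖Y i a‖ ≤ b) (hT : ∀ a l, ‖T a l‖ ≤ 1)
    (hTT : ∀ a l, ‖T a l - T' a l‖ ≤ η) (hX : ∀ i l, i ≠ l → (X * T) i l = 0)
    (hX' : ∀ i l, i ≠ l → (X * T') i l = 0) (hsig : ∀ i, s ≤ ‖(X * T) i i‖)
    (hleak : ∀ i l, s ≤ ‖(Y * T) i l‖) (hη : Fintype.card ν * (b * η) ≤ δ * (s / 4))
    (hzs : z * (Fintype.card ν * b) ≤ s / 4) (i l : Fin K) :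
    ‖(H * T) i l - (H * T') i l‖ ≤ δ * ‖(H * T) i l‖ := by
  have hexp : ∀ (T : Matrix ν (Fin K) ℂ) (i l : Fin K),
      (H * T) i l = c * (X * T) i l - z * (Y * T) i l := by
    intro T i l
    rw [hH, Matrix.sub_mul, Matrix.smul_mul, Matrix.smul_mul]
    rfl
  have hsub : ∀ (A : Matrix (Fin K) ν ℂ), (A * T) i l - (A * T') i l = (A * (T - T')) i l := by
    intro A
    rw [Matrix.mul_sub]; rfl
  by_cases hil : i = l
  · subst hil
    have e1 : ‖(H * T) i i - (H * T') i i‖ ≤ δ * (s / 4) := by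
      rw [hsub]
      exact (norm_mul_apply_le hb (hHb i) fun a => hTT a i).trans hη
    have e2 : s / 4 ≤ ‖(H * T) i i‖ := by
      rw [hexp]
      have e3 := norm_sub_norm_le ((c : ℂ) * (X * T) i i) ((z : ℂ) * (Y * T) i i)
      rw [norm_mul, norm_mul, Complex.norm_real, Complex.norm_real, Real.norm_of_nonneg hz,
        Real.norm_of_nonneg (by linarith)] at e3
      have e4 := norm_mul_apply_le hb (hYb i) fun a => hT a i
      rw [mul_one] at e4
      have e5 := mul_le_mul_of_nonneg_left e4 hz
      have e6 : 1 / 2 * s ≤ c * ‖(X * T) i i‖ := mul_le_mul hc (hsig i) hs (by linarith)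
      linarith
    exact e1.trans (mul_le_mul_of_nonneg_left e2 hδ)
  · have e1 : (H * T) i l - (H * T') i l = -(z * ((Y * (T - T')) i l)) := by
      rw [hexp, hexp, hX i l hil, hX' i l hil, ← hsub]
      ring
    have e2 : (H * T) i l = -(z * (Y * T) i l) := by
      rw [hexp, hX i l hil]; ring
    rw [e1, e2, norm_neg, norm_neg, norm_mul, norm_mul, Complex.norm_real, Real.norm_of_nonneg hz]
    have e3 : ‖(Y * (T - T')) i l‖ ≤ δ * ‖(Y * T) i l‖ := by
      refine (norm_mul_apply_le hb (hYb i) fun a => hTT a l).trans (hη.trans ?_)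
      exact mul_le_mul_of_nonneg_left (by linarith [hleak i l]) hδ
    calc z * ‖(Y * (T - T')) i l‖ ≤ z * (δ * ‖(Y * T) i l‖) := mul_le_mul_of_nonneg_left e3 hz
      _ = _ := by ring

end Scheme

/-! ### Estimates and residuals -/

section Estimate

variable {κ ν : Type*} {P a : ℝ}

/-- The part of the channel that is uncorrelated with its estimate: in the Gaussian model it is
independent of the estimate and has the law of the channel. -/
def residual (P a : ℝ) (H D : Matrix κ ν ℂ) : Matrix κ ν ℂ :=
  -((√P ^ (-a) : ℝ) : ℂ) • H + ((√(1 - (√P ^ (-a)) ^ 2) : ℝ) : ℂ) • D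

lemma sqrt_rpow_pos (hP : 1 < P) (a : ℝ) : 0 < √P ^ a :=
  Real.rpow_pos_of_pos (Real.sqrt_pos.2 (by linarith)) a

lemma sqrt_rpow_neg_le_one (hP : 1 < P) (ha : 0 < a) : √P ^ (-a) ≤ 1 :=
  Real.rpow_le_one_of_one_le_of_nonpos (Real.one_le_sqrt.2 hP.le) (by linarith)

lemma sq_add_sq_estimate (hP : 1 < P) (ha : 0 < a) :
    √(1 - (√P ^ (-a)) ^ 2) ^ 2 + (√P ^ (-a)) ^ 2 = 1 := by
  have h0 := (sqrt_rpow_pos hP (-a)).le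
  have h1 := pow_le_one₀ (n := 2) h0 (sqrt_rpow_neg_le_one hP ha)
  rw [Real.sq_sqrt (by linarith)]
  ring

lemma one_sub_le_sqrt_one_sub_sq {z : ℝ} (h0 : 0 ≤ z) (h1 : z ≤ 1) : 1 - z ≤ √(1 - z ^ 2) :=
  Real.le_sqrt_of_sq_le (by nlinarith)

lemma eq_estimate_sub_residual (hP : 1 < P) (ha : 0 < a) (H D : Matrix κ ν ℂ) :
    H = ((√(1 - (√P ^ (-a)) ^ 2) : ℝ) : ℂ) • estimate P a H D -
      ((√P ^ (-a) : ℝ) : ℂ) • residual P a H D := by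
  have h : (((√(1 - (√P ^ (-a)) ^ 2) : ℝ) : ℂ)) ^ 2 + (((√P ^ (-a) : ℝ) : ℂ)) ^ 2 = 1 := by
    exact_mod_cast sq_add_sq_estimate hP ha
  ext i b
  simp only [estimate, residual, Matrix.sub_apply, Matrix.smul_apply, Matrix.add_apply, smul_eq_mul]
  linear_combination (-H i b) * h

variable [Fintype κ] [Fintype ν] {Ω : Type*} [MeasurableSpace Ω] {μ : Measure Ω}
  [IsProbabilityMeasure μ] {H D D' : Ω → Matrix κ ν ℂ}

lemma hasLaw_estimate_residual (hP : 1 < P) (ha : 0 < a)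
    (hH : HasLaw H (stdComplexNormalMatrix κ ν) μ) (hD : HasLaw D (stdComplexNormalMatrix κ ν) μ)
    (hHD : IndepFun H D μ) :
    HasLaw (fun ω => (estimate P a (H ω) (D ω), residual P a (H ω) (D ω)))
      ((stdComplexNormalMatrix κ ν).prod (stdComplexNormalMatrix κ ν)) μ :=
  hasLaw_rotation hH hD hHD (sq_add_sq_estimate hP ha)

lemma hasLaw_estimate (hP : 1 < P) (ha : 0 < a)
    (hH : HasLaw H (stdComplexNormalMatrix κ ν) μ) (hD : HasLaw D (stdComplexNormalMatrix κ ν) μ)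
    (hHD : IndepFun H D μ) :
    HasLaw (fun ω => estimate P a (H ω) (D ω)) (stdComplexNormalMatrix κ ν) μ :=
  measurePreserving_fst.comp_hasLaw (hasLaw_estimate_residual hP ha hH hD hHD)

omit [Fintype κ] [Fintype ν] in
/-- The difference of two estimates is dominated by the noise of the less accurate one. -/
lemma norm_estimate_sub_le {a' t : ℝ} (hP : 1 < P) (ha' : 0 < a') (haa' : a' ≤ a)
    {A B B' : Matrix κ ν ℂ} {i : κ} {b : ν} (hA : ‖A i b‖ ≤ t) (hB : ‖B i b‖ ≤ t)
    (hB' : ‖B' i b‖ ≤ t) :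
    ‖estimate P a' A B' i b - estimate P a A B i b‖ ≤ 3 * (√P ^ (-a') * t) := by
  have hz0 := (sqrt_rpow_pos hP (-a)).le
  have hz0' := (sqrt_rpow_pos hP (-a')).le
  have hz1' := sqrt_rpow_neg_le_one hP ha'
  have hzz : √P ^ (-a) ≤ √P ^ (-a') :=
    Real.rpow_le_rpow_of_exponent_le (Real.one_le_sqrt.2 hP.le) (by linarith)
  simp only [estimate, Matrix.add_apply, Matrix.smul_apply, smul_eq_mul]
  set z := √P ^ (-a)
  set z' := √P ^ (-a')
  have hc1 := one_sub_le_sqrt_one_sub_sq hz0 (hzz.trans hz1')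
  have hc1' := one_sub_le_sqrt_one_sub_sq hz0' hz1'
  have hc2 : √(1 - z ^ 2) ≤ 1 := Real.sqrt_le_one.2 (by nlinarith)
  have hc2' : √(1 - z' ^ 2) ≤ 1 := Real.sqrt_le_one.2 (by nlinarith)
  set c := √(1 - z ^ 2)
  set c' := √(1 - z' ^ 2)
  have hc : |c' - c| ≤ z' := by rw [abs_le]; constructor <;> linarith
  have e : (c' : ℂ) * A i b + z' * B' i b - (c * A i b + z * B i b) =
      ((c' - c : ℝ) : ℂ) * A i b + z' * B' i b - z * B i b := by push_cast; ring
  rw [e]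
  refine (norm_sub_le _ _).trans ?_
  have h1 := norm_add_le (((c' - c : ℝ) : ℂ) * A i b) (z' * B' i b)
  simp only [norm_mul, Complex.norm_real, Real.norm_eq_abs, abs_of_nonneg hz0,
    abs_of_nonneg hz0'] at h1 ⊢
  have h2 : |c' - c| * ‖A i b‖ ≤ z' * t := mul_le_mul hc hA (norm_nonneg _) hz0'
  have h3 : z' * ‖B' i b‖ ≤ z' * t := mul_le_mul_of_nonneg_left hB' hz0'
  have h4 : z * ‖B i b‖ ≤ z' * t := mul_le_mul hzz hB (norm_nonneg _) hz0'
  linarith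

omit [Fintype κ] [Fintype ν] in
lemma abs_toCoord_le (A : Matrix κ ν ℂ) (p : κ × ν × Fin 2) : |toCoord A p| ≤ ‖A p.1 p.2.1‖ := by
  unfold toCoord
  split_ifs
  · exact Complex.abs_re_le_norm _
  · exact Complex.abs_im_le_norm _

/-- A quantizer that is coarser than the estimation errors gives the same result for both
estimates, outside of an event of polynomially small probability. -/
lemma isPolySmall_quantize_ne {a' b : ℝ} (hb : 0 < b) (hba : b < a') (haa' : a' ≤ a)
    (hH : HasLaw H (stdComplexNormalMatrix κ ν) μ) (hD : HasLaw D (stdComplexNormalMatrix κ ν) μ)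
    (hD' : HasLaw D' (stdComplexNormalMatrix κ ν) μ) (hHD : IndepFun H D μ) :
    IsPolySmall μ fun P => {ω | quantize (√P ^ (-b)) (estimate P a' (H ω) (D' ω)) ≠
      quantize (√P ^ (-b)) (estimate P a (H ω) (D ω))} := by
  set s := (a' - b) / 4 with hs
  have hs0 : 0 < s := by rw [hs]; linarith
  have hX : ∀ᶠ P in atTop, HasLaw (fun ω => estimate P a (H ω) (D ω))
      (stdComplexNormalMatrix κ ν) μ := by
    filter_upwards [eventually_gt_atTop 1] with P hP
    exact hasLaw_estimate hP (by linarith) hH hD hHD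
  have hH' := isPolySmall_entry_gt (X := fun _ => H) (Eventually.of_forall fun _ => hH) hs0
  have hD1 := isPolySmall_entry_gt (X := fun _ => D) (Eventually.of_forall fun _ => hD) hs0
  have hD2 := isPolySmall_entry_gt (X := fun _ => D') (Eventually.of_forall fun _ => hD') hs0
  have hX1 := isPolySmall_entry_gt hX hs0
  have hX2 := isPolySmall_boundary hX hs0 hb (a := a') (by rw [hs]; linarith)
  refine ((((hH'.union hD1).union hD2).union hX1).union hX2).mono ?_
  filter_upwards [eventually_gt_atTop 1] with P hP
  intro ω hω
  by_contra hgood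
  simp only [Set.mem_union, Set.mem_ofPred_eq, not_or, not_exists, not_lt, not_and] at hgood
  obtain ⟨⟨⟨⟨g1, g2⟩, g3⟩, g4⟩, g5⟩ := hgood
  refine hω (quantize_eq_of_forall_boundary (sqrt_rpow_pos hP _)
    (δ := 3 * √P ^ (s - a')) (fun i c => ?_) fun p => ?_)
  · refine (norm_estimate_sub_le hP (by linarith) haa' (g1 i c) (g2 i c) (g3 i c)).trans_eq ?_
    rw [← Real.rpow_add (Real.sqrt_pos.2 (by linarith))]
    ring_nf
  · rintro ⟨k, hk⟩
    exact absurd hk (not_le.2 (not_le.1 (g5 p ((abs_toCoord_le _ p).trans (g4 _ _)) k)))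

end Estimate

/-! ### Zero-forcing schemes at a Gaussian estimate -/

section ZFScheme

variable {K : ℕ} {ν : Type} [Fintype ν] {V : Matrix (Fin K) ν ℂ → Matrix ν (Fin K) ℂ}

lemma IsZFScheme.isTameMatrixFun (hV : IsZFScheme V) (a : ν) (i : Fin K) :
    IsTameMatrixFun fun G => V G a i := (hV.expr a i).isTameMatrixFun

lemma IsZFScheme.measurable_entry (hV : IsZFScheme V) (a : ν) (i : Fin K) :
    Measurable fun G => V G a i := (hV.isTameMatrixFun a i).measurable

lemma IsZFScheme.hasSmallBall_signal (hV : IsZFScheme V) (i : Fin K) :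
    HasSmallBall (stdComplexNormalMatrix (Fin K) ν) fun G => ‖(G * V G) i i‖ := by
  refine IsTameMatrixFun.hasSmallBall (f := fun G => (G * V G) i i) ?_
    (hV.signal_ne_zero.mono fun G hG => hG i)
  simp only [Matrix.mul_apply]
  exact IsTameMatrixFun.sum _ fun a _ => (isTameMatrixFun_entry i a).mul (hV.isTameMatrixFun a i)

/-- The interference that leaks through an independent channel error is rarely small. -/
lemma IsZFScheme.hasSmallBall_leakage (hV : IsZFScheme V) (i l : Fin K) :
    HasSmallBall ((stdComplexNormalMatrix (Fin K) ν).prod (stdComplexNormalMatrix (Fin K) ν))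
      fun p => ‖(p.2 * V p.1) i l‖ := by
  obtain ⟨G, hG⟩ := hV.signal_ne_zero.exists
  obtain ⟨a⟩ : Nonempty ν := by
    by_contra h
    have := not_nonempty_iff.1 h
    exact hG i (by simp [Matrix.mul_apply])
  refine hasSmallBall_mul_indep hV.measurable_entry i l a ?_
  refine hasSmallBall_of_lintegral_inv (hV.measurable_entry a l).norm.aemeasurable ?_
  simpa only [ofReal_norm] using hV.inv_moment a l

end ZFScheme

section Gauge

variable {M K : ℕ} [NeZero M] {N : Fin M → ℕ}
  {V : Matrix (Fin K) (Ant N) ℂ → Matrix (Ant N) (Fin K) ℂ}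

/-- Unless a gauge of the estimate `G` is small, a small perturbation of the estimate causes a
small change of the precoder and a small correction. -/
lemma IsZFScheme.exists_gauge (hV : IsZFScheme V) :
    ∃ w : Matrix (Fin K) (Ant N) ℂ → ℝ, HasSmallBall (stdComplexNormalMatrix (Fin K) (Ant N)) w ∧
      ∀ G G' t r, 0 < t → t ≤ 1 → t ≤ w G → 0 ≤ r → r ≤ t → (∀ i a, ‖G' i a - G i a‖ ≤ r) →
        (∀ a l, ‖V G' a l - V G a l‖ ≤ (Fintype.card (Ant N) + 1) * (r / t ^ 2)) ∧
        ∀ l n, ‖correction G (V G) (V G') l n‖ ≤ (Fintype.card (Ant N) + 1) * (r / t ^ 2) := by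
  set F : (Ant N × Fin K) ⊕ (Fin K × Fin (N 0) × {a : Ant N // a.1 ≠ 0}) →
      Matrix (Fin K) (Ant N) ℂ → ℂ :=
    Sum.elim (fun p G => V G p.1 p.2) fun p G => correctionGain G p.1 p.2.1 p.2.2 with hF
  obtain ⟨w, hw, h⟩ := exists_matrix_gauge Finset.univ (F := F) (by
    rintro (p | p) -
    · exact hV.isTameMatrixFun p.1 p.2
    · exact isTameMatrixFun_correctionGain _ _ _)
  refine ⟨w, hw, fun G G' t r ht ht1 htw hr hrt hG => ?_⟩
  have hdiff : ∀ a l, ‖V G' a l - V G a l‖ ≤ r / t := fun a l => by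
    rw [le_div_iff₀' ht]
    exact (mul_le_mul_of_nonneg_right htw (norm_nonneg _)).trans
      ((h (Sum.inl (a, l)) (Finset.mem_univ _) G).2 G' r hr (hrt.trans htw) hG)
  have hgain : ∀ l n a, ‖correctionGain G l n a‖ ≤ 1 / t := fun l n a => by
    rw [le_div_iff₀' ht]
    exact (mul_le_mul_of_nonneg_right htw (norm_nonneg _)).trans
      (h (Sum.inr (l, n, a)) (Finset.mem_univ _) G).1
  have hrt2 : r / t ≤ r / t ^ 2 :=
    div_le_div_of_nonneg_left hr (by positivity) (pow_le_of_le_one ht.le ht1 two_ne_zero)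
  have hrt0 : 0 ≤ r / t ^ 2 := by positivity
  refine ⟨fun a l => (hdiff a l).trans (hrt2.trans ?_), fun l n => ?_⟩
  · exact le_mul_of_one_le_left hrt0 (by linarith [Nat.cast_nonneg (α := ℝ) (Fintype.card (Ant N))])
  · rw [correction_apply]
    refine (norm_sum_le _ _).trans ((Finset.sum_le_sum (g := fun _ => r / t ^ 2)
      fun a _ => ?_).trans ?_)
    · rw [norm_mul, norm_sub_rev]
      refine (mul_le_mul (hgain l n a) (hdiff a.1 l) (norm_nonneg _) (by positivity)).trans_eq ?_
      field_simp
    · rw [Finset.sum_const, nsmul_eq_mul]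
      refine mul_le_mul_of_nonneg_right ?_ hrt0
      have : (Fintype.card {a : Ant N // a.1 ≠ 0} : ℝ) ≤ Fintype.card (Ant N) := by
        exact_mod_cast Fintype.card_subtype_le _
      rw [Finset.card_univ]
      linarith

end Gauge

/-! ### The rate gap of the distributed scheme -/

section Gap

variable {Ω : Type*} [MeasurableSpace Ω] {μ : Measure Ω} [IsProbabilityMeasure μ]
  {M K : ℕ} [NeZero M] {N : Fin M → ℕ} {α : Fin M → ℝ} {H : Ω → Matrix (Fin K) (Ant N) ℂ}
  {Δ : Fin M → Ω → Matrix (Fin K) (Ant N) ℂ}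
  {V : Matrix (Fin K) (Ant N) ℂ → Matrix (Ant N) (Fin K) ℂ} {αq αμ : ℝ} {m : ℝ → ℝ}
  {e : ℝ → Fin M → Matrix (Fin K) (Ant N) ℂ → Matrix (Fin K) (Ant N) ℂ}
  {fallback : ℝ → Matrix (Fin K) (Ant N) ℂ → Matrix (Fin (N 0)) (Fin K) ℂ}

/-- Consistency: up to an event of polynomially small probability, all transmitters hold the
quantized estimate of the best-informed one, and the best-informed one knows it. -/
lemma isPolySmall_inconsistent (hα : Antitone α) (hH : IsDistributedCSIT μ H Δ) (hq0 : 0 < αq)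
    (hαq : ∀ j, αq < α j)
    (he : ∀ P, 1 < P → ∀ j, j ≠ 0 → IsMAPEstimator μ
      (fun ω => estimate P (α 0) (H ω) (Δ 0 ω))
      (fun ω => quantize (√P ^ (-αq)) (estimate P (α j) (H ω) (Δ j ω)))
      (Set.range (quantize (√P ^ (-αq)))) (e P j)) :
    IsPolySmall μ fun P => {ω | ∃ j, j ≠ 0 ∧
      ¬ (quantize (√P ^ (-αq)) (estimate P (α j) (H ω) (Δ j ω)) =
          quantize (√P ^ (-αq)) (estimate P (α 0) (H ω) (Δ 0 ω)) ∧
        e P j (estimate P (α 0) (H ω) (Δ 0 ω)) =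
          quantize (√P ^ (-αq)) (estimate P (α 0) (H ω) (Δ 0 ω)))} := by
  have h1 : ∀ j, IsPolySmall μ fun P =>
      {ω | quantize (√P ^ (-αq)) (estimate P (α j) (H ω) (Δ j ω)) ≠
        quantize (√P ^ (-αq)) (estimate P (α 0) (H ω) (Δ 0 ω))} := fun j =>
    isPolySmall_quantize_ne hq0 (hαq j) (hα (Fin.zero_le j)) hH.law_channel (hH.law_noise 0)
      (hH.law_noise j) (hH.indep 0)
  -- quantizing the own estimate is one possible decision rule, and the MAP rule is the best one
  have h2 : ∀ j : {j : Fin M // j ≠ 0}, IsPolySmall μ fun P =>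
      {ω | quantize (√P ^ (-αq)) (estimate P (α j) (H ω) (Δ j ω)) ≠
        e P j (estimate P (α 0) (H ω) (Δ 0 ω))} := fun j => by
    refine (h1 j).of_le ?_
    filter_upwards [eventually_gt_atTop 1] with P hP
    exact (he P hP j j.2).measure_ne_le
      (hasLaw_estimate hP (hq0.trans (hαq 0)) hH.law_channel (hH.law_noise 0)
        (hH.indep 0)).aemeasurable
      ((measurable_quantize _).comp_aemeasurable (hasLaw_estimate hP (hq0.trans (hαq j))
        hH.law_channel (hH.law_noise j) (hH.indep j)).aemeasurable)
      (measurable_quantize _) fun x => Set.mem_range_self x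
  refine ((isPolySmall_iUnion h1).union (isPolySmall_iUnion h2)).mono
    (Eventually.of_forall fun P => ?_)
  rintro ω ⟨j, hj, hω⟩
  by_contra hgood
  simp only [Set.mem_union, Set.mem_iUnion, Set.mem_ofPred_eq, not_or, not_exists, ne_eq,
    not_not] at hgood
  exact hω ⟨hgood.1 j, (hgood.2 ⟨j, hj⟩).symm.trans (hgood.1 j)⟩

omit [NeZero M] in
/-- The channel, its estimate `X` and the residual `Y` are in general position, up to an event of
polynomially small probability: no entry is large, `X` lies in a given full-measure set `A` and
has a large gauge `w`, and neither the signals nor the leakages through `Y` are small. -/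
lemma isPolySmall_degenerate {D : Ω → Matrix (Fin K) (Ant N) ℂ} {a ε : ℝ} (ha : 0 < a)
    (hε : 0 < ε) (hH : HasLaw H (stdComplexNormalMatrix (Fin K) (Ant N)) μ)
    (hD : HasLaw D (stdComplexNormalMatrix (Fin K) (Ant N)) μ) (hHD : IndepFun H D μ)
    (hV : IsZFScheme V) {w : Matrix (Fin K) (Ant N) ℂ → ℝ}
    (hw : HasSmallBall (stdComplexNormalMatrix (Fin K) (Ant N)) w)
    {A : Matrix (Fin K) (Ant N) ℂ → Prop}
    (hA : ∀ᵐ G ∂(stdComplexNormalMatrix (Fin K) (Ant N)), A G) :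
    IsPolySmall μ fun P => {ω | ¬ ((∀ i b, ‖H ω i b‖ ≤ √P ^ ε) ∧
      (∀ i b, ‖residual P a (H ω) (D ω) i b‖ ≤ √P ^ ε) ∧
      √P ^ (-ε) ≤ w (estimate P a (H ω) (D ω)) ∧ A (estimate P a (H ω) (D ω)) ∧
      (∀ i, √P ^ (-ε) ≤
        ‖(estimate P a (H ω) (D ω) * V (estimate P a (H ω) (D ω))) i i‖) ∧
      ∀ i l, √P ^ (-ε) ≤
        ‖(residual P a (H ω) (D ω) * V (estimate P a (H ω) (D ω))) i l‖)} := by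
  have hXY : ∀ᶠ P in atTop, HasLaw
      (fun ω => (estimate P a (H ω) (D ω), residual P a (H ω) (D ω)))
      ((stdComplexNormalMatrix (Fin K) (Ant N)).prod (stdComplexNormalMatrix (Fin K) (Ant N)))
      μ := by
    filter_upwards [eventually_gt_atTop 1] with P hP
    exact hasLaw_estimate_residual hP ha hH hD hHD
  have hX : ∀ᶠ P in atTop, HasLaw (fun ω => estimate P a (H ω) (D ω))
      (stdComplexNormalMatrix (Fin K) (Ant N)) μ :=
    hXY.mono fun P h => measurePreserving_fst.comp_hasLaw h
  have hY : ∀ᶠ P in atTop, HasLaw (fun ω => residual P a (H ω) (D ω))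
      (stdComplexNormalMatrix (Fin K) (Ant N)) μ :=
    hXY.mono fun P h => measurePreserving_snd.comp_hasLaw h
  have b1 := isPolySmall_entry_gt (X := fun _ => H) (Eventually.of_forall fun _ => hH) hε
  have b2 := isPolySmall_entry_gt hY hε
  have b3 := hw.isPolySmall hX hε
  have b4 : IsPolySmall μ fun P => {ω | ¬ A (estimate P a (H ω) (D ω))} := by
    refine isPolySmall_of_null (hX.mono fun P h => ?_)
    rw [← h.map_eq] at hA
    exact ae_iff.1 (ae_of_ae_map h.aemeasurable hA)
  have b5 := isPolySmall_iUnion fun i => (hV.hasSmallBall_signal i).isPolySmall hX hε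
  have b6 := isPolySmall_iUnion fun i => isPolySmall_iUnion fun l =>
    (hV.hasSmallBall_leakage i l).isPolySmall hXY hε
  refine (((((b1.union b2).union b3).union b4).union b5).union b6).mono
    (Eventually.of_forall fun P ω hω => ?_)
  by_contra hgood
  simp only [Set.mem_union, Set.mem_iUnion, Set.mem_ofPred_eq, not_or, not_exists, not_lt,
    not_not] at hgood
  obtain ⟨⟨⟨⟨⟨g1, g2⟩, g3⟩, g4⟩, g5⟩, g6⟩ := hgood
  exact hω ⟨g1, g2, g3, g4, g5, g6⟩

/-- Outside of an event of polynomially small probability, the distributed precoder changes the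
received amplitudes of the centralized one by a vanishing relative error only. -/
lemma exists_isPolySmall_relative_error (hN : K - 1 ≤ N 0) (hα : Antitone α)
    (hH : IsDistributedCSIT μ H Δ) (hV : IsZFScheme V) (hαq : ∀ j, αq < α j) (hαμ : 0 < αμ)
    (hαμq : αμ < αq) (hm : ∀ P, 1 < P → 0 < m P ∧ m P < 1)
    (hm_theta : (fun P => 1 - m P) =Θ[atTop] fun P : ℝ => √P ^ (-αμ))
    (he : ∀ P, 1 < P → ∀ j, j ≠ 0 → IsMAPEstimator μ
      (fun ω => estimate P (α 0) (H ω) (Δ 0 ω))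
      (fun ω => quantize (√P ^ (-αq)) (estimate P (α j) (H ω) (Δ j ω)))
      (Set.range (quantize (√P ^ (-αq)))) (e P j)) :
    ∃ ε : ℝ, 0 < ε ∧ ∃ F : ℝ → Set Ω, IsPolySmall μ F ∧ ∀ᶠ P in atTop, ∀ ω, ω ∉ F P → ∀ i l,
      ‖(H ω * V (estimate P (α 0) (H ω) (Δ 0 ω))) i l -
        (H ω * cdzf V (√P ^ (-αq)) (m P) (e P) (fallback P)
          fun j => estimate P (α j) (H ω) (Δ j ω)) i l‖ ≤
      √P ^ (-ε) * ‖(H ω * V (estimate P (α 0) (H ω) (Δ 0 ω))) i l‖ := by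
  have hq0 : 0 < αq := hαμ.trans hαμq
  have hα0 : 0 < α 0 := hq0.trans (hαq 0)
  -- all random quantities are compared to `√P ^ (-ε)` and `√P ^ ε`; a few such factors must not
  -- outweigh the gaps between `1`, the back-off and the quantization step
  obtain ⟨ε, hε, hε1, hε2⟩ : ∃ ε : ℝ, 0 < ε ∧ 4 * ε < αμ ∧ 4 * ε < αq - αμ := by
    refine ⟨min αμ (αq - αμ) / 8, by have := lt_min hαμ (sub_pos.2 hαμq); linarith, ?_, ?_⟩
    · have := min_le_left αμ (αq - αμ); linarith
    · have := min_le_right αμ (αq - αμ); linarith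
  obtain ⟨w, hw, hgauge⟩ := hV.exists_gauge
  have hbad := (isPolySmall_degenerate hα0 hε hH.law_channel (hH.law_noise 0) (hH.indep 0) hV hw
    (hV.zero_forcing.and (ae_crossChannel_mul_pinv hN))).union
    (isPolySmall_inconsistent hα hH hq0 hαq he)
  refine ⟨ε, hε, _, hbad, ?_⟩
  obtain ⟨C, hC, hCm⟩ := hm_theta.1.exists_pos
  obtain ⟨C', hC', hCm'⟩ := hm_theta.2.exists_pos
  set L : ℝ := ((Fintype.card (Ant N) : ℕ) : ℝ) with hL
  have hL0 : 0 ≤ L := Nat.cast_nonneg _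
  have s1 := eventually_const_mul_sqrt_rpow_le (C' * ((K + 1) * (L + 1)))
    (a := 2 * ε - αq) (b := -αμ) (by linarith)
  have s2 := eventually_const_mul_sqrt_rpow_le (8 * L * C) (a := ε - αμ) (b := -2 * ε)
    (by linarith)
  have s3 := eventually_const_mul_sqrt_rpow_le (4 * L) (a := ε - α 0) (b := -ε)
    (by linarith [hαq 0])
  have s4 := (tendsto_sqrt_rpow_neg hα0).eventually_le_const (show (0 : ℝ) < 1 / 2 by norm_num)
  filter_upwards [s1, s2, s3, s4, hCm.bound, hCm'.bound, eventually_gt_atTop 1]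
    with P h1 h2 h3 h4 hb1 hb2 hP ω hω
  obtain ⟨hω1, hω2⟩ := not_or.1 hω
  obtain ⟨g1, g2, g3, ⟨g4, g5⟩, g6, g7⟩ := not_not.1 hω1
  have g8 := fun j hj => not_not.1 fun h => hω2 ⟨j, hj, h⟩
  obtain ⟨hm0, hm1⟩ := hm P hP
  have hx0 : 0 < √P := Real.sqrt_pos.2 (by linarith)
  have hpow : ∀ a : ℝ, 0 < √P ^ a := fun a => sqrt_rpow_pos hP a
  have hmul : ∀ a b : ℝ, √P ^ a * √P ^ b = √P ^ (a + b) := fun a b => (Real.rpow_add hx0 a b).symm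
  rw [Real.norm_of_nonneg (sub_pos.2 hm1).le, Real.norm_of_nonneg (hpow _).le] at hb1 hb2
  set X := estimate P (α 0) (H ω) (Δ 0 ω) with hXdef
  set t := √P ^ (-ε) with ht
  set r := √P ^ (-αq) with hr
  have hrt : r ≤ t := Real.rpow_le_rpow_of_exponent_le (Real.one_le_sqrt.2 hP.le) (by linarith)
  -- the size of the correction and of the deviation of the other transmitters
  set κ := (L + 1) * (r / t ^ 2) with hκ
  have hκ0 : 0 ≤ κ := by have := hpow (-αq); positivity
  obtain ⟨hdiff, hcorr⟩ := hgauge X (quantize r X) t r (hpow _) (sqrt_rpow_neg_le_one hP hε) g3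
    (hpow _).le hrt fun i a => norm_quantize_sub_le (hpow _) X i a
  have hrt2 : r / t ^ 2 = √P ^ (2 * ε - αq) := by
    rw [div_eq_iff (by have := hpow (-ε); positivity), pow_two, hmul, hmul, hr]
    ring_nf
  have hκm : (K + 1) * κ ≤ 1 - m P := by
    rw [hκ, hrt2]
    refine le_of_mul_le_mul_left ?_ hC'
    linarith
  have hK0 : (0 : ℝ) ≤ K := Nat.cast_nonneg _
  obtain ⟨hz, ho, hclose⟩ := cdzf_close (V := V) (m := m P) (q := r) (e := e P)
    (fallback := fallback P) (G := fun j => estimate P (α j) (H ω) (Δ j ω)) (X' := quantize r X)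
    hV.power hm0.le hm1.le (fun j hj => (g8 j hj).1) (fun j hj => (g8 j hj).2) hκ0
    (by linarith) hdiff hcorr
  have hzf : ∀ i l, i ≠ l → (X * cdzf V r (m P) (e P) (fallback P)
      fun j => estimate P (α j) (H ω) (Δ j ω)) i l = 0 := fun i l hil =>
    zero_forcing_of_correction hil (g5 l) (g4 i l hil.symm) (fun n => hz n l)
      fun a ha => ho a ha l
  -- since `κ` fits into the back-off, the total deviation is of the order of the back-off
  have hη : κ + (1 - m P) ≤ 2 * (C * √P ^ (-αμ)) := by nlinarith [mul_nonneg hK0 hκ0]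
  refine relative_error_le (s := t) (δ := t) (b := √P ^ ε)
    (eq_estimate_sub_residual hP hα0 (H ω) (Δ 0 ω)) ?_ (hpow _).le (hpow _).le (hpow _).le
    (hpow _).le g1 g2 (fun a l => (hV.power X).norm_entry_le a l) hclose
    (fun i l hil => g4 i l hil.symm) hzf g6 g7 ?_ ?_
  · exact le_trans (by linarith) (one_sub_le_sqrt_one_sub_sq (hpow _).le (by linarith))
  · calc L * (√P ^ ε * (κ + (1 - m P))) ≤ L * (√P ^ ε * (2 * (C * √P ^ (-αμ)))) :=
        mul_le_mul_of_nonneg_left (mul_le_mul_of_nonneg_left hη (hpow _).le) hL0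
      _ = 8 * L * C * √P ^ (ε - αμ) / 4 := by
        rw [sub_eq_add_neg, ← hmul]; ring
      _ ≤ √P ^ (-2 * ε) / 4 := by linarith
      _ = t * (t / 4) := by
        rw [← mul_div_assoc, hmul]; ring_nf
  · calc √P ^ (-α 0) * (L * √P ^ ε) = 4 * L * √P ^ (ε - α 0) / 4 := by
          rw [sub_eq_add_neg, ← hmul]; ring
      _ ≤ t / 4 := by linarith

end Gap

lemma HasAffineExpansion.congr {R R' : ℝ → ℝ} {dof offset : ℝ}
    (hR : HasAffineExpansion R dof offset) (h : Tendsto (fun P => R P - R' P) atTop (𝓝 0)) :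
    HasAffineExpansion R' dof offset := by
  have h1 := Tendsto.sub hR h
  rw [sub_zero] at h1
  exact h1.congr fun P => by ring

end

end NetworkMISO
theorem theorem1 {Ω : Type*} [MeasurableSpace Ω] (μ : Measure Ω) [IsProbabilityMeasure μ]
    {M K : ℕ} [NeZero M] (N : Fin M → ℕ) (hN : K - 1 ≤ N 0)
    -- accuracy exponents, sorted, the first transmitter being the best informed one
    (α : Fin M → ℝ) (hα : StrictAnti α) (hα_le : α 0 ≤ 1) (hα_pos : ∀ j, 0 < α j)
    -- channel, estimation noises
    (H : Ω → Matrix (Fin K) (Ant N) ℂ) (Δ : Fin M → Ω → Matrix (Fin K) (Ant N) ℂ)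
    (hH : IsDistributedCSIT μ H Δ)
    -- centralized zero-forcing algorithm
    (V : Matrix (Fin K) (Ant N) ℂ → Matrix (Ant N) (Fin K) ℂ) (hV : IsZFScheme V)
    -- quantization and power back-off
    (αq αμ : ℝ) (hαq : ∀ j, αq < α j) (hαμ : 0 < αμ) (hαμq : αμ < αq)
    (m : ℝ → ℝ) (hm : ∀ P, 1 < P → 0 < m P ∧ m P < 1)
    (hm_theta : (fun P => 1 - m P) =Θ[atTop] fun P : ℝ => √P ^ (-αμ))
    -- MAP estimation at the best-informed transmitter of the quantized estimates of the others
    (e : ℝ → Fin M → Matrix (Fin K) (Ant N) ℂ → Matrix (Fin K) (Ant N) ℂ)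
    (he : ∀ P, 1 < P → ∀ j, j ≠ 0 → IsMAPEstimator μ
      (fun ω => estimate P (α 0) (H ω) (Δ 0 ω))
      (fun ω => quantize (√P ^ (-αq)) (estimate P (α j) (H ω) (Δ j ω)))
      (Set.range (quantize (√P ^ (-αq)))) (e P j))
    -- behaviour of the best-informed transmitter in power outage
    (fallback : ℝ → Matrix (Fin K) (Ant N) ℂ → Matrix (Fin (N 0)) (Fin K) ℂ)
    (hfm : ∀ P, Measurable (fallback P)) (hfp : ∀ P G, PowerFeasible (fallback P G))
    -- estimates, centralized precoder, distributed precoder, and the two expected sum rates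
    (Hhat : ℝ → Fin M → Ω → Matrix (Fin K) (Ant N) ℂ)
    (hHhat : Hhat = fun P j ω => estimate P (α j) (H ω) (Δ j ω))
    (Tc Td : ℝ → Ω → Matrix (Ant N) (Fin K) ℂ)
    (hTc : Tc = fun P ω => V (Hhat P 0 ω))
    (hTd : Td = fun P ω => cdzf V (√P ^ (-αq)) (m P) (e P) (fallback P) fun j => Hhat P j ω)
    (Rc Rd : ℝ → ℝ)
    (hRc : Rc = fun P => expectedSumRate μ P H (Tc P))
    (hRd : Rd = fun P => expectedSumRate μ P H (Td P)) :
    -- both precoders satisfy the power constraint, and the expected rates are well defined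
    (∀ P, 1 < P → (∀ ω, PowerFeasible (Tc P ω) ∧ PowerFeasible (Td P ω)) ∧
      ∀ i, Integrable (fun ω => instRate P (H ω) (Tc P ω) i) μ ∧
        Integrable (fun ω => instRate P (H ω) (Td P ω) i) μ) ∧
    -- the rate gap vanishes
    Tendsto (fun P => Rc P - Rd P) atTop (𝓝 0) ∧
    -- the two settings have the same high-SNR affine expansions, in particular the rate offsets
    (∀ dof offset : ℝ, HasAffineExpansion Rc dof offset ↔ HasAffineExpansion Rd dof offset) := by
  subst hHhat hTc hTd hRc hRd
  have hq0 : 0 < αq := hαμ.trans hαμq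
  have hlaw : ∀ P, 1 < P → ∀ j, HasLaw (fun ω => estimate P (α j) (H ω) (Δ j ω))
      (stdComplexNormalMatrix (Fin K) (Ant N)) μ := fun P hP j =>
    hasLaw_estimate hP (hα_pos j) hH.law_channel (hH.law_noise j) (hH.indep j)
  have hTcp : ∀ P, 1 < P → ∀ ω, PowerFeasible (V (estimate P (α 0) (H ω) (Δ 0 ω))) :=
    fun P _ ω => hV.power _
  have hTdp : ∀ P, 1 < P → ∀ ω, PowerFeasible (cdzf V (√P ^ (-αq)) (m P) (e P) (fallback P)
      fun j => estimate P (α j) (H ω) (Δ j ω)) := fun P hP ω =>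
    powerFeasible_cdzf hV.power (hm P hP).1.le (hm P hP).2.le (hfp P)
  have hTcm : ∀ P, 1 < P → AEMeasurable (fun ω => V (estimate P (α 0) (H ω) (Δ 0 ω))) μ :=
    fun P hP => (measurable_matrix hV.measurable_entry).comp_aemeasurable (hlaw P hP 0).aemeasurable
  have hTdm : ∀ P, 1 < P → AEMeasurable (fun ω => cdzf V (√P ^ (-αq)) (m P) (e P) (fallback P)
      fun j => estimate P (α j) (H ω) (Δ j ω)) μ := fun P hP =>
    (measurable_cdzf hV.measurable_entry (fun j hj => (he P hP j hj).measurable)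
      (hfm P)).comp_aemeasurable (aemeasurable_pi_lambda _ fun j => (hlaw P hP j).aemeasurable)
  obtain ⟨ε, hε, F, hF, hrel⟩ := exists_isPolySmall_relative_error (fallback := fallback) hN
    hα.antitone hH hV hαq hαμ hαμq hm hm_theta he
  have hgap := tendsto_expectedSumRate_sub hH.law_channel hTcm hTdm hTcp hTdp
    (Eventually.of_forall fun P => Real.rpow_nonneg (Real.sqrt_nonneg P) (-ε))
    (tendsto_sqrt_rpow_neg hε) hF hrel
  refine ⟨fun P hP => ⟨fun ω => ⟨hTcp P hP ω, hTdp P hP ω⟩, fun i =>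
    ⟨integrable_instRate (by linarith) hH.law_channel (hTcm P hP) (hTcp P hP) i,
      integrable_instRate (by linarith) hH.law_channel (hTdm P hP) (hTdp P hP) i⟩⟩, hgap,
    fun dof offset => ⟨fun h => h.congr hgap, fun h => h.congr ?_⟩⟩
  simpa using hgap.neg
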